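/- **Notation.** For $\gamma\in(0,\tfrac12)$, $0<\alpha<\tfrac{1-2\gamma}{2}$ and $\alpha<\beta<\alpha+\gamma$ put $$p=\frac{2}{1-2\gamma+2(\beta-\alpha)},\qquad \|u\|_{\gamma,\alpha}^2=\int_{\mathbb R}\int_{\mathbb R}\frac{(u(x)-u(y))^2}{|x-y|^{1+2\gamma}|x|^\alpha|y|^\alpha}\,dy\,dx ,$$ let $D_{\gamma,\alpha}(\mathbb R)$ be the completion of $C_c^\infty(\mathbb R)$ with respect to $\|\cdot\|_{\gamma,\alpha}$ (a space of functions modulo null sets), and let $$S_\gamma(\alpha,\beta)=\inf_{w\in D_{\gamma,\alpha}(\mathbb R)\setminus\{0\}}\frac{\|w\|_{\gamma,\alpha}^2}{\left(\int_{\mathbb R}|x|^{-\beta p}|w|^p\,dx\right)^{2/p}} .$$ A function $u\in D_{\gamma,\alpha}(\mathbb R)$ is a weak solution of $\mathcal L_{\gamma,\alpha}u=F$, where $\mathcal L_{\gamma,\alpha}u(x)=\mathrm{PV}\int_{\mathbb R}\frac{u(x)-u(y)}{|x-y|^{1+2\gamma}|x|^\alpha|y|^\alpha}\,dy$, if for all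 $\phi\in C_c^\infty(\mathbb R)$ $$\frac12\int_{\mathbb R}\int_{\mathbb R}\frac{(u(x)-u(y))(\phi(x)-\phi(y))}{|x-y|^{1+2\gamma}|x|^\alpha|y|^\alpha}\,dy\,dx=\int_{\mathbb R}F\phi\,dx .$$ **Lemma 4.6.** Let $\varepsilon>0$ run through a sequence tending to $0$, and let $\gamma_\varepsilon\in(0,\tfrac12)$, $\alpha_\varepsilon$, $\beta_\varepsilon$ satisfy $$0<\alpha_\varepsilon<\min\Big\{\beta_\varepsilon,\frac{1-2\gamma_\varepsilon}{2}\Big\},\qquad \beta_\varepsilon<\alpha_\varepsilon+\gamma_\varepsilon,\qquad \gamma_\varepsilon\to\tfrac12,\quad \beta_\varepsilon\to0,$$ $$\varepsilon p_\varepsilon\to a\in(0,\infty),\qquad \beta_\varepsilon p_\varepsilon\to b\in[0,1)\qquad\text{as }\varepsilon\downarrow0,$$ where $p_\varepsilon$ is the exponent $p$ for these parameters. For every $\varepsilon$ of the sequence let $u_\varepsilon$ be a positive even minimizer for $S_{\gamma_\varepsilon}(\alpha_\varepsilon,\beta_\varepsilon)$, normalized so that, in the weak sense, $$\mathcal L_{\gamma_\varepsilon,\alpha_\varepsilon}u_\varepsilon=\frac1{p_\varepsilon}\,\frac{u_\varepsilon^{\,p_\varepsilon-1}}{|x|^{\beta_\varepsilon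 p_\varepsilon}}\ \text{ in }\mathbb R,\qquad \max_{[-1,1]}u_\varepsilon=1$$ (the maximum being understood as an essential supremum, which it equals when $u_\varepsilon$ is continuous). Set $\eta_\varepsilon=p_\varepsilon(u_\varepsilon-1)$. Then there is a constant $C$, independent of $\varepsilon$, such that for every $\varepsilon$ of the sequence $$\int_{\mathbb R}\frac{|\eta_\varepsilon(x)|}{1+|x|^{1+2\gamma_\varepsilon+\alpha_\varepsilon}}\,dx\le C .$$ -/

import Mathlib

open MeasureTheory Filter Topology
open scoped ENNReal

noncomputable section

namespace CKN

/-- The exponent `p = 2 / (1 - 2γ + 2(β - α))` (dimension one). -/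
def exponent (γ α β : ℝ) : ℝ := 2 / (1 - 2 * γ + 2 * (β - α))

/-- The kernel `G_{γ,α}(x,y) = 1 / (|x - y|^{1+2γ} |x|^α |y|^α)` (dimension one). -/
def kernel (γ α x y : ℝ) : ℝ := 1 / (|x - y| ^ (1 + 2 * γ) * |x| ^ α * |y| ^ α)

/-- The squared weighted norm `‖u‖²_{γ,α} = ∬ (u(x) - u(y))² G_{γ,α}(x,y) dy dx`, in `[0,∞]`.
The integrand is nonnegative, so that no principal value is needed. -/
def normSq (γ α : ℝ) (u : ℝ → ℝ) : ℝ≥0∞ :=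
  ∫⁻ x, ∫⁻ y, ENNReal.ofReal ((u x - u y) ^ 2 * kernel γ α x y)

/-- Test functions: `C_c^∞(ℝ)`. -/
def IsTestFunction (φ : ℝ → ℝ) : Prop :=
  ContDiff ℝ ((⊤ : ℕ∞) : WithTop ℕ∞) φ ∧ HasCompactSupport φ

/-- The space `D_{γ,α}(ℝ)`, the completion of `C_c^∞(ℝ)` for `‖·‖_{γ,α}`, realized as a space of
(almost everywhere defined) functions: `u` belongs to it when it is the limit in `‖·‖_{γ,α}` of
test functions that converge to `u` almost everywhere as well. The second requirement picks, among
the functions `u + c`, which are at distance zero from each other, the one that represents the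
element of the completion. -/
def MemD (γ α : ℝ) (u : ℝ → ℝ) : Prop :=
  ∃ φ : ℕ → ℝ → ℝ, (∀ n, IsTestFunction (φ n)) ∧
    Tendsto (fun n => normSq γ α (fun x => u x - φ n x)) atTop (𝓝 0) ∧
    ∀ᵐ x, Tendsto (fun n => φ n x) atTop (𝓝 (u x))

/-- The quotient `E_{γ,α,β}[u] = ‖u‖²_{γ,α} / (∫ |x|^{-βp} |u|^p dx)^{2/p}`. -/
def energy (γ α β : ℝ) (u : ℝ → ℝ) : ℝ≥0∞ :=
  normSq γ α u /
    (∫⁻ x, ENNReal.ofReal (|u x| ^ exponent γ α β / |x| ^ (β * exponent γ α β))) ^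
      (2 / exponent γ α β)

/-- The best constant `S_γ(α,β) = inf { E_{γ,α,β}[w] : w ∈ D_{γ,α} \ {0} }`. -/
def bestConstant (γ α β : ℝ) : ℝ≥0∞ :=
  ⨅ w ∈ {w : ℝ → ℝ | MemD γ α w ∧ ¬ w =ᵐ[volume] 0}, energy γ α β w

/-- `u` is a minimizer for `S_γ(α,β)`. -/
def IsMinimizer (γ α β : ℝ) (u : ℝ → ℝ) : Prop :=
  MemD γ α u ∧ ¬ u =ᵐ[volume] 0 ∧ energy γ α β u = bestConstant γ α β

/-- `u` is a weak (energy) solution of `𝓛_{γ,α} u = F` in `ℝ`, where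
`𝓛_{γ,α} u(x) = PV ∫ (u(x) - u(y)) G_{γ,α}(x,y) dy`. -/
def IsWeakSolution (γ α : ℝ) (u F : ℝ → ℝ) : Prop :=
  MemD γ α u ∧ ∀ φ : ℝ → ℝ, IsTestFunction φ →
    1 / 2 * ∫ z : ℝ × ℝ, (u z.1 - u z.2) * (φ z.1 - φ z.2) * kernel γ α z.1 z.2
      = ∫ x, F x * φ x

/-- The normalized minimizers: positive and even minimizers that solve
`𝓛_{γ,α} u = (1/p) |x|^{-βp} u^{p-1}` and whose maximum over `[-1,1]` is `1`. Elements of `D_{γ,α}`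
are classes of functions modulo null sets, so positivity and evenness hold almost everywhere and
the maximum is the essential one: `1` is the least essential upper bound of `u` on `[-1,1]`, which
is the maximum in the ordinary sense when `u` is continuous. -/
structure IsNormalizedMinimizer (γ α β : ℝ) (u : ℝ → ℝ) : Prop where
  minimizer : IsMinimizer γ α β u
  pos : ∀ᵐ x, 0 < u x
  even : ∀ᵐ x, u (-x) = u x
  equation : IsWeakSolution γ α u (fun x =>
    1 / exponent γ α β * (1 / |x| ^ (β * exponent γ α β)) * u x ^ (exponent γ α β - 1))
  max_eq_one : IsLeast {m : ℝ | ∀ᵐ x ∂(volume.restrict (Set.Icc (-1 : ℝ) 1)), u x ≤ m} 1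

/-- `η = p (u - 1)`. -/
def eta (γ α β : ℝ) (u : ℝ → ℝ) (x : ℝ) : ℝ := exponent γ α β * (u x - 1)

end CKN

end

/-!
The exponent `p` tends to infinity, and `η = p (u - 1)` is controlled by two mechanisms.

**Growth.** For `v = |x|^{-α} u` the ground state representation (`normSq_add_hardy`) writes
the weighted energy of `u` as the unweighted energy of `v` minus a nonnegative multiple of
`∫ v² |x|^{-2γ}`. Polarization of `v` with respect to a reflection at `c > 0` therefore does not
increase the energy (`normSq_polarize_le`), while it strictly increases
`∫ |x|^{-βp} u^p = ∫ v^p |x|^{-(β-α)p}` unless `v(2c - x) ≤ v(x)` for almost all `x < c`. Hence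
`|x|^{-α} u` of a minimizer is symmetric decreasing, and `u ≤ 1` on `[-1,1]` gives `u ≤ |x|^α`
outside (`ae_le_rpow_of_isNormalizedMinimizer`). As `α p < 1`, this bounds `η` from above by
`|x|^σ / σ` for every `σ ≥ α`.

That polarization stays in `D_{γ,α}` rests on a Mazur-type closedness property of energy
limits (`EnergyLimit.of_bounded`) and on the density of test functions among bounded compactly
supported functions of finite energy (`energyLimit_of_bounded_support`).

**Maximum principle.** The operator maps `|x|^σ` to `-c_σ |x|^{σ-s}` with `s = 2γ + 2α`
(`integral_powDiff`), and averaging over the substitution `s ↦ s⁻¹` shows that `c_σ` is bounded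
above and below by positive constants as `γ → 1/2` (`le_powConst`, `exists_powConst_le`). Since
`βp → b < 1`, for a fixed small `σ` and a large `Λ` the function
`z = η + Λ (|x|^σ - |x|^{2σ})` satisfies `𝓛 z ≤ C` uniformly: the barrier absorbs the singularity
`|x|^{-βp}` of the right-hand side. By the growth bound `z ≤ -1` outside a fixed interval, and
`z > -1` somewhere in `[-1,1]` because `max u = 1` there. Testing the equation with `(z + 1)⁺`
then bounds the weighted integral of `(z + 1)⁻` (`lintegral_negPart_le`), and `|η|` is bounded by
this negative part and fixed powers of `|x|`.
-/

noncomputable section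

namespace CKN

/-! ### The kernel and the energy -/

theorem kernel_nonneg (γ α x y : ℝ) : 0 ≤ kernel γ α x y := by
  unfold kernel; positivity

theorem kernel_symm (γ α x y : ℝ) : kernel γ α x y = kernel γ α y x := by
  unfold kernel; rw [abs_sub_comm, mul_assoc, mul_assoc, mul_comm (|x| ^ α)]

theorem kernel_pos {γ α x y : ℝ} (hx : x ≠ 0) (hy : y ≠ 0) (hxy : x ≠ y) :
    0 < kernel γ α x y := by
  have h1 : 0 < |x - y| := abs_pos.2 (sub_ne_zero.2 hxy)
  have h2 : 0 < |x| := abs_pos.2 hx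
  have h3 : 0 < |y| := abs_pos.2 hy
  unfold kernel; positivity

@[fun_prop]
theorem measurable_kernel (γ α : ℝ) : Measurable (fun z : ℝ × ℝ => kernel γ α z.1 z.2) := by
  unfold kernel; fun_prop

theorem aemeasurable_diff {u : ℝ → ℝ} (hu : AEMeasurable u) :
    AEMeasurable (fun z : ℝ × ℝ => u z.1 - u z.2) :=
  (hu.comp_quasiMeasurePreserving Measure.quasiMeasurePreserving_fst).sub
    (hu.comp_quasiMeasurePreserving Measure.quasiMeasurePreserving_snd)

theorem aemeasurable_energy_density (γ α : ℝ) {u : ℝ → ℝ} (hu : AEMeasurable u) :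
    AEMeasurable (fun z : ℝ × ℝ => ENNReal.ofReal ((u z.1 - u z.2) ^ 2 * kernel γ α z.1 z.2)) :=
  (((aemeasurable_diff hu).pow_const 2).mul (measurable_kernel γ α).aemeasurable).ennreal_ofReal

theorem normSq_eq_lintegral_prod (γ α : ℝ) {u : ℝ → ℝ} (hu : AEMeasurable u) :
    normSq γ α u
      = ∫⁻ z : ℝ × ℝ, ENNReal.ofReal ((u z.1 - u z.2) ^ 2 * kernel γ α z.1 z.2) := by
  unfold normSq
  rw [Measure.volume_eq_prod, lintegral_prod _ (aemeasurable_energy_density γ α hu)]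

theorem normSq_congr (γ α : ℝ) {u w : ℝ → ℝ} (h : u =ᵐ[volume] w) :
    normSq γ α u = normSq γ α w := by
  unfold normSq
  refine lintegral_congr_ae ?_
  filter_upwards [h] with x hx
  refine lintegral_congr_ae ?_
  filter_upwards [h] with y hy
  rw [hx, hy]

theorem normSq_le_of_abs_diff_le {γ α : ℝ} {u w : ℝ → ℝ}
    (h : ∀ x y, |w x - w y| ≤ |u x - u y|) : normSq γ α w ≤ normSq γ α u := by
  unfold normSq
  refine lintegral_mono fun x => lintegral_mono fun y => ENNReal.ofReal_le_ofReal ?_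
  exact mul_le_mul_of_nonneg_right (sq_le_sq.2 (h x y)) (kernel_nonneg ..)

theorem normSq_sub_comm (γ α : ℝ) (u w : ℝ → ℝ) :
    normSq γ α (fun x => u x - w x) = normSq γ α (fun x => w x - u x) := by
  unfold normSq
  congr 1; ext x; congr 1; ext y; congr 2; ring

theorem normSq_const_mul (γ α c : ℝ) (u : ℝ → ℝ) :
    normSq γ α (fun x => c * u x) = ENNReal.ofReal (c ^ 2) * normSq γ α u := by
  unfold normSq
  rw [← lintegral_const_mul' _ _ ENNReal.ofReal_ne_top]
  congr 1; ext x
  rw [← lintegral_const_mul' _ _ ENNReal.ofReal_ne_top]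
  congr 1; ext y
  rw [← ENNReal.ofReal_mul (sq_nonneg c)]
  congr 1; ring

/-- The parallelogram identity. It holds in `[0,∞]`, without finiteness of the energies. -/
theorem normSq_parallelogram (γ α : ℝ) {u w : ℝ → ℝ} (hu : AEMeasurable u) (hw : AEMeasurable w) :
    normSq γ α (fun x => u x - w x) + normSq γ α (fun x => u x + w x)
      = 2 * normSq γ α u + 2 * normSq γ α w := by
  rw [normSq_eq_lintegral_prod γ α hu, normSq_eq_lintegral_prod γ α hw,
    normSq_eq_lintegral_prod γ α (u := fun x => u x - w x) (hu.sub hw),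
    normSq_eq_lintegral_prod γ α (u := fun x => u x + w x) (hu.add hw),
    ← lintegral_add_left'
      (aemeasurable_energy_density γ α (u := fun x => u x - w x) (hu.sub hw)),
    ← lintegral_const_mul' _ _ (by simp), ← lintegral_const_mul' _ _ (by simp),
    ← lintegral_add_left' ((aemeasurable_energy_density γ α hu).const_mul 2)]
  congr 1; ext z
  have hk := kernel_nonneg γ α z.1 z.2
  have h2 : (2 : ℝ≥0∞) = ENNReal.ofReal 2 := by simp
  rw [h2, ← ENNReal.ofReal_mul (by norm_num), ← ENNReal.ofReal_mul (by norm_num),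
    ← ENNReal.ofReal_add (by positivity) (by positivity),
    ← ENNReal.ofReal_add (by positivity) (by positivity)]
  congr 1; ring

theorem normSq_add_le (γ α : ℝ) {u w : ℝ → ℝ} (hu : AEMeasurable u) (hw : AEMeasurable w) :
    normSq γ α (fun x => u x + w x) ≤ 2 * normSq γ α u + 2 * normSq γ α w := by
  rw [← normSq_parallelogram γ α hu hw]; exact le_add_self

theorem normSq_sub_le (γ α : ℝ) {u w : ℝ → ℝ} (hu : AEMeasurable u) (hw : AEMeasurable w) :
    normSq γ α (fun x => u x - w x) ≤ 2 * normSq γ α u + 2 * normSq γ α w := by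
  rw [← normSq_parallelogram γ α hu hw]; exact le_self_add

theorem normSq_le_add_sub (γ α : ℝ) {u w : ℝ → ℝ} (hu : AEMeasurable u) (hw : AEMeasurable w) :
    normSq γ α u ≤ 2 * normSq γ α (fun x => u x - w x) + 2 * normSq γ α w := by
  have := normSq_add_le γ α (u := fun x => u x - w x) (hu.sub hw) hw
  simpa only [sub_add_cancel] using this

/-- Fatou's lemma for the energy. -/
theorem normSq_le_liminf (γ α : ℝ) {w : ℕ → ℝ → ℝ} {u : ℝ → ℝ} (hw : ∀ n, AEMeasurable (w n))
    (h : ∀ᵐ x, Tendsto (fun n => w n x) atTop (𝓝 (u x))) :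
    normSq γ α u ≤ liminf (fun n => normSq γ α (w n)) atTop := by
  have hu : AEMeasurable u := aemeasurable_of_tendsto_metrizable_ae' hw h
  simp_rw [normSq_eq_lintegral_prod γ α hu, normSq_eq_lintegral_prod γ α (hw _)]
  refine le_trans (lintegral_mono_ae ?_)
    (lintegral_liminf_le' fun n => aemeasurable_energy_density γ α (hw n))
  have h1 := Measure.quasiMeasurePreserving_fst (μ := (volume : Measure ℝ))
    (ν := (volume : Measure ℝ)) |>.ae h
  have h2 := Measure.quasiMeasurePreserving_snd (μ := (volume : Measure ℝ))
    (ν := (volume : Measure ℝ)) |>.ae h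
  rw [← Measure.volume_eq_prod] at h1 h2
  filter_upwards [h1, h2] with z hz1 hz2
  have : Tendsto (fun n => ENNReal.ofReal ((w n z.1 - w n z.2) ^ 2 * kernel γ α z.1 z.2)) atTop
      (𝓝 (ENNReal.ofReal ((u z.1 - u z.2) ^ 2 * kernel γ α z.1 z.2))) :=
    ENNReal.tendsto_ofReal (((hz1.sub hz2).pow 2).mul_const _)
  rw [this.liminf_eq]

/-! ### Energy limits and a Mazur-type closedness lemma -/

/-- `u` is the limit, in the energy `‖·‖_{γ,α}` and almost everywhere, of functions of the class
`A`. For the class of test functions this is membership in `D_{γ,α}`; smaller classes record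
uniform bounds on the approximating functions. -/
def EnergyLimit (γ α : ℝ) (A : Set (ℝ → ℝ)) (u : ℝ → ℝ) : Prop :=
  ∃ φ : ℕ → ℝ → ℝ, (∀ n, φ n ∈ A) ∧
    Tendsto (fun n => normSq γ α (fun x => u x - φ n x)) atTop (𝓝 0) ∧
    ∀ᵐ x, Tendsto (fun n => φ n x) atTop (𝓝 (u x))

theorem memD_iff_energyLimit {γ α : ℝ} {u : ℝ → ℝ} :
    MemD γ α u ↔ EnergyLimit γ α {φ | IsTestFunction φ} u := Iff.rfl

theorem EnergyLimit.mono {γ α : ℝ} {A B : Set (ℝ → ℝ)} {u : ℝ → ℝ} (h : EnergyLimit γ α A u)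
    (hAB : A ⊆ B) : EnergyLimit γ α B u := by
  obtain ⟨φ, h1, h2⟩ := h
  exact ⟨φ, fun n => hAB (h1 n), h2⟩

theorem EnergyLimit.aemeasurable {γ α : ℝ} {A : Set (ℝ → ℝ)} {u : ℝ → ℝ}
    (h : EnergyLimit γ α A u) (hA : ∀ w ∈ A, AEMeasurable w) : AEMeasurable u := by
  obtain ⟨φ, h1, -, h3⟩ := h
  exact aemeasurable_of_tendsto_metrizable_ae' (fun n => hA _ (h1 n)) h3

/-- Members of the class `A` that are close to `u` in energy and in measure; closeness in measure is
expressed through a finite measure equivalent to the Lebesgue measure. -/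
theorem EnergyLimit.exists_close {γ α : ℝ} {A : Set (ℝ → ℝ)} {u : ℝ → ℝ}
    (h : EnergyLimit γ α A u) (hA : ∀ w ∈ A, AEMeasurable w) {e : ℝ≥0∞} (he : 0 < e) :
    ∃ φ ∈ A, normSq γ α (fun x => u x - φ x) ≤ e ∧
      ∫⁻ x, min ‖u x - φ x‖ₑ 1 ∂(volume : Measure ℝ).toFinite ≤ e := by
  have hu := h.aemeasurable hA
  obtain ⟨φ, h1, h2, h3⟩ := h
  have hac : (volume : Measure ℝ).toFinite ≪ volume := toFinite_absolutelyContinuous _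
  have h4 : Tendsto (fun n => ∫⁻ x, min ‖u x - φ n x‖ₑ 1 ∂(volume : Measure ℝ).toFinite) atTop
      (𝓝 (∫⁻ _, 0 ∂(volume : Measure ℝ).toFinite)) := by
    refine tendsto_lintegral_of_dominated_convergence' (fun _ => 1) (fun n => ?_)
      (fun n => ae_of_all _ fun x => min_le_right _ _) (by simp) ?_
    · exact ((hu.sub (hA _ (h1 n))).mono_ac hac).enorm.min aemeasurable_const
    · filter_upwards [hac.ae_le h3] with x hx
      have : Tendsto (fun n => ‖u x - φ n x‖ₑ) atTop (𝓝 0) := by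
        have := (tendsto_const_nhds (x := u x)).sub hx
        rw [sub_self] at this
        simpa using this.enorm
      simpa using this.min (tendsto_const_nhds (x := (1 : ℝ≥0∞)))
  rw [lintegral_zero] at h4
  obtain ⟨n, hn1, hn2⟩ := ((h2.eventually_le_const he).and (h4.eventually_le_const he)).exists
  exact ⟨φ n, h1 n, hn1, hn2⟩

/-- Tail convex hulls of an almost everywhere convergent sequence converge almost everywhere. -/
theorem tendsto_of_mem_convexHull_tail {w z : ℕ → ℝ → ℝ} {x l : ℝ}
    (hw : Tendsto (fun n => w n x) atTop (𝓝 l))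
    (hz : ∀ n, z n ∈ convexHull ℝ (w '' Set.Ici n)) :
    Tendsto (fun n => z n x) atTop (𝓝 l) := by
  rw [Metric.tendsto_atTop] at hw ⊢
  intro e he
  obtain ⟨N, hN⟩ := hw e he
  refine ⟨N, fun n hn => ?_⟩
  have hc : Convex ℝ {f : ℝ → ℝ | f x ∈ Metric.ball l e} :=
    (convex_ball l e).linear_preimage (LinearMap.proj x : (ℝ → ℝ) →ₗ[ℝ] ℝ)
  refine convexHull_min ?_ hc (hz n)
  rintro _ ⟨k, hk, rfl⟩
  exact hN k (le_trans hn hk)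

/-- A sequence of bounded energy that converges almost everywhere has convex combinations that
converge in energy to the same limit: near-minimizers of the energy in the convex hulls of the
tails form a Cauchy sequence by the parallelogram identity. -/
theorem energyLimit_of_bounded {γ α : ℝ} {A : Set (ℝ → ℝ)} (hAc : Convex ℝ A)
    (hA : ∀ w ∈ A, AEMeasurable w) {w : ℕ → ℝ → ℝ} {u : ℝ → ℝ} {B : ℝ≥0∞} (hB : B ≠ ∞)
    (hwA : ∀ n, w n ∈ A) (hwB : ∀ n, normSq γ α (w n) ≤ B)
    (hw : ∀ᵐ x, Tendsto (fun n => w n x) atTop (𝓝 (u x))) : EnergyLimit γ α A u := by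
  set T : ℕ → Set (ℝ → ℝ) := fun n => convexHull ℝ (w '' Set.Ici n) with hT
  have hTA : ∀ n, T n ⊆ A := fun n => convexHull_min (by rintro _ ⟨k, -, rfl⟩; exact hwA k) hAc
  have hTanti : ∀ {m n}, m ≤ n → T n ⊆ T m := fun h =>
    convexHull_mono (Set.image_mono (Set.Ici_subset_Ici.2 h))
  set d : ℕ → ℝ≥0∞ := fun n => ⨅ z ∈ T n, normSq γ α z with hd
  have hdmono : Monotone d := fun m n h => biInf_mono fun z hz => hTanti h hz
  have hdB : ∀ n, d n ≤ B := fun n =>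
    (iInf₂_le (w n) (subset_convexHull ℝ _ (Set.mem_image_of_mem w (Set.mem_Ici.2 le_rfl)))).trans (hwB n)
  have hdfin : ∀ n, d n ≠ ∞ := fun n => ne_top_of_le_ne_top hB (hdB n)
  set D : ℝ≥0∞ := ⨆ n, d n with hD
  have hDfin : D ≠ ∞ := ne_top_of_le_ne_top hB (iSup_le hdB)
  have hdD : Tendsto d atTop (𝓝 D) := tendsto_atTop_iSup hdmono
  set e : ℕ → ℝ≥0∞ := fun n => ((n : ℝ≥0∞) + 1)⁻¹ with he
  have he0 : Tendsto e atTop (𝓝 0) := by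
    have := (tendsto_add_atTop_iff_nat 1).2 ENNReal.tendsto_inv_nat_nhds_zero
    simpa [he] using this
  have hepos : ∀ n, 0 < e n := fun n => by simp [he]
  have heanti : ∀ {m n}, m ≤ n → e n ≤ e m := fun h => by
    simp only [he]; gcongr
  have hex : ∀ n, ∃ z ∈ T n, normSq γ α z < d n + e n := fun n => by
    have : d n < d n + e n := ENNReal.lt_add_right (hdfin n) (hepos n).ne'
    rw [hd] at this
    simpa only [iInf_lt_iff, exists_prop] using this
  choose z hzT hzd using hex
  have hzm : ∀ n, AEMeasurable (z n) := fun n => hA _ (hTA n (hzT n))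
  have hzlim : ∀ᵐ x, Tendsto (fun n => z n x) atTop (𝓝 (u x)) := by
    filter_upwards [hw] with x hx
    exact tendsto_of_mem_convexHull_tail hx hzT
  -- The midpoint of `z n` and `z m` lies in the `n`-th hull, so that its energy is at least `d n`.
  have hcauchy : ∀ n m, n ≤ m →
      normSq γ α (fun x => z n x - z m x) ≤ 2 * D + 4 * e n - 2 * d n := by
    intro n m hnm
    have hmid : (fun x => (1 / 2 : ℝ) * (z n x + z m x)) ∈ T n := by
      have := (convex_convexHull ℝ (w '' Set.Ici n)) (hzT n) (hTanti hnm (hzT m))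
        (by norm_num : (0 : ℝ) ≤ 1 / 2) (by norm_num : (0 : ℝ) ≤ 1 / 2) (by norm_num)
      convert this using 1
      ext x; simp; ring
    have h1 : d n ≤ normSq γ α (fun x => (1 / 2 : ℝ) * (z n x + z m x)) := iInf₂_le _ hmid
    rw [normSq_const_mul] at h1
    have h4 : 4 * d n ≤ normSq γ α (fun x => z n x + z m x) := by
      have h44 : (4 : ℝ≥0∞) = ENNReal.ofReal 4 := by simp
      calc 4 * d n ≤ 4 * (ENNReal.ofReal ((1 / 2) ^ 2) * normSq γ α (fun x => z n x + z m x)) := by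
            gcongr
        _ = normSq γ α (fun x => z n x + z m x) := by
            rw [← mul_assoc, h44, ← ENNReal.ofReal_mul (by norm_num)]; norm_num
    have h5 := normSq_parallelogram γ α (hzm n) (hzm m)
    refine ENNReal.le_sub_of_add_le_right (ENNReal.mul_ne_top (by simp) (hdfin n)) ?_
    refine (ENNReal.add_le_add_iff_right
      (ENNReal.mul_ne_top (by simp) (hdfin n) : 2 * d n ≠ ∞)).1 ?_
    calc normSq γ α (fun x => z n x - z m x) + 2 * d n + 2 * d n
        = normSq γ α (fun x => z n x - z m x) + 4 * d n := by ring
      _ ≤ normSq γ α (fun x => z n x - z m x) + normSq γ α (fun x => z n x + z m x) := by gcongr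
      _ = 2 * normSq γ α (z n) + 2 * normSq γ α (z m) := h5
      _ ≤ 2 * (d n + e n) + 2 * (D + e n) := by
          gcongr
          · exact (hzd n).le
          · exact (hzd m).le.trans (add_le_add (le_iSup d m) (heanti hnm))
      _ = 2 * D + 4 * e n + 2 * d n := by ring
  refine ⟨z, fun n => hTA n (hzT n), ?_, hzlim⟩
  -- Fatou's lemma as `m → ∞` turns the Cauchy estimate into an estimate for `u - z n`.
  have hbound : ∀ n, normSq γ α (fun x => u x - z n x) ≤ 2 * D + 4 * e n - 2 * d n := by
    intro n
    rw [normSq_sub_comm]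
    refine (normSq_le_liminf γ α (w := fun m x => z n x - z m x)
      (fun m => (hzm n).sub (hzm m)) ?_).trans ?_
    · filter_upwards [hzlim] with x hx using tendsto_const_nhds.sub hx
    · refine (liminf_le_liminf (v := fun _ => 2 * D + 4 * e n - 2 * d n) ?_).trans
        (by rw [liminf_const])
      filter_upwards [eventually_ge_atTop n] with m hm using hcauchy n m hm
  refine tendsto_of_tendsto_of_tendsto_of_le_of_le tendsto_const_nhds ?_ (fun n => zero_le)
    hbound
  have h1 : Tendsto (fun n => 2 * D + 4 * e n - 2 * d n) atTop (𝓝 (2 * D + 4 * 0 - 2 * D)) := by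
    refine ENNReal.Tendsto.sub (tendsto_const_nhds.add
      (ENNReal.Tendsto.const_mul he0 (by simp))) (ENNReal.Tendsto.const_mul hdD (by simp)) ?_
    right; exact ENNReal.mul_ne_top (by simp) hDfin
  simpa using h1

/-- Energy limits are closed under almost everywhere convergence with bounded energy. -/
theorem EnergyLimit.of_bounded {γ α : ℝ} {A : Set (ℝ → ℝ)} (hAc : Convex ℝ A)
    (hA : ∀ w ∈ A, AEMeasurable w) {w : ℕ → ℝ → ℝ} {u : ℝ → ℝ} {B : ℝ≥0∞} (hB : B ≠ ∞)
    (hwA : ∀ n, EnergyLimit γ α A (w n)) (hwB : ∀ n, normSq γ α (w n) ≤ B)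
    (hw : ∀ᵐ x, Tendsto (fun n => w n x) atTop (𝓝 (u x))) : EnergyLimit γ α A u := by
  set e : ℕ → ℝ≥0∞ := fun n => 2⁻¹ ^ n with he
  have hepos : ∀ n, 0 < e n := fun n => ENNReal.pow_pos (by simp) n
  have he1 : ∀ n, e n ≤ 1 := fun n => pow_le_one₀ zero_le (by simp)
  choose φ hφA hφN hφm using fun n => (hwA n).exists_close hA (hepos n)
  have hwm : ∀ n, AEMeasurable (w n) := fun n => (hwA n).aemeasurable hA
  have hac : (volume : Measure ℝ) ≪ (volume : Measure ℝ).toFinite := absolutelyContinuous_toFinite _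
  have hac' : (volume : Measure ℝ).toFinite ≪ volume := toFinite_absolutelyContinuous _
  -- The errors `w n - φ n` are summable almost everywhere, so `φ n` has the same limit as `w n`.
  have hsum : ∀ᵐ x, ∑' n, min ‖w n x - φ n x‖ₑ 1 ≠ ∞ := by
    refine hac.ae_le ?_
    have hmeas : ∀ n, AEMeasurable (fun x => min ‖w n x - φ n x‖ₑ 1)
        (volume : Measure ℝ).toFinite := fun n =>
      (((hwm n).sub (hA _ (hφA n))).mono_ac hac').enorm.min aemeasurable_const
    have h1 : ∫⁻ x, ∑' n, min ‖w n x - φ n x‖ₑ 1 ∂(volume : Measure ℝ).toFinite ≠ ∞ := by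
      rw [lintegral_tsum hmeas]
      refine ne_top_of_le_ne_top ?_ (ENNReal.tsum_le_tsum hφm)
      rw [he, ENNReal.tsum_geometric]; simp
    have := ae_lt_top' (AEMeasurable.tsum hmeas) h1
    filter_upwards [this] with x hx using hx.ne
  refine energyLimit_of_bounded (w := φ) (B := 2 * B + 2 * 1) hAc hA ?_ hφA (fun n => ?_) ?_
  · exact ENNReal.add_ne_top.2 ⟨ENNReal.mul_ne_top (by simp) hB, by simp⟩
  · have h1 := normSq_le_add_sub γ α (hA _ (hφA n)) (hwm n)
    rw [normSq_sub_comm, add_comm] at h1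
    refine h1.trans ?_
    gcongr
    · exact hwB n
    · exact (hφN n).trans (he1 n)
  · filter_upwards [hw, hsum] with x hx hs
    have h1 := ENNReal.tendsto_atTop_zero_of_tsum_ne_top hs
    have h2 : Tendsto (fun n => ‖w n x - φ n x‖ₑ) atTop (𝓝 0) := by
      refine h1.congr' ?_
      filter_upwards [h1.eventually_lt_const (by simp : (0 : ℝ≥0∞) < 1)] with n hn
      rcases min_lt_iff.1 hn with h | h
      · exact min_eq_left h.le
      · exact absurd h (lt_irrefl _)
    have h3 : Tendsto (fun n => w n x - φ n x) atTop (𝓝 0) := by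
      rw [tendsto_zero_iff_enorm_tendsto_zero]; exact h2
    simpa using hx.sub h3

/-! ### Power functions: integrability and the inversion `s ↦ s⁻¹` -/

theorem integrableOn_neg_preimage {f : ℝ → ℝ} (hf : ∀ x, f (-x) = f x) {s : Set ℝ}
    (h : IntegrableOn f s) : IntegrableOn f (Neg.neg ⁻¹' s) := by
  have := ((Measure.measurePreserving_neg (volume : Measure ℝ)).integrableOn_comp_preimage
    (Homeomorph.neg ℝ).measurableEmbedding (f := f) (s := s)).2 h
  have h2 : f ∘ Neg.neg = f := funext hf
  rwa [h2] at this

theorem integrableOn_abs_rpow_Icc {r : ℝ} (hr : -1 < r) (R : ℝ) :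
    IntegrableOn (fun x : ℝ => |x| ^ r) (Set.Icc (-R) R) := by
  rcases lt_or_ge R 0 with hR | hR
  · rw [Set.Icc_eq_empty (by linarith)]; exact integrableOn_empty
  have h1 : IntegrableOn (fun x : ℝ => |x| ^ r) (Set.Ioc 0 R) := by
    have := (intervalIntegral.intervalIntegrable_rpow' (a := 0) (b := R) hr).1
    refine this.congr_fun (fun x hx => ?_) measurableSet_Ioc
    simp only [abs_of_pos hx.1]
  have h2 := integrableOn_neg_preimage (f := fun x : ℝ => |x| ^ r) (by simp) h1
  have h3 : IntegrableOn (fun x : ℝ => |x| ^ r) {(0 : ℝ)} :=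
    integrableOn_singleton (by simp) (by simp)
  refine ((h1.union h2).union h3).mono_set fun x hx => ?_
  simp only [Set.mem_union, Set.mem_Ioc, Set.mem_preimage, Set.mem_singleton_iff]
  rcases lt_trichotomy x 0 with h | h | h
  · left; right; exact ⟨by linarith, by linarith [hx.1]⟩
  · right; exact h
  · left; left; exact ⟨h, hx.2⟩

theorem integrableOn_abs_rpow_compl {r R : ℝ} (hr : r < -1) (hR : 0 < R) :
    IntegrableOn (fun x : ℝ => |x| ^ r) {x | R ≤ |x|} := by
  have h1 : IntegrableOn (fun x : ℝ => |x| ^ r) (Set.Ioi (R / 2)) := by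
    refine (integrableOn_Ioi_rpow_of_lt hr (half_pos hR)).congr_fun (fun x hx => ?_)
      measurableSet_Ioi
    simp only [abs_of_pos ((half_pos hR).trans hx)]
  have h2 := integrableOn_neg_preimage (f := fun x : ℝ => |x| ^ r) (by simp) h1
  refine (h1.union h2).mono_set fun x hx => ?_
  simp only [Set.mem_union, Set.mem_Ioi, Set.mem_preimage]
  rcases le_abs.1 (show R ≤ |x| from hx) with h | h
  · left; linarith
  · right; linarith

theorem measurableSet_le_abs (R : ℝ) : MeasurableSet {x : ℝ | R ≤ |x|} :=
  measurableSet_le measurable_const (by fun_prop)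

theorem abs_rpow_sub_one_le {t r : ℝ} (ht : 1 / 2 ≤ t) (ht2 : t ≤ 2) (hr : |r| ≤ 2) :
    |t ^ r - 1| ≤ 16 * |t - 1| := by
  have hd : ∀ x ∈ Set.Icc (1 / 2 : ℝ) 2,
      HasDerivWithinAt (fun x : ℝ => x ^ r) (r * x ^ (r - 1)) (Set.Icc (1 / 2 : ℝ) 2) x :=
    fun x hx => (Real.hasDerivAt_rpow_const (Or.inl (by linarith [hx.1]))).hasDerivWithinAt
  have hb : ∀ x ∈ Set.Icc (1 / 2 : ℝ) 2, ‖r * x ^ (r - 1)‖ ≤ 16 := by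
    intro x hx
    have hx0 : 0 < x := by linarith [hx.1]
    obtain ⟨hr1, hr2⟩ := abs_le.1 hr
    have h8 : x ^ (r - 1) ≤ 8 := by
      rcases le_total 1 x with h | h
      · calc x ^ (r - 1) ≤ x ^ (1 : ℝ) := Real.rpow_le_rpow_of_exponent_le h (by linarith)
          _ = x := Real.rpow_one x
          _ ≤ 8 := by linarith [hx.2]
      · calc x ^ (r - 1) ≤ x ^ (-3 : ℝ) :=
              Real.rpow_le_rpow_of_exponent_ge hx0 h (by linarith)
          _ ≤ (1 / 2 : ℝ) ^ (-3 : ℝ) :=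
              Real.rpow_le_rpow_of_nonpos (by norm_num) hx.1 (by norm_num)
          _ = 8 := by rw [Real.rpow_neg (by norm_num)]; norm_num
    rw [Real.norm_eq_abs, abs_mul, abs_of_nonneg (Real.rpow_nonneg hx0.le _)]
    nlinarith [abs_nonneg r, Real.rpow_nonneg hx0.le (r - 1)]
  have := (convex_Icc (1 / 2 : ℝ) 2).norm_image_sub_le_of_norm_hasDerivWithin_le hd hb
    (show (1 : ℝ) ∈ Set.Icc (1 / 2 : ℝ) 2 by norm_num) (show t ∈ Set.Icc (1 / 2 : ℝ) 2 from ⟨ht, ht2⟩)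
  simpa using this

/-- Substitution `s ↦ s⁻¹`; it needs no integrability hypothesis. -/
theorem integral_comp_inv {g : ℝ → ℝ} : ∫ s, g s⁻¹ * (s ^ 2)⁻¹ = ∫ s, g s := by
  have hinj : Set.InjOn (fun s : ℝ => s⁻¹) {(0 : ℝ)}ᶜ := fun a _ b _ h => inv_injective h
  have himg : (fun s : ℝ => s⁻¹) '' {(0 : ℝ)}ᶜ = {(0 : ℝ)}ᶜ := by
    ext x
    simp only [Set.mem_image, Set.mem_compl_iff, Set.mem_singleton_iff]
    constructor
    · rintro ⟨y, hy, rfl⟩; exact inv_ne_zero hy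
    · intro hx; exact ⟨x⁻¹, inv_ne_zero hx, inv_inv x⟩
  have h := integral_image_eq_integral_abs_deriv_smul (measurableSet_singleton (0 : ℝ)).compl
    (fun x hx => (hasDerivAt_inv (show x ≠ 0 from hx)).hasDerivWithinAt) hinj g
  rw [himg] at h
  have hae : ∀ f : ℝ → ℝ, ∫ x in {(0 : ℝ)}ᶜ, f x = ∫ x, f x := fun f => by
    rw [restrict_compl_singleton]
  rw [hae, hae] at h
  rw [h]
  congr 1; ext s
  simp only [smul_eq_mul, abs_neg, abs_inv, abs_pow, sq_abs]
  ring

theorem integrable_comp_inv {g : ℝ → ℝ} (hg : Integrable g) :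
    Integrable (fun s => g s⁻¹ * (s ^ 2)⁻¹) := by
  have hinj : Set.InjOn (fun s : ℝ => s⁻¹) {(0 : ℝ)}ᶜ := fun a _ b _ h => inv_injective h
  have h := (integrableOn_image_iff_integrableOn_abs_deriv_smul
    (measurableSet_singleton (0 : ℝ)).compl
    (fun x hx => (hasDerivAt_inv (show x ≠ 0 from hx)).hasDerivWithinAt) hinj g).1 hg.integrableOn
  rw [IntegrableOn, restrict_compl_singleton] at h
  refine h.congr (ae_of_all _ fun s => ?_)
  simp only [smul_eq_mul, abs_neg, abs_inv, abs_pow, sq_abs]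
  ring

/-- The constant `c` in `𝓛_{γ,α} |x|^σ = -c |x|^{σ - 2γ - 2α}`. The integral converges absolutely
since `2γ < 1`. -/
def powConst (γ α σ : ℝ) : ℝ := ∫ s, (|s| ^ σ - 1) * kernel γ α 1 s

theorem kernel_one_left (γ α s : ℝ) :
    kernel γ α 1 s = |1 - s| ^ (-(1 + 2 * γ)) * |s| ^ (-α) := by
  unfold kernel
  rw [abs_one, Real.one_rpow, mul_one, Real.rpow_neg (abs_nonneg _), Real.rpow_neg (abs_nonneg _),
    one_div, mul_inv]

theorem rpow_neg_le_four {γ : ℝ} (h0 : 0 < γ) (h1 : γ < 1 / 2) {t : ℝ} (ht : 1 / 2 ≤ t) :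
    t ^ (-(1 + 2 * γ)) ≤ 4 := by
  calc t ^ (-(1 + 2 * γ)) ≤ (1 / 2 : ℝ) ^ (-(1 + 2 * γ)) :=
        Real.rpow_le_rpow_of_nonpos (by norm_num) ht (by linarith)
    _ ≤ (1 / 2 : ℝ) ^ (-2 : ℝ) :=
        Real.rpow_le_rpow_of_exponent_ge (by norm_num) (by norm_num) (by linarith)
    _ = 4 := by rw [Real.rpow_neg (by norm_num)]; norm_num

theorem rpow_neg_half_le {γ : ℝ} (h0 : 0 < γ) (h1 : γ < 1 / 2) {t d : ℝ} (ht : 0 < t)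
    (hd : t / 2 ≤ d) : d ^ (-(1 + 2 * γ)) ≤ 4 * t ^ (-(1 + 2 * γ)) := by
  calc d ^ (-(1 + 2 * γ)) ≤ (t / 2) ^ (-(1 + 2 * γ)) :=
        Real.rpow_le_rpow_of_nonpos (by linarith) hd (by linarith)
    _ = (1 / 2 : ℝ) ^ (-(1 + 2 * γ)) * t ^ (-(1 + 2 * γ)) := by
        rw [← Real.mul_rpow (by norm_num) ht.le]; ring_nf
    _ ≤ 4 * t ^ (-(1 + 2 * γ)) := by
        gcongr; exact rpow_neg_le_four h0 h1 le_rfl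

theorem abs_abs_sub_one_le (s : ℝ) : |(|s| - 1)| ≤ |1 - s| := by
  have := abs_abs_sub_abs_le s 1
  rwa [abs_one, abs_sub_comm s 1] at this

/-- The conditions on `σ` give convergence at `0` and at infinity. At `s = 1` the first factor
vanishes to first order, which suffices against `|1 - s|^{-1-2γ}` as `2γ < 1`. -/
theorem integrable_powConst {γ α σ : ℝ} (h0 : 0 < γ) (h1 : γ < 1 / 2) (hα : 0 ≤ α) (hα1 : α < 1)
    (hσ2 : |σ| ≤ 2) (hσ : -1 < σ - α) (hσ' : σ < 2 * γ + α) :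
    Integrable (fun s => (|s| ^ σ - 1) * kernel γ α 1 s) := by
  have i1 := (integrableOn_abs_rpow_Icc (r := σ - α) hσ 1).integrable_indicator measurableSet_Icc
  have i2 := (integrableOn_abs_rpow_Icc (r := -α) (by linarith) 1).integrable_indicator
    measurableSet_Icc
  have i3 := (((integrableOn_abs_rpow_Icc (r := -(2 * γ)) (by linarith) 3).integrable_indicator
    measurableSet_Icc).comp_sub_left 1)
  have i4 := (integrableOn_abs_rpow_compl (r := σ - α - (1 + 2 * γ)) (R := 1) (by linarith)
    one_pos).integrable_indicator (measurableSet_le_abs 1)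
  have i5 := (integrableOn_abs_rpow_compl (r := - α - (1 + 2 * γ)) (R := 1) (by linarith)
    one_pos).integrable_indicator (measurableSet_le_abs 1)
  refine ((((i1.const_mul 4).add (i2.const_mul 4)).add (i3.const_mul 32)).add
    ((i4.const_mul 4).add (i5.const_mul 4))).mono' ?_ ?_
  · unfold kernel; exact Measurable.aestronglyMeasurable (by fun_prop)
  filter_upwards [compl_mem_ae_iff.2 (measure_singleton (0 : ℝ)),
    compl_mem_ae_iff.2 (measure_singleton (1 : ℝ))] with s hs hs1
  have hs0 : 0 < |s| := abs_pos.2 hs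
  have hs10 : 0 < |1 - s| := abs_pos.2 (sub_ne_zero.2 (Ne.symm hs1))
  have n1 : 0 ≤ (Set.Icc (-1 : ℝ) 1).indicator (fun x => |x| ^ (σ - α)) s :=
    Set.indicator_nonneg (fun _ _ => by positivity) _
  have n2 : 0 ≤ (Set.Icc (-1 : ℝ) 1).indicator (fun x => |x| ^ (-α)) s :=
    Set.indicator_nonneg (fun _ _ => by positivity) _
  have n3 : 0 ≤ (Set.Icc (-3 : ℝ) 3).indicator (fun x => |x| ^ (-(2 * γ))) (1 - s) :=
    Set.indicator_nonneg (fun _ _ => by positivity) _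
  have n4 : 0 ≤ {x : ℝ | 1 ≤ |x|}.indicator (fun x => |x| ^ (σ - α - (1 + 2 * γ))) s :=
    Set.indicator_nonneg (fun _ _ => by positivity) _
  have n5 : 0 ≤ {x : ℝ | 1 ≤ |x|}.indicator (fun x => |x| ^ (-α - (1 + 2 * γ))) s :=
    Set.indicator_nonneg (fun _ _ => by positivity) _
  simp only [Pi.add_apply]
  rw [kernel_one_left, Real.norm_eq_abs, abs_mul, abs_of_nonneg (by positivity :
    0 ≤ |1 - s| ^ (-(1 + 2 * γ)) * |s| ^ (-α))]
  have habs : |(|s| ^ σ - 1)| ≤ |s| ^ σ + 1 := by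
    rw [abs_le]; constructor <;> linarith [Real.rpow_nonneg hs0.le σ]
  have tri1 : 1 ≤ |1 - s| + |s| := by
    have := abs_add_le (1 - s) s; simpa using this
  have tri2 : |s| ≤ |1 - s| + 1 := by
    have := abs_sub_abs_le_abs_sub s 1; rw [abs_one, abs_sub_comm] at this; linarith
  have tri3 : |1 - s| ≤ 1 + |s| := by
    have := abs_sub 1 s; rwa [abs_one] at this
  rcases le_total |s| (1 / 2) with hle | hle
  · have hm : s ∈ Set.Icc (-1 : ℝ) 1 := abs_le.1 (by linarith)
    rw [Set.indicator_of_mem hm] at n1 n2 ⊢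
    rw [Set.indicator_of_mem hm]
    have hk := rpow_neg_le_four h0 h1 (show 1 / 2 ≤ |1 - s| by linarith)
    have key : |(|s| ^ σ - 1)| * (|1 - s| ^ (-(1 + 2 * γ)) * |s| ^ (-α))
        ≤ 4 * |s| ^ (σ - α) + 4 * |s| ^ (-α) := by
      calc _ ≤ (|s| ^ σ + 1) * (4 * |s| ^ (-α)) := by gcongr
        _ = 4 * (|s| ^ σ * |s| ^ (-α)) + 4 * |s| ^ (-α) := by ring
        _ = _ := by rw [← Real.rpow_add hs0]; ring_nf
    linarith
  rcases le_total |s| 2 with hle2 | hle2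
  · have hm : (1 - s) ∈ Set.Icc (-3 : ℝ) 3 := abs_le.1 (by linarith)
    rw [Set.indicator_of_mem hm] at n3 ⊢
    have hd := (abs_rpow_sub_one_le hle hle2 hσ2).trans
      (mul_le_mul_of_nonneg_left (abs_abs_sub_one_le s) (by norm_num))
    have h2 : |s| ^ (-α) ≤ 2 := by
      calc |s| ^ (-α) ≤ (1 / 2 : ℝ) ^ (-α) :=
            Real.rpow_le_rpow_of_nonpos (by norm_num) hle (by linarith)
        _ ≤ (1 / 2 : ℝ) ^ (-1 : ℝ) :=
            Real.rpow_le_rpow_of_exponent_ge (by norm_num) (by norm_num) (by linarith)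
        _ = 2 := by rw [Real.rpow_neg (by norm_num)]; norm_num
    have key : |(|s| ^ σ - 1)| * (|1 - s| ^ (-(1 + 2 * γ)) * |s| ^ (-α))
        ≤ 32 * |1 - s| ^ (-(2 * γ)) := by
      calc _ ≤ (16 * |1 - s|) * (|1 - s| ^ (-(1 + 2 * γ)) * 2) := by gcongr
        _ = 32 * (|1 - s| ^ (1 : ℝ) * |1 - s| ^ (-(1 + 2 * γ))) := by rw [Real.rpow_one]; ring
        _ = _ := by rw [← Real.rpow_add hs10]; ring_nf
    linarith
  · have hm : s ∈ {x : ℝ | 1 ≤ |x|} := by simp only [Set.mem_ofPred_eq]; linarith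
    rw [Set.indicator_of_mem hm] at n4 n5 ⊢
    rw [Set.indicator_of_mem hm]
    have hk := rpow_neg_half_le h0 h1 hs0 (show |s| / 2 ≤ |1 - s| by linarith)
    have key : |(|s| ^ σ - 1)| * (|1 - s| ^ (-(1 + 2 * γ)) * |s| ^ (-α))
        ≤ 4 * |s| ^ (σ - α - (1 + 2 * γ)) + 4 * |s| ^ (- α - (1 + 2 * γ)) := by
      calc _ ≤ (|s| ^ σ + 1) * ((4 * |s| ^ (-(1 + 2 * γ))) * |s| ^ (-α)) := by gcongr
        _ = 4 * (|s| ^ σ * |s| ^ (-α) * |s| ^ (-(1 + 2 * γ)))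
            + 4 * (|s| ^ (-α) * |s| ^ (-(1 + 2 * γ))) := by ring
        _ = _ := by
          rw [← Real.rpow_add hs0, ← Real.rpow_add hs0, ← Real.rpow_add hs0]; ring_nf
    linarith

/-- The density of `powConst` averaged with its image under `s ↦ s⁻¹`. It vanishes to second order
at `s = ±1` and has a sign, so that it is bounded uniformly up to `γ = 1/2`. -/
def symPow (γ α σ s : ℝ) : ℝ :=
  (|s| ^ σ - 1) * (1 - |s| ^ (-(σ + (1 - 2 * γ - 2 * α)))) * kernel γ α 1 s

theorem symPow_eq (γ α σ : ℝ) {s : ℝ} (hs : s ≠ 0) :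
    (|s| ^ σ - 1) * kernel γ α 1 s + (|s⁻¹| ^ σ - 1) * kernel γ α 1 s⁻¹ * (s ^ 2)⁻¹
      = symPow γ α σ s := by
  have hs0 : 0 < |s| := abs_pos.2 hs
  have h1 : |1 - s⁻¹| = |1 - s| * |s|⁻¹ := by
    rw [← abs_inv, ← abs_mul, sub_mul, one_mul, mul_inv_cancel₀ hs, abs_sub_comm]
  have h2 : (s ^ 2)⁻¹ = |s| ^ (-2 : ℝ) := by
    rw [Real.rpow_neg hs0.le]; norm_num
  have h3 : kernel γ α 1 s⁻¹ * (s ^ 2)⁻¹ = kernel γ α 1 s * |s| ^ (-(1 - 2 * γ - 2 * α)) := by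
    rw [kernel_one_left, kernel_one_left, h1, h2, abs_inv,
      Real.mul_rpow (abs_nonneg _) (inv_nonneg.2 hs0.le), Real.inv_rpow hs0.le, Real.inv_rpow hs0.le,
      ← Real.rpow_neg hs0.le, ← Real.rpow_neg hs0.le]
    have : |s| ^ (-(-(1 + 2 * γ))) * |s| ^ (-(-α)) * |s| ^ (-2 : ℝ)
        = |s| ^ (-α) * |s| ^ (-(1 - 2 * γ - 2 * α)) := by
      rw [← Real.rpow_add hs0, ← Real.rpow_add hs0, ← Real.rpow_add hs0]; ring_nf
    linear_combination |1 - s| ^ (-(1 + 2 * γ)) * this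
  have h4 : |s⁻¹| ^ σ * |s| ^ (-(1 - 2 * γ - 2 * α)) = |s| ^ (-(σ + (1 - 2 * γ - 2 * α))) := by
    rw [abs_inv, Real.inv_rpow hs0.le, ← Real.rpow_neg hs0.le, ← Real.rpow_add hs0]; ring_nf
  have h5 : |s| ^ σ * |s| ^ (-(σ + (1 - 2 * γ - 2 * α))) = |s| ^ (-(1 - 2 * γ - 2 * α)) := by
    rw [← Real.rpow_add hs0]; ring_nf
  rw [mul_assoc (|s⁻¹| ^ σ - 1), h3, symPow]
  linear_combination (kernel γ α 1 s) * h4 + (kernel γ α 1 s) * h5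

theorem integrable_symPow {γ α σ : ℝ}
    (h : Integrable (fun s => (|s| ^ σ - 1) * kernel γ α 1 s)) : Integrable (symPow γ α σ) := by
  refine (h.add (integrable_comp_inv h)).congr ?_
  filter_upwards [compl_mem_ae_iff.2 (measure_singleton (0 : ℝ))] with s hs
  exact symPow_eq γ α σ hs

/-- Averaging `powConst` with its image under `s ↦ s⁻¹`. -/
theorem two_mul_powConst {γ α σ : ℝ}
    (h : Integrable (fun s => (|s| ^ σ - 1) * kernel γ α 1 s)) :
    2 * powConst γ α σ = ∫ s, symPow γ α σ s := by
  rw [two_mul]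
  nth_rw 2 [powConst]
  rw [← integral_comp_inv, powConst, ← integral_add h (integrable_comp_inv h)]
  refine integral_congr_ae ?_
  filter_upwards [compl_mem_ae_iff.2 (measure_singleton (0 : ℝ))] with s hs
  exact symPow_eq γ α σ hs

theorem kernel_scale (γ α s : ℝ) {x : ℝ} (hx : x ≠ 0) :
    kernel γ α x (x * s) = |x| ^ (-(1 + 2 * γ + 2 * α)) * kernel γ α 1 s := by
  have hx0 : 0 < |x| := abs_pos.2 hx
  have h1 : |x - x * s| = |x| * |1 - s| := by rw [← abs_mul]; ring_nf
  unfold kernel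
  rw [h1, abs_mul, Real.mul_rpow (abs_nonneg _) (abs_nonneg _),
    Real.mul_rpow (abs_nonneg _) (abs_nonneg _), Real.rpow_neg hx0.le, abs_one, Real.one_rpow,
    show |x| ^ (1 + 2 * γ + 2 * α) = |x| ^ (1 + 2 * γ) * |x| ^ α * |x| ^ α by
      rw [← Real.rpow_add hx0, ← Real.rpow_add hx0]; ring_nf]
  have : 0 < |x| ^ (1 + 2 * γ) := by positivity
  have : 0 < |x| ^ α := by positivity
  simp only [one_div, ← mul_inv]
  congr 1; ring

theorem powDiff_scale (γ α σ s : ℝ) {x : ℝ} (hx : x ≠ 0) :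
    (|x * s| ^ σ - |x| ^ σ) * kernel γ α x (x * s)
      = |x| ^ (σ - (1 + 2 * γ + 2 * α)) * ((|s| ^ σ - 1) * kernel γ α 1 s) := by
  have hx0 : 0 < |x| := abs_pos.2 hx
  rw [kernel_scale γ α s hx, abs_mul, Real.mul_rpow (abs_nonneg _) (abs_nonneg _),
    sub_eq_add_neg σ, Real.rpow_add hx0]
  ring

theorem integrable_powDiff {γ α σ : ℝ}
    (h : Integrable (fun s => (|s| ^ σ - 1) * kernel γ α 1 s)) {x : ℝ} (hx : x ≠ 0) :
    Integrable (fun y => (|y| ^ σ - |x| ^ σ) * kernel γ α x y) := by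
  rw [← integrable_comp_mul_left_iff _ hx]
  simp_rw [powDiff_scale γ α σ _ hx]
  exact h.const_mul _

/-- `-𝓛_{γ,α} |x|^σ = c |x|^{σ - 2γ - 2α}` with `c = powConst γ α σ`. -/
theorem integral_powDiff (γ α σ : ℝ) {x : ℝ} (hx : x ≠ 0) :
    ∫ y, (|y| ^ σ - |x| ^ σ) * kernel γ α x y
      = |x| ^ (σ - (2 * γ + 2 * α)) * powConst γ α σ := by
  have hx0 : 0 < |x| := abs_pos.2 hx
  have h := Measure.integral_comp_mul_left (fun y => (|y| ^ σ - |x| ^ σ) * kernel γ α x y) x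
  simp_rw [powDiff_scale γ α σ _ hx] at h
  rw [integral_const_mul, abs_inv, smul_eq_mul, inv_mul_eq_div, eq_div_iff hx0.ne'] at h
  rw [← h, powConst, show σ - (2 * γ + 2 * α) = σ - (1 + 2 * γ + 2 * α) + 1 by ring,
    Real.rpow_add hx0, Real.rpow_one]
  ring

theorem integral_abs_powDiff (γ α σ : ℝ) {x : ℝ} (hx : x ≠ 0) :
    ∫ y, |(|y| ^ σ - |x| ^ σ) * kernel γ α x y|
      = |x| ^ (σ - (2 * γ + 2 * α)) * ∫ s, |(|s| ^ σ - 1) * kernel γ α 1 s| := by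
  have hx0 : 0 < |x| := abs_pos.2 hx
  have h := Measure.integral_comp_mul_left (fun y => |(|y| ^ σ - |x| ^ σ) * kernel γ α x y|) x
  simp_rw [powDiff_scale γ α σ _ hx, abs_mul (|x| ^ (σ - (1 + 2 * γ + 2 * α))),
    abs_of_nonneg (Real.rpow_nonneg hx0.le (σ - (1 + 2 * γ + 2 * α)))] at h
  rw [integral_const_mul, abs_inv, smul_eq_mul, inv_mul_eq_div, eq_div_iff hx0.ne'] at h
  rw [← h, show σ - (2 * γ + 2 * α) = σ - (1 + 2 * γ + 2 * α) + 1 by ring,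
    Real.rpow_add hx0, Real.rpow_one]
  ring

theorem symPow_nonneg {γ α σ : ℝ} (hσ : 0 ≤ σ) (hκ : 0 ≤ σ + (1 - 2 * γ - 2 * α)) {s : ℝ}
    (hs : s ≠ 0) : 0 ≤ symPow γ α σ s := by
  unfold symPow
  refine mul_nonneg ?_ (kernel_nonneg ..)
  have hs0 : 0 < |s| := abs_pos.2 hs
  rcases le_total |s| 1 with h | h
  · have h1 := Real.rpow_le_one hs0.le h hσ
    have h2 := Real.one_le_rpow_of_pos_of_le_one_of_nonpos hs0 h (neg_nonpos.2 hκ)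
    nlinarith
  · have h1 := Real.one_le_rpow h hσ
    have h2 := Real.rpow_le_one_of_one_le_of_nonpos h (neg_nonpos.2 hκ)
    nlinarith

theorem symPow_nonpos {γ α σ : ℝ} (hσ : σ ≤ 0) (hκ : 0 ≤ σ + (1 - 2 * γ - 2 * α)) {s : ℝ}
    (hs : s ≠ 0) : symPow γ α σ s ≤ 0 := by
  unfold symPow
  refine mul_nonpos_of_nonpos_of_nonneg ?_ (kernel_nonneg ..)
  have hs0 : 0 < |s| := abs_pos.2 hs
  rcases le_total |s| 1 with h | h
  · have h1 := Real.one_le_rpow_of_pos_of_le_one_of_nonpos hs0 h hσ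
    have h2 := Real.one_le_rpow_of_pos_of_le_one_of_nonpos hs0 h (neg_nonpos.2 hκ)
    nlinarith
  · have h1 := Real.rpow_le_one_of_one_le_of_nonpos h hσ
    have h2 := Real.rpow_le_one_of_one_le_of_nonpos h (neg_nonpos.2 hκ)
    nlinarith

theorem powConst_nonpos {γ α σ : ℝ} (hσ : σ ≤ 0) (hκ : 0 ≤ σ + (1 - 2 * γ - 2 * α))
    (h : Integrable (fun s => (|s| ^ σ - 1) * kernel γ α 1 s)) : powConst γ α σ ≤ 0 := by
  have h1 := two_mul_powConst h
  have h2 : ∫ s, symPow γ α σ s ≤ 0 := by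
    refine integral_nonpos_of_ae ?_
    filter_upwards [compl_mem_ae_iff.2 (measure_singleton (0 : ℝ))] with s hs
    exact symPow_nonpos hσ hκ hs
  linarith

/-- A lower bound for `powConst` that does not depend on `γ` and `α`: the symmetrized density is
nonnegative, and it is bounded below on `[2,3]`. -/
theorem le_powConst {γ α σ : ℝ} (h0 : 0 < γ) (h1 : γ < 1 / 2) (hα1 : α ≤ 1)
    (hσ : 0 < σ) (hκ : 0 ≤ 1 - 2 * γ - 2 * α)
    (h : Integrable (fun s => (|s| ^ σ - 1) * kernel γ α 1 s)) :
    (2 ^ σ - 1) * (1 - 2 ^ (-σ)) / 24 ≤ powConst γ α σ := by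
  have e := two_mul_powConst h
  have hi := integrable_symPow h
  have hlow : ∀ s ∈ Set.Icc (2 : ℝ) 3, (2 ^ σ - 1) * (1 - 2 ^ (-σ)) / 12 ≤ symPow γ α σ s := by
    intro s hs
    have hs0 : 0 < s := by linarith [hs.1]
    rw [symPow, kernel, abs_one, Real.one_rpow, mul_one, abs_of_pos hs0,
      abs_sub_comm, abs_of_nonneg (by linarith [hs.1] : 0 ≤ s - 1), div_eq_mul_one_div]
    have a1 : (2 : ℝ) ^ σ ≤ s ^ σ := Real.rpow_le_rpow (by norm_num) hs.1 hσ.le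
    have a2 : s ^ (-(σ + (1 - 2 * γ - 2 * α))) ≤ 2 ^ (-σ) := by
      calc s ^ (-(σ + (1 - 2 * γ - 2 * α))) ≤ s ^ (-σ) :=
            Real.rpow_le_rpow_of_exponent_le (by linarith [hs.1]) (by linarith)
        _ ≤ 2 ^ (-σ) := Real.rpow_le_rpow_of_nonpos (by norm_num) hs.1 (by linarith)
    have a3 : (1 : ℝ) ≤ 2 ^ σ := Real.one_le_rpow (by norm_num) hσ.le
    have a4 : (2 : ℝ) ^ (-σ) ≤ 1 := Real.rpow_le_one_of_one_le_of_nonpos (by norm_num) (by linarith)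
    have b1 : (s - 1) ^ (1 + 2 * γ) ≤ 4 := by
      calc (s - 1) ^ (1 + 2 * γ) ≤ 2 ^ (1 + 2 * γ) :=
            Real.rpow_le_rpow (by linarith [hs.1]) (by linarith [hs.2]) (by linarith)
        _ ≤ 2 ^ (2 : ℝ) := Real.rpow_le_rpow_of_exponent_le (by norm_num) (by linarith)
        _ = 4 := by norm_num
    have b2 : s ^ α ≤ 3 := by
      calc s ^ α ≤ s ^ (1 : ℝ) := Real.rpow_le_rpow_of_exponent_le (by linarith [hs.1]) hα1
        _ ≤ 3 := by rw [Real.rpow_one]; exact hs.2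
    have b3 : 0 < (s - 1) ^ (1 + 2 * γ) := Real.rpow_pos_of_pos (by linarith [hs.1]) _
    have b4 : 0 < s ^ α := Real.rpow_pos_of_pos hs0 _
    have b5 : (1 : ℝ) / 12 ≤ 1 / ((s - 1) ^ (1 + 2 * γ) * s ^ α) :=
      one_div_le_one_div_of_le (by positivity) (by nlinarith)
    have c1 : (2 ^ σ - 1) * (1 - 2 ^ (-σ))
        ≤ (s ^ σ - 1) * (1 - s ^ (-(σ + (1 - 2 * γ - 2 * α)))) :=
      mul_le_mul (by linarith) (by linarith) (by linarith) (by linarith)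
    exact mul_le_mul c1 b5 (by norm_num) (le_trans (mul_nonneg (by linarith) (by linarith)) c1)
  have h2 : (2 ^ σ - 1) * (1 - 2 ^ (-σ)) / 12 ≤ ∫ s in Set.Icc (2 : ℝ) 3, symPow γ α σ s := by
    have := setIntegral_mono_on (μ := volume) (s := Set.Icc (2 : ℝ) 3)
      (f := fun _ => ((2 : ℝ) ^ σ - 1) * (1 - 2 ^ (-σ)) / 12)
      (integrableOn_const (by simp)) hi.integrableOn measurableSet_Icc hlow
    rw [setIntegral_const] at this
    norm_num [Measure.real] at this
    linarith
  have h3 : ∫ s in Set.Icc (2 : ℝ) 3, symPow γ α σ s ≤ ∫ s, symPow γ α σ s := by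
    refine setIntegral_le_integral hi ?_
    filter_upwards [compl_mem_ae_iff.2 (measure_singleton (0 : ℝ))] with s hs
    exact symPow_nonneg hσ.le (by linarith) hs
  linarith

/-- An upper bound for `powConst` that is uniform up to `γ = 1/2`, `α = 0`. The density of
`powConst` itself loses integrability at `s = 1` in this limit; the symmetrized one does not. -/
theorem exists_powConst_le : ∃ C : ℝ, 0 ≤ C ∧ ∀ γ α σ : ℝ, 3 / 8 ≤ γ → γ < 1 / 2 → 0 ≤ α →
    α ≤ 1 / 8 → 0 < σ → σ ≤ 1 / 2 → 0 ≤ 1 - 2 * γ - 2 * α →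
    Integrable (fun s => (|s| ^ σ - 1) * kernel γ α 1 s) → powConst γ α σ ≤ C := by
  have i1 := (integrableOn_abs_rpow_Icc (r := -(7 / 8)) (by norm_num) 1).integrable_indicator
    measurableSet_Icc
  have i2 : Integrable ((Set.Icc (-2 : ℝ) 2).indicator (fun _ => (1 : ℝ))) :=
    (integrableOn_const (by simp)).integrable_indicator measurableSet_Icc
  have i3 := (integrableOn_abs_rpow_compl (r := -(5 / 4)) (R := 1) (by norm_num)
    one_pos).integrable_indicator (measurableSet_le_abs 1)
  have iD := ((i1.const_mul 4).add (i2.const_mul 1536)).add (i3.const_mul 4)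
  set Df : ℝ → ℝ := _ with hDf
  change Integrable Df at iD
  refine ⟨∫ s, |Df s|, integral_nonneg fun _ => abs_nonneg _, ?_⟩
  intro γ α σ hγ h1 hα hα1 hσ hσ1 hκ hint
  have h0 : 0 < γ := by linarith
  have e := two_mul_powConst hint
  suffices hle : ∫ s, symPow γ α σ s ≤ ∫ s, |Df s| by
    have : 0 ≤ ∫ s, |Df s| := integral_nonneg fun _ => abs_nonneg _
    linarith
  refine integral_mono_ae (integrable_symPow hint) iD.abs ?_
  filter_upwards [compl_mem_ae_iff.2 (measure_singleton (0 : ℝ)),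
    compl_mem_ae_iff.2 (measure_singleton (1 : ℝ))] with s hs hs1
  refine le_trans ?_ (le_abs_self _)
  have hs0 : 0 < |s| := abs_pos.2 hs
  have hs10 : 0 < |1 - s| := abs_pos.2 (sub_ne_zero.2 (Ne.symm hs1))
  have n1 : 0 ≤ (Set.Icc (-1 : ℝ) 1).indicator (fun x => |x| ^ (-(7 / 8) : ℝ)) s :=
    Set.indicator_nonneg (fun _ _ => by positivity) _
  have n2 : 0 ≤ (Set.Icc (-2 : ℝ) 2).indicator (fun _ => (1 : ℝ)) s :=
    Set.indicator_nonneg (fun _ _ => by positivity) _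
  have n3 : 0 ≤ {x : ℝ | 1 ≤ |x|}.indicator (fun x => |x| ^ (-(5 / 4) : ℝ)) s :=
    Set.indicator_nonneg (fun _ _ => by positivity) _
  simp only [hDf, Pi.add_apply]
  rw [symPow, kernel_one_left]
  set r := σ + (1 - 2 * γ - 2 * α) with hr
  have tri1 : 1 ≤ |1 - s| + |s| := by
    have := abs_add_le (1 - s) s; simpa using this
  have tri2 : |s| ≤ |1 - s| + 1 := by
    have := abs_sub_abs_le_abs_sub s 1; rw [abs_one, abs_sub_comm] at this; linarith
  have tri3 : |1 - s| ≤ 1 + |s| := by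
    have := abs_sub 1 s; rwa [abs_one] at this
  have pr := Real.rpow_nonneg hs0.le (-r)
  have pσ := Real.rpow_nonneg hs0.le σ
  rcases le_total |s| (1 / 2) with hle | hle
  · have hm : s ∈ Set.Icc (-1 : ℝ) 1 := abs_le.1 (by linarith)
    rw [Set.indicator_of_mem hm] at n1 ⊢
    have hk := rpow_neg_le_four h0 h1 (show 1 / 2 ≤ |1 - s| by linarith)
    have p1 := Real.rpow_le_one hs0.le (by linarith) hσ.le
    have p2 := Real.one_le_rpow_of_pos_of_le_one_of_nonpos hs0 (by linarith : |s| ≤ 1)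
      (show -r ≤ 0 by linarith)
    have key : (|s| ^ σ - 1) * (1 - |s| ^ (-r)) * (|1 - s| ^ (-(1 + 2 * γ)) * |s| ^ (-α))
        ≤ 4 * |s| ^ (-(7 / 8) : ℝ) := by
      calc _ ≤ |s| ^ (-r) * (4 * |s| ^ (-α)) := by
            gcongr
            nlinarith
        _ = 4 * |s| ^ (-(r + α)) := by
            rw [show -(r + α) = -r + -α by ring, Real.rpow_add hs0]; ring
        _ ≤ 4 * |s| ^ (-(7 / 8) : ℝ) := by
            gcongr 4 * ?_
            exact Real.rpow_le_rpow_of_exponent_ge hs0 (by linarith) (by linarith)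
    linarith
  rcases le_total |s| 2 with hle2 | hle2
  · have hm : s ∈ Set.Icc (-2 : ℝ) 2 := abs_le.1 (by linarith)
    rw [Set.indicator_of_mem hm] at n2 ⊢
    have hd1 := (abs_rpow_sub_one_le hle hle2 (r := σ) (abs_le.2 ⟨by linarith, by linarith⟩)).trans
      (mul_le_mul_of_nonneg_left (abs_abs_sub_one_le s) (by norm_num))
    have hd2 := (abs_rpow_sub_one_le hle hle2 (r := -r)
      (abs_le.2 ⟨by linarith, by linarith⟩)).trans
      (mul_le_mul_of_nonneg_left (abs_abs_sub_one_le s) (by norm_num))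
    have h2 : |s| ^ (-α) ≤ 2 := by
      calc |s| ^ (-α) ≤ (1 / 2 : ℝ) ^ (-α) :=
            Real.rpow_le_rpow_of_nonpos (by norm_num) hle (by linarith)
        _ ≤ (1 / 2 : ℝ) ^ (-1 : ℝ) :=
            Real.rpow_le_rpow_of_exponent_ge (by norm_num) (by norm_num) (by linarith)
        _ = 2 := by rw [Real.rpow_neg (by norm_num)]; norm_num
    have h3 : |1 - s| ^ (1 - 2 * γ) ≤ 3 := by
      rcases le_total |1 - s| 1 with h | h
      · linarith [Real.rpow_le_one hs10.le h (show 0 ≤ 1 - 2 * γ by linarith)]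
      · calc |1 - s| ^ (1 - 2 * γ) ≤ |1 - s| ^ (1 : ℝ) :=
              Real.rpow_le_rpow_of_exponent_le h (by linarith)
          _ ≤ 3 := by rw [Real.rpow_one]; linarith
    have key : (|s| ^ σ - 1) * (1 - |s| ^ (-r)) * (|1 - s| ^ (-(1 + 2 * γ)) * |s| ^ (-α))
        ≤ 1536 * 1 := by
      calc _ ≤ (16 * |1 - s|) * (16 * |1 - s|) * (|1 - s| ^ (-(1 + 2 * γ)) * 2) := by
            refine mul_le_mul ?_ (by gcongr) (by positivity) (by positivity)
            refine (le_abs_self _).trans ?_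
            rw [abs_mul, abs_sub_comm 1]
            gcongr
        _ = 512 * (|1 - s| ^ (2 : ℝ) * |1 - s| ^ (-(1 + 2 * γ))) := by
            rw [Real.rpow_two]; ring
        _ = 512 * |1 - s| ^ (1 - 2 * γ) := by rw [← Real.rpow_add hs10]; ring_nf
        _ ≤ 1536 * 1 := by linarith
    linarith
  · have hm : s ∈ {x : ℝ | 1 ≤ |x|} := by simp only [Set.mem_ofPred_eq]; linarith
    rw [Set.indicator_of_mem hm] at n3 ⊢
    have hk := rpow_neg_half_le h0 h1 hs0 (show |s| / 2 ≤ |1 - s| by linarith)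
    have p1 := Real.one_le_rpow (show 1 ≤ |s| by linarith) hσ.le
    have p2 := Real.rpow_le_one_of_one_le_of_nonpos (show 1 ≤ |s| by linarith)
      (show -r ≤ 0 by linarith)
    have p3 := Real.rpow_le_one_of_one_le_of_nonpos (show 1 ≤ |s| by linarith)
      (show -α ≤ 0 by linarith)
    have key : (|s| ^ σ - 1) * (1 - |s| ^ (-r)) * (|1 - s| ^ (-(1 + 2 * γ)) * |s| ^ (-α))
        ≤ 4 * |s| ^ (-(5 / 4) : ℝ) := by
      calc _ ≤ |s| ^ σ * (4 * |s| ^ (-(1 + 2 * γ)) * 1) := by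
            gcongr
            nlinarith
        _ = 4 * |s| ^ (σ - (1 + 2 * γ)) := by
            rw [sub_eq_add_neg σ, Real.rpow_add hs0]; ring
        _ ≤ 4 * |s| ^ (-(5 / 4) : ℝ) := by
            gcongr 4 * ?_
            exact Real.rpow_le_rpow_of_exponent_le (by linarith) (by linarith)
    linarith

/-! ### The ground state representation -/

theorem ae_ne (a : ℝ) : ∀ᵐ x : ℝ, x ≠ a :=
  compl_mem_ae_iff.2 (measure_singleton a)

theorem ae_prod_fst {P : ℝ → Prop} (h : ∀ᵐ x, P x) : ∀ᵐ z : ℝ × ℝ, P z.1 := by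
  rw [Measure.volume_eq_prod]
  exact (Measure.quasiMeasurePreserving_fst (μ := (volume : Measure ℝ))
    (ν := (volume : Measure ℝ))).ae h

theorem ae_prod_snd {P : ℝ → Prop} (h : ∀ᵐ x, P x) : ∀ᵐ z : ℝ × ℝ, P z.2 := by
  rw [Measure.volume_eq_prod]
  exact (Measure.quasiMeasurePreserving_snd (μ := (volume : Measure ℝ))
    (ν := (volume : Measure ℝ))).ae h

/-- Integrating `A = B + C` with `A, B ≥ 0` of possibly infinite integral and `C` integrable of
nonpositive integral, without subtraction in `[0,∞]`. -/
theorem lintegral_add_ofReal_eq {X : Type*} [MeasurableSpace X] {μ : Measure X} {A B C : X → ℝ}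
    (hA : AEMeasurable A μ) (hB : AEMeasurable B μ) (hA0 : ∀ z, 0 ≤ A z) (hB0 : ∀ z, 0 ≤ B z)
    (hC : Integrable C μ) (hABC : ∀ᵐ z ∂μ, A z = B z + C z) (hI : ∫ z, C z ∂μ ≤ 0) :
    ∫⁻ z, ENNReal.ofReal (A z) ∂μ + ENNReal.ofReal (-∫ z, C z ∂μ)
      = ∫⁻ z, ENNReal.ofReal (B z) ∂μ := by
  have h1 : ∫⁻ z, ENNReal.ofReal (A z) ∂μ + ∫⁻ z, ENNReal.ofReal (-C z) ∂μ
      = ∫⁻ z, ENNReal.ofReal (B z) ∂μ + ∫⁻ z, ENNReal.ofReal (C z) ∂μ := by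
    rw [← lintegral_add_left' hA.ennreal_ofReal, ← lintegral_add_left' hB.ennreal_ofReal]
    refine lintegral_congr_ae ?_
    filter_upwards [hABC] with z hz
    have hA' := hA0 z
    have hB' := hB0 z
    rcases le_total 0 (C z) with h | h
    · rw [ENNReal.ofReal_of_nonpos (by linarith : -C z ≤ 0), add_zero, hz,
        ENNReal.ofReal_add hB' h]
    · rw [ENNReal.ofReal_of_nonpos h, add_zero, ← ENNReal.ofReal_add hA' (by linarith)]
      congr 1; linarith
  have hfin : ∫⁻ z, ENNReal.ofReal (C z) ∂μ ≠ ∞ := (hC.lintegral_lt_top).ne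
  have hfin' : ∫⁻ z, ENNReal.ofReal (-C z) ∂μ ≠ ∞ := (hC.neg.lintegral_lt_top).ne
  have h2 : ∫⁻ z, ENNReal.ofReal (-C z) ∂μ
      = ∫⁻ z, ENNReal.ofReal (C z) ∂μ + ENNReal.ofReal (-∫ z, C z ∂μ) := by
    rw [integral_eq_lintegral_pos_part_sub_lintegral_neg_part hC] at hI ⊢
    rw [neg_sub, ENNReal.ofReal_sub _ ENNReal.toReal_nonneg, ENNReal.ofReal_toReal hfin,
      ENNReal.ofReal_toReal hfin', add_tsub_cancel_of_le]
    exact (ENNReal.toReal_le_toReal hfin hfin').1 (by linarith)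
  rw [h2, ← add_assoc, add_right_comm] at h1
  exact (ENNReal.add_left_inj hfin).1 h1

/-- The Hardy constant of the ground state representation. -/
def hardyConst (γ α : ℝ) : ℝ := -(2 * powConst γ 0 (-α))

theorem integrable_powConst_ground {γ α : ℝ} (h0 : 0 < γ) (h1 : γ < 1 / 2) (hα : 0 ≤ α)
    (hα1 : α < (1 - 2 * γ) / 2) :
    Integrable (fun s => (|s| ^ (-α) - 1) * kernel γ 0 1 s) :=
  integrable_powConst h0 h1 le_rfl one_pos (by rw [abs_neg, abs_of_nonneg hα]; linarith)
    (by linarith) (by linarith)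

theorem hardyConst_nonneg {γ α : ℝ} (h0 : 0 < γ) (h1 : γ < 1 / 2) (hα : 0 ≤ α)
    (hα1 : α < (1 - 2 * γ) / 2) : 0 ≤ hardyConst γ α := by
  have := powConst_nonpos (γ := γ) (α := 0) (σ := -α) (by linarith) (by linarith)
    (integrable_powConst_ground h0 h1 hα hα1)
  unfold hardyConst; linarith

theorem kernel_eq_kernel_zero (γ α x y : ℝ) :
    kernel γ α x y = kernel γ 0 x y * (|x| ^ (-α) * |y| ^ (-α)) := by
  unfold kernel
  rw [Real.rpow_zero, Real.rpow_zero, mul_one, mul_one, Real.rpow_neg (abs_nonneg _),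
    Real.rpow_neg (abs_nonneg _), ← mul_inv, one_div, one_div, ← mul_inv, mul_assoc]

theorem integrable_prod_powDiff {γ α σ : ℝ}
    (hp : Integrable (fun s => (|s| ^ σ - 1) * kernel γ α 1 s)) {g : ℝ → ℝ} (hg : AEMeasurable g)
    (hint : Integrable (fun x => g x * |x| ^ (σ - (2 * γ + 2 * α)))) :
    Integrable (fun z : ℝ × ℝ => g z.1 * ((|z.2| ^ σ - |z.1| ^ σ) * kernel γ α z.1 z.2)) := by
  rw [Measure.volume_eq_prod, integrable_prod_iff]
  · constructor
    · filter_upwards [ae_ne 0] with x hx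
      exact (integrable_powDiff hp hx).const_mul (g x)
    · refine (hint.abs.mul_const (∫ s, |(|s| ^ σ - 1) * kernel γ α 1 s|)).congr ?_
      filter_upwards [ae_ne 0] with x hx
      simp only [Real.norm_eq_abs]
      simp_rw [abs_mul (g x)]
      rw [integral_const_mul, integral_abs_powDiff γ α σ hx,
        abs_of_nonneg (by positivity : 0 ≤ |x| ^ (σ - (2 * γ + 2 * α))), ← mul_assoc]
  · exact ((hg.comp_quasiMeasurePreserving Measure.quasiMeasurePreserving_fst).mul
      (Measurable.aemeasurable (by fun_prop))).aestronglyMeasurable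

theorem integral_prod_powDiff {γ α σ : ℝ}
    (hp : Integrable (fun s => (|s| ^ σ - 1) * kernel γ α 1 s)) {g : ℝ → ℝ} (hg : AEMeasurable g)
    (hint : Integrable (fun x => g x * |x| ^ (σ - (2 * γ + 2 * α)))) :
    ∫ z : ℝ × ℝ, g z.1 * ((|z.2| ^ σ - |z.1| ^ σ) * kernel γ α z.1 z.2)
      = (∫ x, g x * |x| ^ (σ - (2 * γ + 2 * α))) * powConst γ α σ := by
  have h := integrable_prod_powDiff hp hg hint
  rw [Measure.volume_eq_prod] at h
  rw [Measure.volume_eq_prod, integral_prod _ h, ← integral_mul_const]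
  refine integral_congr_ae ?_
  filter_upwards [ae_ne 0] with x hx
  rw [integral_const_mul, integral_powDiff γ α σ hx, ← mul_assoc]

/-- The ground state representation: writing `w = |x|^α v`, the weighted energy of `w` and the
unweighted energy of `v` differ by a Hardy term with a nonnegative constant. -/
theorem normSq_add_hardy {γ α : ℝ} (h0 : 0 < γ) (h1 : γ < 1 / 2) (hα : 0 ≤ α)
    (hα1 : α < (1 - 2 * γ) / 2) {w : ℝ → ℝ} (hw : AEMeasurable w)
    (hint : Integrable (fun x => w x ^ 2 * |x| ^ (-(2 * γ + 2 * α)))) :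
    normSq γ α w + ENNReal.ofReal (hardyConst γ α * ∫ x, w x ^ 2 * |x| ^ (-(2 * γ + 2 * α)))
      = normSq γ 0 (fun x => |x| ^ (-α) * w x) := by
  have hp := integrable_powConst_ground h0 h1 hα hα1
  have hv : AEMeasurable (fun x => |x| ^ (-α) * w x) :=
    (Measurable.aemeasurable (by fun_prop)).mul hw
  -- With `ω = |x|^{-α}`, pointwise `(w(x) - w(y))² ω(x) ω(y) - (ω(x) w(x) - ω(y) w(y))²` is
  -- `w(x)² ω(x) (ω(y) - ω(x))` plus the same expression with `x` and `y` exchanged; the factor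
  -- `ω(y) - ω(x)` integrates against the kernel to a multiple of a power of `|x|`.
  set g : ℝ → ℝ := fun x => w x ^ 2 * |x| ^ (-α) with hg
  have hgm : AEMeasurable g := (hw.pow_const 2).mul (Measurable.aemeasurable (by fun_prop))
  have hgw : (fun x => w x ^ 2 * |x| ^ (-(2 * γ + 2 * α)))
      =ᵐ[volume] fun x => g x * |x| ^ (-α - (2 * γ + 2 * 0)) := by
    filter_upwards [ae_ne 0] with x hx
    simp only [hg]
    rw [mul_assoc, ← Real.rpow_add (abs_pos.2 hx)]; ring_nf
  set C₁ : ℝ × ℝ → ℝ := fun z =>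
    g z.1 * ((|z.2| ^ (-α) - |z.1| ^ (-α)) * kernel γ 0 z.1 z.2) with hC₁
  have hC₁int : Integrable C₁ := integrable_prod_powDiff hp hgm (hint.congr hgw)
  have hC₁I : ∫ z, C₁ z = (∫ x, w x ^ 2 * |x| ^ (-(2 * γ + 2 * α))) * powConst γ 0 (-α) := by
    rw [integral_congr_ae hgw]
    exact integral_prod_powDiff hp hgm (hint.congr hgw)
  have hC₂int : Integrable (fun z : ℝ × ℝ => C₁ z.swap) := hC₁int.swap
  have hC₂I : ∫ z : ℝ × ℝ, C₁ z.swap = ∫ z, C₁ z := by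
    rw [Measure.volume_eq_prod]; exact integral_prod_swap _
  have hH : 0 ≤ ∫ x, w x ^ 2 * |x| ^ (-(2 * γ + 2 * α)) :=
    integral_nonneg fun x => by positivity
  have hsum : ∫ z, (C₁ z + C₁ z.swap)
      = -(hardyConst γ α * ∫ x, w x ^ 2 * |x| ^ (-(2 * γ + 2 * α))) := by
    rw [integral_add hC₁int hC₂int, hC₂I, hC₁I, hardyConst]; ring
  have hc0 := hardyConst_nonneg h0 h1 hα hα1
  have := lintegral_add_ofReal_eq (μ := (volume : Measure (ℝ × ℝ)))
    (A := fun z : ℝ × ℝ => (w z.1 - w z.2) ^ 2 * kernel γ α z.1 z.2)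
    (B := fun z : ℝ × ℝ => (|z.1| ^ (-α) * w z.1 - |z.2| ^ (-α) * w z.2) ^ 2 * kernel γ 0 z.1 z.2)
    (C := fun z => C₁ z + C₁ z.swap)
    (((aemeasurable_diff hw).pow_const 2).mul (measurable_kernel γ α).aemeasurable)
    (((aemeasurable_diff hv).pow_const 2).mul (measurable_kernel γ 0).aemeasurable)
    (fun z => mul_nonneg (sq_nonneg _) (kernel_nonneg ..))
    (fun z => mul_nonneg (sq_nonneg _) (kernel_nonneg ..)) (hC₁int.add hC₂int) ?_ ?_
  · rw [hsum, neg_neg] at this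
    rw [normSq_eq_lintegral_prod γ α hw, normSq_eq_lintegral_prod γ 0 hv]
    exact this
  · refine ae_of_all _ fun z => ?_
    simp only [hC₁, hg, Prod.fst_swap, Prod.snd_swap]
    rw [kernel_eq_kernel_zero γ α, kernel_symm γ 0 z.2 z.1]
    ring
  · rw [hsum]
    have := mul_nonneg hc0 hH
    linarith

/-! ### Functions of finite energy -/

/-- Bounded, compactly supported Lipschitz functions have finite energy. The integrand is dominated
by a product of functions of one variable, symmetrized. -/
theorem normSq_lt_top_of_lipschitz {γ α : ℝ} (h0 : 0 < γ) (h1 : γ < 1 / 2) (hα : 0 ≤ α)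
    (hα1 : α < 1) {φ : ℝ → ℝ} {L M R : ℝ} (hL0 : 0 ≤ L) (hL : ∀ x y, |φ x - φ y| ≤ L * |x - y|)
    (hM : ∀ x, |φ x| ≤ M) (hR : 1 ≤ R) (hsupp : ∀ x, R < |x| → φ x = 0) :
    normSq γ α φ < ∞ := by
  have hM0 : 0 ≤ M := (abs_nonneg _).trans (hM 0)
  have hφm : Measurable φ := by
    have : LipschitzWith (Real.toNNReal L) φ := LipschitzWith.of_dist_le' fun x y => by
      simpa only [Real.dist_eq] using hL x y
    exact this.continuous.measurable
  set h : ℝ → ℝ := (Set.Icc (-R) R).indicator (fun x => |x| ^ (-α)) with hh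
  set m₁ : ℝ → ℝ := (Set.Icc (-(2 * R)) (2 * R)).indicator (fun x => |x| ^ (-α)) with hm₁
  set m₂ : ℝ → ℝ := {x | 2 * R ≤ |x|}.indicator (fun x => |x| ^ (-α - (1 + 2 * γ))) with hm₂
  set K₁ : ℝ := L ^ 2 * (3 * R) ^ (1 - 2 * γ) with hK₁
  have hK₁0 : 0 ≤ K₁ := by positivity
  set m : ℝ → ℝ := fun y => K₁ * m₁ y + 4 * M ^ 2 * m₂ y with hm
  have hh0 : ∀ x, 0 ≤ h x := fun x => Set.indicator_nonneg (fun _ _ => by positivity) _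
  have hm₁0 : ∀ x, 0 ≤ m₁ x := fun x => Set.indicator_nonneg (fun _ _ => by positivity) _
  have hm₂0 : ∀ x, 0 ≤ m₂ x := fun x => Set.indicator_nonneg (fun _ _ => by positivity) _
  have hm0 : ∀ x, 0 ≤ m x := fun x => by
    have := hm₁0 x; have := hm₂0 x; simp only [hm]; positivity
  have ih : Integrable h :=
    (integrableOn_abs_rpow_Icc (by linarith) R).integrable_indicator measurableSet_Icc
  have im : Integrable m :=
    (((integrableOn_abs_rpow_Icc (by linarith) (2 * R)).integrable_indicator
      measurableSet_Icc).const_mul K₁).add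
    (((integrableOn_abs_rpow_compl (by linarith) (by linarith)).integrable_indicator
      (measurableSet_le_abs (2 * R))).const_mul (4 * M ^ 2))
  have hkey : ∀ x y : ℝ, x ≠ 0 → y ≠ 0 → |x| ≤ R →
      (φ x - φ y) ^ 2 * kernel γ α x y ≤ h x * m y := by
    intro x y hx hy hxR
    have hx0 := abs_pos.2 hx
    have hy0 := abs_pos.2 hy
    rcases eq_or_ne x y with rfl | hxy
    · simpa using mul_nonneg (hh0 x) (hm0 x)
    have hd0 : 0 < |x - y| := abs_pos.2 (sub_ne_zero.2 hxy)
    have hk : kernel γ α x y = |x - y| ^ (-(1 + 2 * γ)) * (|x| ^ (-α) * |y| ^ (-α)) := by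
      rw [kernel_eq_kernel_zero, kernel, Real.rpow_zero, Real.rpow_zero, mul_one, mul_one,
        Real.rpow_neg hd0.le, one_div]
    have hhx : h x = |x| ^ (-α) := Set.indicator_of_mem (Set.mem_Icc.2 (abs_le.1 hxR)) _
    rw [hk, hhx]
    rcases le_total |y| (2 * R) with hyR | hyR
    · have hmy : m₁ y = |y| ^ (-α) := Set.indicator_of_mem (Set.mem_Icc.2 (abs_le.1 hyR)) _
      have hD : (φ x - φ y) ^ 2 * |x - y| ^ (-(1 + 2 * γ)) ≤ K₁ := by
        calc (φ x - φ y) ^ 2 * |x - y| ^ (-(1 + 2 * γ))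
            ≤ (L * |x - y|) ^ 2 * |x - y| ^ (-(1 + 2 * γ)) := by
              gcongr ?_ * _
              exact sq_le_sq.2 (by rw [abs_of_nonneg (by positivity : 0 ≤ L * |x - y|)]; exact hL x y)
          _ = L ^ 2 * |x - y| ^ (1 - 2 * γ) := by
              rw [mul_pow, mul_assoc, ← Real.rpow_two |x - y|, ← Real.rpow_add hd0]; ring_nf
          _ ≤ K₁ := by
              rw [hK₁]
              gcongr L ^ 2 * ?_
              exact Real.rpow_le_rpow hd0.le ((abs_sub x y).trans (by linarith)) (by linarith)
      calc _ = (φ x - φ y) ^ 2 * |x - y| ^ (-(1 + 2 * γ)) * (|x| ^ (-α) * |y| ^ (-α)) := by ring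
        _ ≤ K₁ * (|x| ^ (-α) * |y| ^ (-α)) := by gcongr
        _ = |x| ^ (-α) * (K₁ * m₁ y) := by rw [hmy]; ring
        _ ≤ |x| ^ (-α) * m y := by
            gcongr
            have := hm₂0 y
            simp only [hm]
            have : 0 ≤ 4 * M ^ 2 * m₂ y := by positivity
            linarith
    · have hmy : m₂ y = |y| ^ (-α - (1 + 2 * γ)) := Set.indicator_of_mem (s := {x | 2 * R ≤ |x|}) hyR _
      have hφy : φ y = 0 := hsupp y (by linarith)
      have hk2 : |x - y| ^ (-(1 + 2 * γ)) ≤ 4 * |y| ^ (-(1 + 2 * γ)) := by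
        refine rpow_neg_half_le h0 h1 hy0 ?_
        have := abs_sub_abs_le_abs_sub y x
        rw [abs_sub_comm] at this
        linarith
      have hφx : (φ x - φ y) ^ 2 ≤ M ^ 2 := by
        rw [hφy, sub_zero]; exact sq_le_sq.2 (by rw [abs_of_nonneg hM0]; exact hM x)
      calc _ ≤ M ^ 2 * (4 * |y| ^ (-(1 + 2 * γ)) * (|x| ^ (-α) * |y| ^ (-α))) := by gcongr
        _ = |x| ^ (-α) * (4 * M ^ 2 * m₂ y) := by
            rw [hmy, sub_eq_add_neg, Real.rpow_add hy0]; ring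
        _ ≤ |x| ^ (-α) * m y := by
            gcongr
            have := hm₁0 y
            simp only [hm]
            have : 0 ≤ K₁ * m₁ y := by positivity
            linarith
  have iF : Integrable (fun z : ℝ × ℝ => h z.1 * m z.2 + m z.1 * h z.2) :=
    (ih.mul_prod im).add (im.mul_prod ih)
  rw [normSq_eq_lintegral_prod γ α hφm.aemeasurable]
  refine lt_of_le_of_lt (lintegral_mono_ae ?_) iF.lintegral_lt_top
  filter_upwards [ae_prod_fst (ae_ne 0), ae_prod_snd (ae_ne 0)] with z hz1 hz2
  refine ENNReal.ofReal_le_ofReal ?_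
  have p1 := mul_nonneg (hh0 z.1) (hm0 z.2)
  have p2 := mul_nonneg (hm0 z.1) (hh0 z.2)
  rcases le_or_gt |z.1| R with h | h
  · linarith [hkey z.1 z.2 hz1 hz2 h]
  rcases le_or_gt |z.2| R with h' | h'
  · have := hkey z.2 z.1 hz2 hz1 h'
    rw [kernel_symm, ← neg_sq, neg_sub] at this
    linarith
  · rw [hsupp _ h, hsupp _ h']; simp; linarith

theorem IsTestFunction.lipschitz {φ : ℝ → ℝ} (hφ : IsTestFunction φ) :
    ∃ L : ℝ, 0 ≤ L ∧ ∀ x y, |φ x - φ y| ≤ L * |x - y| := by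
  obtain ⟨L, hL⟩ := hφ.1.lipschitzWith_of_hasCompactSupport hφ.2 (by simp)
  exact ⟨L, L.2, fun x y => by simpa [Real.dist_eq] using hL.dist_le_mul x y⟩

theorem IsTestFunction.exists_supp {φ : ℝ → ℝ} (hφ : IsTestFunction φ) :
    ∃ R : ℝ, 1 ≤ R ∧ ∀ x, R < |x| → φ x = 0 := by
  obtain ⟨R, hR⟩ := hφ.2.isCompact.isBounded.subset_closedBall 0
  refine ⟨max R 1, le_max_right _ _, fun x hx => ?_⟩
  refine image_eq_zero_of_notMem_tsupport fun h => ?_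
  have := hR h
  rw [mem_closedBall_zero_iff, Real.norm_eq_abs] at this
  linarith [le_max_left R 1]

theorem IsTestFunction.exists_bound {φ : ℝ → ℝ} (hφ : IsTestFunction φ) :
    ∃ M : ℝ, ∀ x, |φ x| ≤ M := by
  obtain ⟨M, hM⟩ := hφ.1.continuous.bounded_above_of_compact_support hφ.2
  exact ⟨M, hM⟩

theorem IsTestFunction.aemeasurable {φ : ℝ → ℝ} (hφ : IsTestFunction φ) : AEMeasurable φ :=
  hφ.1.continuous.aemeasurable

theorem normSq_lt_top_of_isTestFunction {γ α : ℝ} (h0 : 0 < γ) (h1 : γ < 1 / 2) (hα : 0 ≤ α)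
    (hα1 : α < 1) {φ : ℝ → ℝ} (hφ : IsTestFunction φ) : normSq γ α φ < ∞ := by
  obtain ⟨L, hL0, hL⟩ := hφ.lipschitz
  obtain ⟨R, hR, hs⟩ := hφ.exists_supp
  obtain ⟨M, hM⟩ := hφ.exists_bound
  exact normSq_lt_top_of_lipschitz h0 h1 hα hα1 hL0 hL hM hR hs

theorem lintegral_comp_mul_left' (f : ℝ → ℝ≥0∞) {a : ℝ} (ha : a ≠ 0) :
    ∫⁻ x, f (a * x) = ENNReal.ofReal |a⁻¹| * ∫⁻ x, f x := by
  rw [← (measurableEmbedding_mulLeft₀ ha).lintegral_map, Real.map_volume_mul_left ha,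
    lintegral_smul_measure, smul_eq_mul]

/-- Dilations that concentrate a function at the origin do not increase the energy. -/
theorem normSq_comp_mul_le {γ α : ℝ} (h : 2 * γ + 2 * α ≤ 1) (w : ℝ → ℝ) {l : ℝ}
    (hl : 1 ≤ l) : normSq γ α (fun x => w (l * x)) ≤ normSq γ α w := by
  have hl0 : 0 < l := by linarith
  have hk : ∀ x y, kernel γ α x y = l ^ (1 + 2 * γ + 2 * α) * kernel γ α (l * x) (l * y) := by
    intro x y
    unfold kernel
    rw [← mul_sub, abs_mul, abs_mul, abs_mul, abs_of_pos hl0, Real.mul_rpow hl0.le (abs_nonneg _),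
      Real.mul_rpow hl0.le (abs_nonneg _), Real.mul_rpow hl0.le (abs_nonneg _),
      show l ^ (1 + 2 * γ + 2 * α) = l ^ (1 + 2 * γ) * l ^ α * l ^ α by
        rw [← Real.rpow_add hl0, ← Real.rpow_add hl0]; ring_nf]
    have : 0 < l ^ (1 + 2 * γ) := by positivity
    have : 0 < l ^ α := by positivity
    simp only [one_div, mul_inv]
    field_simp
  unfold normSq
  have hinner : ∀ x, ∫⁻ y, ENNReal.ofReal ((w (l * x) - w (l * y)) ^ 2 * kernel γ α x y)
      = ENNReal.ofReal (l ^ (1 + 2 * γ + 2 * α)) * (ENNReal.ofReal |l⁻¹| *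
        ∫⁻ y, ENNReal.ofReal ((w (l * x) - w y) ^ 2 * kernel γ α (l * x) y)) := by
    intro x
    rw [← lintegral_comp_mul_left' _ hl0.ne', ← lintegral_const_mul' _ _ ENNReal.ofReal_ne_top]
    congr 1; ext y
    rw [← ENNReal.ofReal_mul (by positivity), hk x y]
    congr 1; ring
  simp_rw [hinner]
  rw [lintegral_const_mul' _ _ ENNReal.ofReal_ne_top, lintegral_const_mul' _ _ ENNReal.ofReal_ne_top,
    lintegral_comp_mul_left'
      (fun x => ∫⁻ y, ENNReal.ofReal ((w x - w y) ^ 2 * kernel γ α x y)) hl0.ne',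
    ← mul_assoc, ← mul_assoc, ← ENNReal.ofReal_mul (by positivity),
    ← ENNReal.ofReal_mul (by positivity)]
  refine mul_le_of_le_one_left zero_le (ENNReal.ofReal_le_one.2 ?_)
  rw [abs_inv, abs_of_pos hl0, mul_assoc, ← mul_inv, ← div_eq_mul_inv,
    div_le_one (by positivity)]
  calc l ^ (1 + 2 * γ + 2 * α) ≤ l ^ (2 : ℝ) :=
        Real.rpow_le_rpow_of_exponent_le hl (by linarith)
    _ = l * l := by rw [Real.rpow_two]; ring

/-! ### Density: bounded compactly supported functions of finite energy -/

/-- Test functions bounded by `M` that vanish on `|x| > R`. -/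
def boundedTest (M R : ℝ) : Set (ℝ → ℝ) :=
  {φ | IsTestFunction φ ∧ (∀ x, |φ x| ≤ M) ∧ ∀ x, R < |x| → φ x = 0}

theorem IsTestFunction.add_smul {φ ψ : ℝ → ℝ} (hφ : IsTestFunction φ) (hψ : IsTestFunction ψ)
    (a b : ℝ) : IsTestFunction (a • φ + b • ψ) := by
  refine ⟨(contDiff_const.smul hφ.1).add (contDiff_const.smul hψ.1), ?_⟩
  exact (hφ.2.smul_left (f := fun _ => a)).add (hψ.2.smul_left (f := fun _ => b))

theorem convex_isTestFunction : Convex ℝ {φ : ℝ → ℝ | IsTestFunction φ} :=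
  fun _ hφ _ hψ a b _ _ _ => hφ.add_smul hψ a b

theorem convex_boundedTest (M R : ℝ) : Convex ℝ (boundedTest M R) := by
  rintro φ ⟨h1, h2, h3⟩ ψ ⟨k1, k2, k3⟩ a b ha hb hab
  refine ⟨h1.add_smul k1 a b, fun x => ?_, fun x hx => ?_⟩
  · have e : (a • φ + b • ψ) x = a * φ x + b * ψ x := rfl
    rw [e]
    calc |a * φ x + b * ψ x| ≤ |a * φ x| + |b * ψ x| := abs_add_le _ _
      _ = a * |φ x| + b * |ψ x| := by rw [abs_mul, abs_mul, abs_of_nonneg ha, abs_of_nonneg hb]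
      _ ≤ a * M + b * M := by
        have := mul_le_mul_of_nonneg_left (h2 x) ha
        have := mul_le_mul_of_nonneg_left (k2 x) hb
        linarith
      _ = M := by rw [← add_mul, hab, one_mul]
  · simp [h3 x hx, k3 x hx]

/-- The square of an average is at most the average of the squares. -/
theorem ofReal_sq_integral_le {μ : Measure ℝ} [IsProbabilityMeasure μ] {g : ℝ → ℝ} {M : ℝ}
    (hg : Measurable g) (hM : ∀ x, |g x| ≤ M) :
    ENNReal.ofReal ((∫ t, g t ∂μ) ^ 2) ≤ ∫⁻ t, ENNReal.ofReal (g t ^ 2) ∂μ := by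
  have i1 : Integrable g μ := Integrable.of_bound hg.aestronglyMeasurable M (ae_of_all _ hM)
  have i2 : Integrable (fun t => g t ^ 2) μ :=
    Integrable.of_bound (hg.pow_const 2).aestronglyMeasurable (M ^ 2) (ae_of_all _ fun x => by
      rw [Real.norm_eq_abs, abs_pow]; exact pow_le_pow_left₀ (abs_nonneg _) (hM x) 2)
  rw [← ofReal_integral_eq_lintegral_ofReal i2 (ae_of_all _ fun x => sq_nonneg _)]
  refine ENNReal.ofReal_le_ofReal ?_
  exact (Even.convexOn_pow (𝕜 := ℝ) (n := 2) even_two).map_integral_le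
    (continuous_pow 2).continuousOn isClosed_univ (by simp) i1 i2

theorem kernel_zero_sub (γ x y t : ℝ) : kernel γ 0 (x - t) (y - t) = kernel γ 0 x y := by
  unfold kernel; simp

/-- Averaging over translations does not increase the unweighted energy. -/
theorem normSq_average_le {γ : ℝ} {μ : Measure ℝ} [IsProbabilityMeasure μ] {v : ℝ → ℝ} {M : ℝ}
    (hv : Measurable v) (hM : ∀ x, |v x| ≤ M) :
    normSq γ 0 (fun x => ∫ t, v (x - t) ∂μ) ≤ normSq γ 0 v := by
  have hmeas : Measurable (fun q : (ℝ × ℝ) × ℝ => ENNReal.ofReal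
      ((v (q.1.1 - q.2) - v (q.1.2 - q.2)) ^ 2 * kernel γ 0 q.1.1 q.1.2)) := by
    have h1 : Measurable (fun q : (ℝ × ℝ) × ℝ => v (q.1.1 - q.2)) := hv.comp (by fun_prop)
    have h2 : Measurable (fun q : (ℝ × ℝ) × ℝ => v (q.1.2 - q.2)) := hv.comp (by fun_prop)
    have h3 : Measurable (fun q : (ℝ × ℝ) × ℝ => kernel γ 0 q.1.1 q.1.2) :=
      (measurable_kernel γ 0).comp measurable_fst
    exact (((h1.sub h2).pow_const 2).mul h3).ennreal_ofReal
  have hint : ∀ x, Integrable (fun t => v (x - t)) μ := fun x =>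
    Integrable.of_bound (hv.comp (by fun_prop)).aestronglyMeasurable M
      (ae_of_all _ fun t => hM (x - t))
  have hm : Measurable (fun x => ∫ t, v (x - t) ∂μ) := by
    have : StronglyMeasurable (fun q : ℝ × ℝ => v (q.1 - q.2)) :=
      (hv.comp (by fun_prop)).stronglyMeasurable
    exact this.integral_prod_right.measurable
  rw [normSq_eq_lintegral_prod γ 0 hm.aemeasurable, normSq_eq_lintegral_prod γ 0 hv.aemeasurable]
  calc ∫⁻ z : ℝ × ℝ, ENNReal.ofReal
        ((∫ t, v (z.1 - t) ∂μ - ∫ t, v (z.2 - t) ∂μ) ^ 2 * kernel γ 0 z.1 z.2)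
      ≤ ∫⁻ z : ℝ × ℝ, ∫⁻ t, ENNReal.ofReal
        ((v (z.1 - t) - v (z.2 - t)) ^ 2 * kernel γ 0 z.1 z.2) ∂μ := by
        refine lintegral_mono fun z => ?_
        rw [← integral_sub (hint _) (hint _), ENNReal.ofReal_mul (sq_nonneg _)]
        simp_rw [ENNReal.ofReal_mul (sq_nonneg _)]
        rw [lintegral_mul_const' _ _ ENNReal.ofReal_ne_top]
        gcongr
        refine ofReal_sq_integral_le (M := M + M)
          ((hv.comp (by fun_prop)).sub (hv.comp (by fun_prop))) fun t => ?_
        exact (abs_sub _ _).trans (add_le_add (hM _) (hM _))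
    _ = ∫⁻ t, ∫⁻ z : ℝ × ℝ, ENNReal.ofReal
        ((v (z.1 - t) - v (z.2 - t)) ^ 2 * kernel γ 0 z.1 z.2) ∂volume ∂μ :=
        lintegral_lintegral_swap hmeas.aemeasurable
    _ = ∫⁻ _ : ℝ, ∫⁻ z : ℝ × ℝ, ENNReal.ofReal
        ((v z.1 - v z.2) ^ 2 * kernel γ 0 z.1 z.2) ∂volume ∂μ := by
        congr 1; ext t
        have := lintegral_sub_right_eq_self (μ := (volume : Measure (ℝ × ℝ)))
          (fun z : ℝ × ℝ => ENNReal.ofReal ((v z.1 - v z.2) ^ 2 * kernel γ 0 z.1 z.2)) (t, t)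
        simpa [kernel_zero_sub] using this
    _ = _ := by rw [lintegral_const, measure_univ, mul_one]

/-- The probability measure with density a normalized bump function. -/
def bumpMeasure (ψ : ContDiffBump (0 : ℝ)) : Measure ℝ :=
  volume.withDensity fun t => ENNReal.ofReal (ψ.normed volume t)

theorem measurable_normed (ψ : ContDiffBump (0 : ℝ)) : Measurable (ψ.normed volume) :=
  (ψ.continuous_normed).measurable

instance (ψ : ContDiffBump (0 : ℝ)) : IsProbabilityMeasure (bumpMeasure ψ) := by
  constructor
  rw [bumpMeasure, withDensity_apply _ MeasurableSet.univ, Measure.restrict_univ,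
    ← ofReal_integral_eq_lintegral_ofReal ψ.integrable_normed
      (ae_of_all _ fun x => ψ.nonneg_normed x), ψ.integral_normed, ENNReal.ofReal_one]

theorem convolution_eq_average (ψ : ContDiffBump (0 : ℝ)) (v : ℝ → ℝ) (x : ℝ) :
    convolution (ψ.normed volume) v (ContinuousLinearMap.lsmul ℝ ℝ) volume x
      = ∫ t, v (x - t) ∂(bumpMeasure ψ) := by
  rw [convolution_def, bumpMeasure, integral_withDensity_eq_integral_toReal_smul
    (measurable_normed ψ).ennreal_ofReal (ae_of_all _ fun _ => ENNReal.ofReal_lt_top)]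
  congr 1; ext t
  rw [ENNReal.toReal_ofReal (ψ.nonneg_normed t)]
  rfl

theorem bumpMeasure_ae (ψ : ContDiffBump (0 : ℝ)) : ∀ᵐ t ∂(bumpMeasure ψ), |t| < ψ.rOut := by
  rw [bumpMeasure, ae_withDensity_iff (measurable_normed ψ).ennreal_ofReal]
  refine ae_of_all _ fun t ht => ?_
  have h : t ∈ Function.support (ψ.normed volume) := fun h => ht (by rw [h]; simp)
  rw [ψ.support_normed_eq, mem_ball_zero_iff] at h
  exact h

theorem average_congr (ψ : ContDiffBump (0 : ℝ)) {v w : ℝ → ℝ} {x : ℝ}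
    (h : ∀ y, |y - x| < ψ.rOut → v y = w y) :
    ∫ t, v (x - t) ∂(bumpMeasure ψ) = ∫ t, w (x - t) ∂(bumpMeasure ψ) := by
  refine integral_congr_ae ?_
  filter_upwards [bumpMeasure_ae ψ] with t ht
  exact h _ (by rw [show x - t - x = -t by ring, abs_neg]; exact ht)

theorem abs_average_le (ψ : ContDiffBump (0 : ℝ)) {v : ℝ → ℝ} {x B : ℝ}
    (h : ∀ y, |y - x| < ψ.rOut → |v y| ≤ B) : |∫ t, v (x - t) ∂(bumpMeasure ψ)| ≤ B := by
  have : ∀ᵐ t ∂(bumpMeasure ψ), ‖v (x - t)‖ ≤ B := by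
    filter_upwards [bumpMeasure_ae ψ] with t ht
    exact h _ (by rw [show x - t - x = -t by ring, abs_neg]; exact ht)
  simpa using norm_integral_le_of_norm_le_const this

/-- A product with a function bounded by `1`. -/
theorem normSq_mul_le {γ α : ℝ} {a w : ℝ → ℝ} {M : ℝ} (ha : AEMeasurable a) (hw : AEMeasurable w)
    (ha1 : ∀ x, |a x| ≤ 1) (hM : ∀ x, |w x| ≤ M) :
    normSq γ α (fun x => a x * w x)
      ≤ 2 * normSq γ α w + ENNReal.ofReal (2 * M ^ 2) * normSq γ α a := by
  rw [normSq_eq_lintegral_prod γ α ha, normSq_eq_lintegral_prod γ α hw,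
    normSq_eq_lintegral_prod γ α (u := fun x => a x * w x) (ha.mul hw),
    ← lintegral_const_mul' _ _ (by simp), ← lintegral_const_mul' _ _ ENNReal.ofReal_ne_top,
    ← lintegral_add_left' ((aemeasurable_energy_density γ α hw).const_mul 2)]
  refine lintegral_mono fun z => ?_
  have hk := kernel_nonneg γ α z.1 z.2
  have h2 : (2 : ℝ≥0∞) = ENNReal.ofReal 2 := by simp
  rw [h2, ← ENNReal.ofReal_mul (by norm_num), ← ENNReal.ofReal_mul (by positivity),
    ← ENNReal.ofReal_add (by positivity) (by positivity)]
  refine ENNReal.ofReal_le_ofReal ?_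
  rw [← mul_assoc, ← mul_assoc, ← add_mul]
  refine mul_le_mul_of_nonneg_right ?_ hk
  have e1 : a z.1 ^ 2 ≤ 1 := by rw [← sq_abs]; nlinarith [ha1 z.1, abs_nonneg (a z.1)]
  have e2 : w z.2 ^ 2 ≤ M ^ 2 := by
    rw [← sq_abs]; nlinarith [hM z.2, abs_nonneg (w z.2)]
  have e3 : a z.1 * w z.1 - a z.2 * w z.2
      = a z.1 * (w z.1 - w z.2) + w z.2 * (a z.1 - a z.2) := by ring
  rw [e3]
  nlinarith [sq_nonneg (a z.1 * (w z.1 - w z.2) - w z.2 * (a z.1 - a z.2)),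
    mul_le_mul_of_nonneg_right e1 (sq_nonneg (w z.1 - w z.2)),
    mul_le_mul_of_nonneg_right e2 (sq_nonneg (a z.1 - a z.2))]

theorem integrable_sq_mul_rpow {w : ℝ → ℝ} {M R r : ℝ} (hw : AEMeasurable w)
    (hM : ∀ x, |w x| ≤ M) (hsupp : ∀ x, R < |x| → w x = 0) (hr : -1 < r) :
    Integrable (fun x => w x ^ 2 * |x| ^ r) := by
  refine (((integrableOn_abs_rpow_Icc hr R).integrable_indicator
    measurableSet_Icc).const_mul (M ^ 2)).mono' ?_ (ae_of_all _ fun x => ?_)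
  · exact ((hw.pow_const 2).mul (Measurable.aemeasurable (by fun_prop))).aestronglyMeasurable
  · rw [Real.norm_eq_abs, abs_of_nonneg (by positivity)]
    rcases le_or_gt |x| R with h | h
    · rw [Set.indicator_of_mem (Set.mem_Icc.2 (abs_le.1 h))]
      refine mul_le_mul_of_nonneg_right ?_ (by positivity)
      rw [← sq_abs]
      exact pow_le_pow_left₀ (abs_nonneg _) (hM x) 2
    · rw [hsupp x h, Set.indicator_of_notMem
        (fun h' => absurd (abs_le.2 (Set.mem_Icc.1 h')) (not_le.2 h))]
      simp

/-- Cutting off near the origin, where a point has zero capacity, and mollifying `|x|^{-α} w` shows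
that bounded compactly supported functions `w` of finite energy are energy limits of uniformly
bounded test functions with supports in a common compact set. -/
theorem energyLimit_of_bounded_support_of_measurable {γ α : ℝ} (h0 : 0 < γ) (h1 : γ < 1 / 2)
    (hα : 0 ≤ α) (hα1 : α < (1 - 2 * γ) / 2) {w : ℝ → ℝ} {M R : ℝ} (hw : Measurable w)
    (hM : ∀ x, |w x| ≤ M) (hsupp : ∀ x, R < |x| → w x = 0) (hfin : normSq γ α w < ∞) :
    EnergyLimit γ α (boundedTest (2 * M) (R + 1)) w := by
  have hM0 : 0 ≤ M := (abs_nonneg _).trans (hM 0)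
  let θ : ContDiffBump (0 : ℝ) := ⟨1, 2, one_pos, one_lt_two⟩
  have hθt : IsTestFunction θ := ⟨θ.contDiff, θ.hasCompactSupport⟩
  set l : ℕ → ℝ := fun n => (n : ℝ) + 1 with hl
  have hl1 : ∀ n, 1 ≤ l n := fun n => by simp [hl]
  have hl0 : ∀ n, 0 < l n := fun n => lt_of_lt_of_le one_pos (hl1 n)
  -- The cutoff `a n` vanishes on `|x| ≤ 1 / l n`; its energy stays bounded under the dilations.
  set a : ℕ → ℝ → ℝ := fun n x => 1 - θ (l n * x) with ha
  have ham : ∀ n, Measurable (a n) := fun n =>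
    measurable_const.sub (θ.continuous.measurable.comp (by fun_prop))
  have ha1 : ∀ n x, |a n x| ≤ 1 := fun n x => by
    rw [abs_le]; constructor <;> simp only [ha] <;>
      linarith [θ.nonneg' (l n * x), θ.le_one (x := l n * x)]
  have ha0 : ∀ n x, |x| ≤ 1 / l n → a n x = 0 := fun n x hx => by
    have : θ (l n * x) = 1 := θ.one_of_mem_closedBall (by
      rw [mem_closedBall_zero_iff, Real.norm_eq_abs, abs_mul, abs_of_pos (hl0 n)]
      rw [le_div_iff₀ (hl0 n)] at hx
      show l n * |x| ≤ 1
      linarith)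
    simp [ha, this]
  have ha2 : ∀ n x, 2 / l n ≤ |x| → a n x = 1 := fun n x hx => by
    have : θ (l n * x) = 0 := θ.zero_of_le_dist (by
      rw [Real.dist_eq, sub_zero, abs_mul, abs_of_pos (hl0 n)]
      rw [div_le_iff₀ (hl0 n)] at hx
      show 2 ≤ l n * |x|
      linarith)
    simp [ha, this]
  set ε : ℕ → ℝ := fun n => 1 / (2 * l n) with hε
  have hε0 : ∀ n, 0 < ε n := fun n => by have := hl0 n; simp only [hε]; positivity
  have hε2 : ∀ n, 1 / l n = 2 * ε n := fun n => by
    have := (hl0 n).ne'; simp only [hε]; field_simp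
  have hε1 : ∀ n, ε n ≤ 1 := fun n => by
    simp only [hε]
    rw [div_le_one (by have := hl0 n; positivity)]
    linarith [hl1 n]
  -- The mollification scale is half the radius of the hole, so that mollified functions vanish
  -- near the origin and the factor `|x|^α` does not spoil their smoothness.
  let ψ : ℕ → ContDiffBump (0 : ℝ) := fun n =>
    ⟨ε n / 2, ε n, half_pos (hε0 n), half_lt_self (hε0 n)⟩
  have hψ : ∀ n, (ψ n).rOut = ε n := fun n => rfl
  set v : ℝ → ℝ := fun x => |x| ^ (-α) * w x with hv
  set va : ℕ → ℝ → ℝ := fun n x => |x| ^ (-α) * (a n x * w x) with hva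
  have hvm : Measurable v := by simp only [hv]; fun_prop
  have hvam : ∀ n, Measurable (va n) := fun n => by
    have := ham n; simp only [hva]; fun_prop
  have hvaM : ∀ n x, |va n x| ≤ M * |x| ^ (-α) := fun n x => by
    simp only [hva]
    rw [abs_mul, abs_mul, abs_of_nonneg (by positivity : 0 ≤ |x| ^ (-α)), mul_comm]
    gcongr
    calc |a n x| * |w x| ≤ 1 * M := mul_le_mul (ha1 n x) (hM x) (abs_nonneg _) zero_le_one
      _ = M := one_mul M
  have hva0 : ∀ n x, |x| ≤ 2 * ε n → va n x = 0 := fun n x hx => by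
    simp only [hva]; rw [ha0 n x (by rw [hε2]; exact hx)]; simp
  have hvaR : ∀ n x, R < |x| → va n x = 0 := fun n x hx => by
    simp only [hva]; rw [hsupp x hx]; simp
  have hvaB : ∀ n x, |va n x| ≤ M * (2 * ε n) ^ (-α) := fun n x => by
    have := hε0 n
    rcases le_total |x| (2 * ε n) with h | h
    · rw [hva0 n x h, abs_zero]; positivity
    · refine (hvaM n x).trans ?_
      gcongr M * ?_
      exact Real.rpow_le_rpow_of_nonpos (by linarith) h (by linarith)
  set vn : ℕ → ℝ → ℝ := fun n x => ∫ t, va n (x - t) ∂(bumpMeasure (ψ n)) with hvn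
  have hvn0 : ∀ n x, |x| < ε n → vn n x = 0 := fun n x hx => by
    have := average_congr (ψ n) (v := va n) (w := fun _ => 0) (x := x) fun y hy => by
      refine hva0 n y ?_
      rw [hψ] at hy
      have := abs_sub_abs_le_abs_sub y x
      linarith
    simpa [hvn] using this
  have hvnR : ∀ n x, R + 1 < |x| → vn n x = 0 := fun n x hx => by
    have := average_congr (ψ n) (v := va n) (w := fun _ => 0) (x := x) fun y hy => by
      refine hvaR n y ?_
      rw [hψ] at hy
      have := abs_sub_abs_le_abs_sub x y
      rw [abs_sub_comm] at this
      linarith [hε1 n]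
    simpa [hvn] using this
  have hvnM : ∀ n x, x ≠ 0 → |vn n x| ≤ 2 * M * |x| ^ (-α) := fun n x hx => by
    have hx0 := abs_pos.2 hx
    refine abs_average_le (ψ n) fun y hy => ?_
    rw [hψ] at hy
    rcases le_total |y| (2 * ε n) with h | h
    · rw [hva0 n y h, abs_zero]; positivity
    · refine (hvaM n y).trans ?_
      have h3 : |x| / 2 ≤ |y| := by
        have := abs_sub_abs_le_abs_sub x y
        rw [abs_sub_comm] at this
        linarith [hε0 n]
      calc M * |y| ^ (-α) ≤ M * (|x| / 2) ^ (-α) := by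
            gcongr M * ?_
            exact Real.rpow_le_rpow_of_nonpos (by linarith) h3 (by linarith)
        _ = M * ((1 / 2 : ℝ) ^ (-α) * |x| ^ (-α)) := by
            rw [← Real.mul_rpow (by norm_num) hx0.le]; ring_nf
        _ ≤ M * ((1 / 2 : ℝ) ^ (-1 : ℝ) * |x| ^ (-α)) := by
            gcongr M * (?_ * _)
            exact Real.rpow_le_rpow_of_exponent_ge (by norm_num) (by norm_num) (by linarith)
        _ = 2 * M * |x| ^ (-α) := by rw [Real.rpow_neg (by norm_num)]; norm_num; ring
  set φ : ℕ → ℝ → ℝ := fun n x => |x| ^ α * vn n x with hφ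
  have hvi : Integrable v := by
    refine (((integrableOn_abs_rpow_Icc (r := -α) (by linarith) R).integrable_indicator
      measurableSet_Icc).const_mul M).mono' hvm.aestronglyMeasurable (ae_of_all _ fun x => ?_)
    rw [Real.norm_eq_abs]
    rcases le_or_gt |x| R with h | h
    · rw [Set.indicator_of_mem (Set.mem_Icc.2 (abs_le.1 h))]
      simp only [hv]
      rw [abs_mul, abs_of_nonneg (by positivity : 0 ≤ |x| ^ (-α)), mul_comm]
      gcongr; exact hM x
    · simp only [hv]
      rw [hsupp x h, mul_zero, abs_zero]
      exact mul_nonneg hM0 (Set.indicator_nonneg (fun _ _ => by positivity) _)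
  have hvai : ∀ n, Integrable (va n) := fun n => by
    refine hvi.norm.mono' (hvam n).aestronglyMeasurable (ae_of_all _ fun x => ?_)
    simp only [hva, hv, norm_mul]
    gcongr
    exact mul_le_of_le_one_left (norm_nonneg _) (ha1 n x)
  have hφt : ∀ n, IsTestFunction (φ n) := fun n => by
    have hsm : ContDiff ℝ ((⊤ : ℕ∞) : WithTop ℕ∞) (vn n) := by
      have := (ψ n).hasCompactSupport_normed (μ := volume) |>.contDiff_convolution_left
        (ContinuousLinearMap.lsmul ℝ ℝ) (n := (⊤ : ℕ∞)) (ψ n).contDiff_normed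
        (hvai n).locallyIntegrable
      have e : convolution ((ψ n).normed volume) (va n) (ContinuousLinearMap.lsmul ℝ ℝ) volume
          = vn n := funext fun x => convolution_eq_average (ψ n) (va n) x
      rwa [e] at this
    constructor
    · rw [contDiff_iff_contDiffAt]
      intro x
      rcases lt_or_ge |x| (ε n) with hx | hx
      · have : φ n =ᶠ[𝓝 x] fun _ => 0 := by
          filter_upwards [(isOpen_lt continuous_abs continuous_const).mem_nhds
            (show x ∈ {y : ℝ | |y| < ε n} from hx)] with y hy
          simp only [hφ]; rw [hvn0 n y hy, mul_zero]
        exact contDiffAt_const.congr_of_eventuallyEq this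
      · have hx0 : x ≠ 0 := abs_pos.1 (lt_of_lt_of_le (hε0 n) hx)
        exact ((contDiffAt_abs hx0).rpow_const_of_ne (abs_pos.2 hx0).ne').mul hsm.contDiffAt
    · refine HasCompactSupport.intro (isCompact_Icc (a := -(R + 1)) (b := R + 1)) fun x hx => ?_
      simp only [hφ]
      rw [hvnR n x (not_le.1 fun h => hx (Set.mem_Icc.2 (abs_le.1 h))), mul_zero]
  have hφb : ∀ n, φ n ∈ boundedTest (2 * M) (R + 1) := fun n => by
    refine ⟨hφt n, fun x => ?_, fun x hx => ?_⟩
    · rcases eq_or_ne x 0 with rfl | hx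
      · simp only [hφ]
        rw [hvn0 n 0 (by rw [abs_zero]; exact hε0 n)]; simp; positivity
      · have hx0 := abs_pos.2 hx
        simp only [hφ]
        rw [abs_mul, abs_of_nonneg (by positivity : 0 ≤ |x| ^ α)]
        calc |x| ^ α * |vn n x| ≤ |x| ^ α * (2 * M * |x| ^ (-α)) := by
              gcongr; exact hvnM n x hx
          _ = 2 * M * (|x| ^ α * |x| ^ (-α)) := by ring
          _ = 2 * M := by rw [← Real.rpow_add hx0, add_neg_cancel, Real.rpow_zero, mul_one]
    · simp only [hφ]; rw [hvnR n x hx, mul_zero]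
  have hs1 : -1 < -(2 * γ + 2 * α) := by linarith
  have iw := integrable_sq_mul_rpow hw.aemeasurable hM hsupp hs1
  set B : ℝ≥0∞ := 2 * normSq γ α w + ENNReal.ofReal (2 * M ^ 2) * normSq γ α θ
    + ENNReal.ofReal (hardyConst γ α * ∫ x, w x ^ 2 * |x| ^ (-(2 * γ + 2 * α))) with hB
  have hBfin : B ≠ ∞ := by
    have h3 := (normSq_lt_top_of_isTestFunction h0 h1 hα (by linarith) hθt).ne
    rw [hB]
    exact ENNReal.add_ne_top.2 ⟨ENNReal.add_ne_top.2 ⟨ENNReal.mul_ne_top (by simp) hfin.ne,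
      ENNReal.mul_ne_top ENNReal.ofReal_ne_top h3⟩, ENNReal.ofReal_ne_top⟩
  -- Dropping the Hardy term of `φ n` and keeping that of `a n * w`, the comparison is made in the
  -- translation invariant energy, which mollification does not increase.
  have hφB : ∀ n, normSq γ α (φ n) ≤ B := fun n => by
    have haw : ∀ x, |a n x * w x| ≤ M := fun x => by
      rw [abs_mul]
      calc |a n x| * |w x| ≤ 1 * M := mul_le_mul (ha1 n x) (hM x) (abs_nonneg _) zero_le_one
        _ = M := one_mul M
    have hawm : AEMeasurable (fun x => a n x * w x) := ((ham n).mul hw).aemeasurable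
    have haws : ∀ x, R < |x| → a n x * w x = 0 := fun x hx => by rw [hsupp x hx, mul_zero]
    have iaw := integrable_sq_mul_rpow hawm haw haws hs1
    have iφ := integrable_sq_mul_rpow (hφt n).aemeasurable (hφb n).2.1 (hφb n).2.2 hs1
    have g1 := normSq_add_hardy h0 h1 hα hα1 (hφt n).aemeasurable iφ
    have g2 := normSq_add_hardy h0 h1 hα hα1 hawm iaw
    have e1 : normSq γ 0 (fun x => |x| ^ (-α) * φ n x) = normSq γ 0 (vn n) := by
      refine normSq_congr γ 0 ?_
      filter_upwards [ae_ne 0] with x hx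
      simp only [hφ]
      rw [← mul_assoc, ← Real.rpow_add (abs_pos.2 hx), neg_add_cancel, Real.rpow_zero, one_mul]
    have e2 : normSq γ α (a n) ≤ normSq γ α θ := by
      refine le_trans ?_ (normSq_comp_mul_le (by linarith) θ (hl1 n))
      refine normSq_le_of_abs_diff_le fun x y => ?_
      simp only [ha]
      rw [show 1 - θ (l n * x) - (1 - θ (l n * y)) = -(θ (l n * x) - θ (l n * y)) by ring, abs_neg]
    calc normSq γ α (φ n) ≤ normSq γ 0 (vn n) := by rw [← e1, ← g1]; exact le_self_add
      _ ≤ normSq γ 0 (va n) := normSq_average_le (hvam n) (hvaB n)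
      _ = normSq γ α (fun x => a n x * w x)
          + ENNReal.ofReal (hardyConst γ α * ∫ x, (a n x * w x) ^ 2 * |x| ^ (-(2 * γ + 2 * α))) :=
          g2.symm
      _ ≤ B := by
          rw [hB]
          gcongr
          · refine (normSq_mul_le (ham n).aemeasurable hw.aemeasurable (ha1 n) hM).trans ?_
            gcongr
          · exact hardyConst_nonneg h0 h1 hα hα1
          · intro x
            refine mul_le_mul_of_nonneg_right ?_ (by positivity)
            rw [mul_pow, ← sq_abs (a n x)]
            exact mul_le_of_le_one_left (sq_nonneg _) (pow_le_one₀ (abs_nonneg _) (ha1 n x))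
  have hlim : ∀ᵐ x, Tendsto (fun n => φ n x) atTop (𝓝 (w x)) := by
    have hεlim : Tendsto ε atTop (𝓝 0) := by
      have := (tendsto_one_div_add_atTop_nhds_zero_nat (𝕜 := ℝ)).const_mul (1 / 2)
      rw [mul_zero] at this
      refine this.congr fun n => ?_
      simp only [hε, hl]
      have : (n : ℝ) + 1 ≠ 0 := by positivity
      field_simp
    have hL := ContDiffBump.ae_convolution_tendsto_right_of_locallyIntegrable (φ := ψ) (K := 2)
      (l := atTop) (g := v) (μ := volume) (by simpa only [hψ] using hεlim)
      (Eventually.of_forall fun n => by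
        show ε n ≤ 2 * (ε n / 2)
        linarith) hvi.locallyIntegrable
    filter_upwards [hL, ae_ne 0] with x hx hx0
    have hxp := abs_pos.2 hx0
    have h3 : Tendsto (fun n => |x| ^ α * vn n x) atTop (𝓝 (|x| ^ α * v x)) := by
      refine (hx.congr' ?_).const_mul _
      filter_upwards [hεlim.eventually_lt_const (show 0 < |x| / 5 by positivity)] with n hn
      rw [convolution_eq_average]
      refine average_congr (ψ n) fun y hy => ?_
      rw [hψ] at hy
      have := abs_sub_abs_le_abs_sub x y
      rw [abs_sub_comm] at this
      have h4 : 2 / l n ≤ |y| := by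
        rw [show 2 / l n = 2 * (1 / l n) by ring, hε2]; linarith
      simp only [hva, hv]; rw [ha2 n y h4, one_mul]
    have h4 : |x| ^ α * v x = w x := by
      simp only [hv]
      rw [← mul_assoc, ← Real.rpow_add hxp, add_neg_cancel, Real.rpow_zero, one_mul]
    rwa [h4] at h3
  exact energyLimit_of_bounded (convex_boundedTest _ _) (fun w hw => hw.1.aemeasurable) hBfin hφb
    hφB hlim

theorem EnergyLimit.congr {γ α : ℝ} {A : Set (ℝ → ℝ)} {u w : ℝ → ℝ} (h : EnergyLimit γ α A u)
    (huw : u =ᵐ[volume] w) : EnergyLimit γ α A w := by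
  obtain ⟨φ, h1, h2, h3⟩ := h
  refine ⟨φ, h1, h2.congr fun n => normSq_congr γ α ?_, ?_⟩
  · filter_upwards [huw] with x hx
    rw [hx]
  · filter_upwards [huw, h3] with x hx hx3
    rwa [← hx]

/-- The version for almost everywhere defined functions. -/
theorem energyLimit_of_bounded_support {γ α : ℝ} (h0 : 0 < γ) (h1 : γ < 1 / 2)
    (hα : 0 ≤ α) (hα1 : α < (1 - 2 * γ) / 2) {w : ℝ → ℝ} {M R : ℝ} (hw : AEMeasurable w)
    (hM0 : 0 ≤ M) (hM : ∀ᵐ x, |w x| ≤ M) (hsupp : ∀ᵐ x, R < |x| → w x = 0)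
    (hfin : normSq γ α w < ∞) :
    EnergyLimit γ α (boundedTest (2 * M) (R + 1)) w := by
  set w' : ℝ → ℝ := (Set.Icc (-R) R).indicator fun x => max (-M) (min M (hw.mk w x)) with hw'
  have heq : w =ᵐ[volume] w' := by
    filter_upwards [hw.ae_eq_mk, hM, hsupp] with x h1 h2 h3
    simp only [hw']
    rcases le_or_gt |x| R with h | h
    · rw [Set.indicator_of_mem (Set.mem_Icc.2 (abs_le.1 h)), ← h1,
        min_eq_right (abs_le.1 h2).2, max_eq_right (abs_le.1 h2).1]
    · rw [h3 h, Set.indicator_of_notMem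
        (fun h' => absurd (abs_le.2 (Set.mem_Icc.1 h')) (not_le.2 h))]
  refine (energyLimit_of_bounded_support_of_measurable h0 h1 hα hα1 (M := M) (R := R)
    ?_ ?_ ?_ ?_).congr heq.symm
  · exact (measurable_const.max (measurable_const.min hw.measurable_mk)).indicator measurableSet_Icc
  · intro x
    simp only [hw']
    by_cases h : x ∈ Set.Icc (-R) R
    · rw [Set.indicator_of_mem h, abs_le]
      exact ⟨le_max_left _ _, max_le (by linarith) (min_le_left _ _)⟩
    · rw [Set.indicator_of_notMem h, abs_zero]; exact hM0
  · intro x h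
    exact Set.indicator_of_notMem
      (fun h' => absurd (abs_le.2 (Set.mem_Icc.1 h')) (not_le.2 h)) _
  · rwa [← normSq_congr γ α heq]

/-! ### Polarization -/

/-- The polarization (two-point rearrangement) of `v` with respect to the reflection
`x ↦ 2c - x`: the larger of the values at `x` and at its mirror image is put to the left of `c`. -/
def twoPoint (c : ℝ) (v : ℝ → ℝ) (x : ℝ) : ℝ :=
  if x < c then max (v x) (v (2 * c - x)) else min (v x) (v (2 * c - x))

/-- The polarization of `|x|^{-α} u`, expressed as an operation on `u`. -/
def polarize (α c : ℝ) (u : ℝ → ℝ) (x : ℝ) : ℝ :=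
  |x| ^ α * twoPoint c (fun y => |y| ^ (-α) * u y) x

theorem measurable_twoPoint (c : ℝ) {v : ℝ → ℝ} (hv : Measurable v) :
    Measurable (twoPoint c v) := by
  have h : Measurable (fun x => v (2 * c - x)) := hv.comp (by fun_prop)
  exact Measurable.ite measurableSet_Iio (hv.max h) (hv.min h)

theorem ae_reflect (c : ℝ) {P : ℝ → Prop} (h : ∀ᵐ x, P x) : ∀ᵐ x, P (2 * c - x) :=
  (Measure.measurePreserving_sub_left volume (2 * c)).quasiMeasurePreserving.ae h

theorem twoPoint_congr (c : ℝ) {v w : ℝ → ℝ} (h : v =ᵐ[volume] w) :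
    twoPoint c v =ᵐ[volume] twoPoint c w := by
  filter_upwards [h, ae_reflect c h] with x h1 h2
  simp only [twoPoint, h1, h2]

/-- Folding an integral at `c`. -/
theorem lintegral_fold (c : ℝ) {g : ℝ → ℝ≥0∞} (hg : Measurable g) :
    ∫⁻ x, g x = ∫⁻ x in Set.Iio c, (g x + g (2 * c - x)) := by
  rw [lintegral_add_left hg, ← lintegral_add_compl g (measurableSet_Iio (a := c))]
  congr 1
  have hpre : (fun x => 2 * c - x) ⁻¹' (Set.Ioi c) = Set.Iio c := by
    ext x; simp only [Set.mem_preimage, Set.mem_Ioi, Set.mem_Iio]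
    constructor <;> intro h <;> linarith
  have := (Measure.measurePreserving_sub_left (volume : Measure ℝ) (2 * c)).setLIntegral_comp_preimage
    (s := Set.Ioi c) measurableSet_Ioi hg
  rw [hpre] at this
  rw [this, Set.compl_Iio]
  exact setLIntegral_congr Ioi_ae_eq_Ici.symm

/-- Reflecting one of two points on the same side of `c` increases their distance. -/
theorem kernel_zero_reflect_le {γ c x y : ℝ} (h0 : 0 < γ) (hx : x < c) (hy : y < c)
    (hxy : x ≠ y) : kernel γ 0 x (2 * c - y) ≤ kernel γ 0 x y := by
  unfold kernel
  simp only [Real.rpow_zero, mul_one]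
  have h1 : 0 < |x - y| := abs_pos.2 (sub_ne_zero.2 hxy)
  refine one_div_le_one_div_of_le (by positivity) (Real.rpow_le_rpow h1.le ?_ (by linarith))
  rw [abs_sub_comm x (2 * c - y), abs_of_pos (by linarith : 0 < 2 * c - y - x)]
  exact abs_le.2 ⟨by linarith, by linarith⟩

/-- The two-point inequality behind the polarization of energies: for `a, a'` and `b, b'` the values at
two pairs of mirror points, the larger weight `K` goes to points on the same side. -/
theorem four_point {a a' b b' K K' : ℝ} (hK : K' ≤ K) :
    (max a a' - max b b') ^ 2 * K + (max a a' - min b b') ^ 2 * K'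
      + ((min a a' - max b b') ^ 2 * K' + (min a a' - min b b') ^ 2 * K)
      ≤ (a - b) ^ 2 * K + (a - b') ^ 2 * K' + ((a' - b) ^ 2 * K' + (a' - b') ^ 2 * K) := by
  rcases le_total a a' with h | h <;> rcases le_total b b' with h' | h'
  · rw [max_eq_right h, max_eq_right h', min_eq_left h, min_eq_left h']; linarith
  · rw [max_eq_right h, max_eq_left h', min_eq_left h, min_eq_right h']
    nlinarith [mul_nonneg (sub_nonneg.2 hK) (mul_nonneg (sub_nonneg.2 h) (sub_nonneg.2 h'))]
  · rw [max_eq_left h, max_eq_right h', min_eq_right h, min_eq_left h']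
    nlinarith [mul_nonneg (sub_nonneg.2 hK) (mul_nonneg (sub_nonneg.2 h) (sub_nonneg.2 h'))]
  · rw [max_eq_left h, max_eq_left h', min_eq_right h, min_eq_right h']

theorem normSq_fold (γ c : ℝ) {v : ℝ → ℝ} (hv : Measurable v) :
    normSq γ 0 v = ∫⁻ x in Set.Iio c, ∫⁻ y in Set.Iio c, ENNReal.ofReal
      ((v x - v y) ^ 2 * kernel γ 0 x y + (v x - v (2 * c - y)) ^ 2 * kernel γ 0 x (2 * c - y)
        + ((v (2 * c - x) - v y) ^ 2 * kernel γ 0 x (2 * c - y)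
          + (v (2 * c - x) - v (2 * c - y)) ^ 2 * kernel γ 0 x y)) := by
  set F : ℝ × ℝ → ℝ≥0∞ := fun z => ENNReal.ofReal ((v z.1 - v z.2) ^ 2 * kernel γ 0 z.1 z.2) with hF
  have hFm : Measurable F := by
    have := measurable_kernel γ 0; simp only [hF]; fun_prop
  have hFx : ∀ x, Measurable (fun y => F (x, y)) := fun x => hFm.comp (by fun_prop)
  have e0 : normSq γ 0 v = ∫⁻ x, ∫⁻ y, F (x, y) := rfl
  rw [e0, lintegral_fold c hFm.lintegral_prod_right']
  refine lintegral_congr fun x => ?_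
  have hFs : Measurable (fun y => F (x, y) + F (x, 2 * c - y)) :=
    (hFx x).add (hFm.comp (by fun_prop))
  rw [lintegral_fold c (hFx x), lintegral_fold c (hFx (2 * c - x)), ← lintegral_add_left hFs]
  refine lintegral_congr fun y => ?_
  have k1 : kernel γ 0 (2 * c - x) y = kernel γ 0 x (2 * c - y) := by
    unfold kernel; simp only [Real.rpow_zero, mul_one]
    rw [abs_sub_comm, show y - (2 * c - x) = x - (2 * c - y) by ring]
  have k2 : kernel γ 0 (2 * c - x) (2 * c - y) = kernel γ 0 x y := by
    unfold kernel; simp only [Real.rpow_zero, mul_one]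
    rw [abs_sub_comm, show 2 * c - y - (2 * c - x) = x - y by ring]
  have n1 := kernel_nonneg γ 0 x y
  have n2 := kernel_nonneg γ 0 x (2 * c - y)
  simp only [hF]
  rw [k1, k2, ← ENNReal.ofReal_add (by positivity) (by positivity),
    ← ENNReal.ofReal_add (by positivity) (by positivity),
    ← ENNReal.ofReal_add (by positivity) (by positivity)]

theorem normSq_twoPoint_le {γ : ℝ} (h0 : 0 < γ) (c : ℝ) {v : ℝ → ℝ} (hv : AEMeasurable v) :
    normSq γ 0 (twoPoint c v) ≤ normSq γ 0 v := by
  rw [normSq_congr γ 0 (twoPoint_congr c hv.ae_eq_mk), normSq_congr γ 0 hv.ae_eq_mk]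
  have hm := hv.measurable_mk
  set v := hv.mk v
  rw [normSq_fold γ c hm, normSq_fold γ c (measurable_twoPoint c hm)]
  refine setLIntegral_mono' measurableSet_Iio fun x hx => ?_
  refine lintegral_mono_ae ?_
  filter_upwards [self_mem_ae_restrict measurableSet_Iio, ae_restrict_of_ae (ae_ne x)] with y hy hyx
  rw [Set.mem_Iio] at hx hy
  refine ENNReal.ofReal_le_ofReal ?_
  have hx' : ¬ 2 * c - x < c := by linarith
  have hy' : ¬ 2 * c - y < c := by linarith
  have ex : 2 * c - (2 * c - x) = x := by ring
  have ey : 2 * c - (2 * c - y) = y := by ring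
  simp only [twoPoint, if_pos hx, if_pos hy, if_neg hx', if_neg hy', ex, ey]
  rw [min_comm (v (2 * c - x)), min_comm (v (2 * c - y))]
  exact four_point (kernel_zero_reflect_le h0 hx hy (Ne.symm hyx))

theorem abs_lt_abs_reflect {c x : ℝ} (hc : 0 < c) (hx : x < c) : |x| < |2 * c - x| := by
  rw [abs_of_pos (by linarith : 0 < 2 * c - x)]
  exact abs_lt.2 ⟨by linarith, by linarith⟩

theorem weighted_pair {A B ω ω' : ℝ} (h : ω' ≤ ω) :
    A * ω + B * ω' ≤ max A B * ω + min A B * ω' := by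
  rcases le_total A B with h1 | h1
  · rw [max_eq_right h1, min_eq_left h1]; nlinarith
  · rw [max_eq_left h1, min_eq_right h1]

theorem lintegral_pow_fold {p r c : ℝ} {v : ℝ → ℝ} (hv : Measurable v) (hv0 : ∀ x, 0 ≤ v x) :
    ∫⁻ x, ENNReal.ofReal (v x ^ p * |x| ^ (-r)) = ∫⁻ x in Set.Iio c, ENNReal.ofReal
      (v x ^ p * |x| ^ (-r) + v (2 * c - x) ^ p * |2 * c - x| ^ (-r)) := by
  rw [lintegral_fold c (by fun_prop)]
  refine lintegral_congr fun x => ?_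
  have := hv0 x
  have := hv0 (2 * c - x)
  rw [ENNReal.ofReal_add (by positivity) (by positivity)]

theorem twoPoint_nonneg {c : ℝ} {v : ℝ → ℝ} (hv0 : ∀ x, 0 ≤ v x) (x : ℝ) : 0 ≤ twoPoint c v x := by
  unfold twoPoint
  split_ifs
  · exact le_max_of_le_left (hv0 _)
  · exact le_min (hv0 _) (hv0 _)

theorem max_rpow {a b p : ℝ} (ha : 0 ≤ a) (hb : 0 ≤ b) (hp : 0 ≤ p) :
    (max a b) ^ p = max (a ^ p) (b ^ p) := by
  rcases le_total a b with h | h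
  · rw [max_eq_right h, max_eq_right (Real.rpow_le_rpow ha h hp)]
  · rw [max_eq_left h, max_eq_left (Real.rpow_le_rpow hb h hp)]

theorem min_rpow {a b p : ℝ} (ha : 0 ≤ a) (hb : 0 ≤ b) (hp : 0 ≤ p) :
    (min a b) ^ p = min (a ^ p) (b ^ p) := by
  rcases le_total a b with h | h
  · rw [min_eq_left h, min_eq_left (Real.rpow_le_rpow ha h hp)]
  · rw [min_eq_right h, min_eq_right (Real.rpow_le_rpow hb h hp)]

theorem twoPoint_left {c x : ℝ} {v : ℝ → ℝ} (hx : x < c) :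
    twoPoint c v x = max (v x) (v (2 * c - x)) := if_pos hx

theorem twoPoint_right {c x : ℝ} {v : ℝ → ℝ} (hx : x < c) :
    twoPoint c v (2 * c - x) = min (v x) (v (2 * c - x)) := by
  rw [twoPoint, if_neg (by linarith), min_comm, sub_sub_cancel]

theorem fold_density_le {p r c : ℝ} (hp : 0 ≤ p) (hr : 0 ≤ r) (hc : 0 < c) {v : ℝ → ℝ}
    (hv0 : ∀ x, 0 ≤ v x) {x : ℝ} (hx : x < c) (hx0 : x ≠ 0) :
    v x ^ p * |x| ^ (-r) + v (2 * c - x) ^ p * |2 * c - x| ^ (-r)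
      ≤ twoPoint c v x ^ p * |x| ^ (-r) + twoPoint c v (2 * c - x) ^ p * |2 * c - x| ^ (-r) := by
  rw [twoPoint_left hx, twoPoint_right hx, max_rpow (hv0 _) (hv0 _) hp,
    min_rpow (hv0 _) (hv0 _) hp]
  exact weighted_pair (Real.rpow_le_rpow_of_nonpos (abs_pos.2 hx0) (abs_lt_abs_reflect hc hx).le
    (by linarith))

/-- Polarization moves mass towards the origin, which lies to the left of `c`. -/
theorem lintegral_pow_le_twoPoint {p r c : ℝ} (hp : 0 ≤ p) (hr : 0 ≤ r) (hc : 0 < c) {v : ℝ → ℝ}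
    (hv : Measurable v) (hv0 : ∀ x, 0 ≤ v x) :
    ∫⁻ x, ENNReal.ofReal (v x ^ p * |x| ^ (-r))
      ≤ ∫⁻ x, ENNReal.ofReal (twoPoint c v x ^ p * |x| ^ (-r)) := by
  rw [lintegral_pow_fold (c := c) hv hv0,
    lintegral_pow_fold (c := c) (measurable_twoPoint c hv) (twoPoint_nonneg hv0)]
  refine lintegral_mono_ae ?_
  filter_upwards [self_mem_ae_restrict measurableSet_Iio, ae_restrict_of_ae (ae_ne 0)] with x hx hx0
  exact ENNReal.ofReal_le_ofReal (fold_density_le hp hr hc hv0 hx hx0)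

/-- Polarization strictly increases a singularly weighted `L^p` norm, unless nothing is moved. -/
theorem ae_reflect_le_of_lintegral_le {p r c : ℝ} (hp : 0 < p) (hr : 0 < r) (hc : 0 < c)
    {v : ℝ → ℝ} (hv : Measurable v) (hv0 : ∀ x, 0 ≤ v x)
    (hfin : ∫⁻ x, ENNReal.ofReal (v x ^ p * |x| ^ (-r)) ≠ ∞)
    (hle : ∫⁻ x, ENNReal.ofReal (twoPoint c v x ^ p * |x| ^ (-r))
      ≤ ∫⁻ x, ENNReal.ofReal (v x ^ p * |x| ^ (-r))) :
    ∀ᵐ x, x < c → v (2 * c - x) ≤ v x := by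
  have hvr : Measurable (fun x => v (2 * c - x)) := hv.comp (by fun_prop)
  have htm := measurable_twoPoint c hv
  have htr : Measurable (fun x => twoPoint c v (2 * c - x)) := htm.comp (by fun_prop)
  rw [lintegral_pow_fold (c := c) hv hv0] at hfin hle
  rw [lintegral_pow_fold (c := c) htm (twoPoint_nonneg hv0)] at hle
  have := ae_eq_of_ae_le_of_lintegral_le ?_ hfin (Measurable.aemeasurable (by fun_prop)) hle
  · rw [EventuallyEq, ae_restrict_iff' measurableSet_Iio] at this
    filter_upwards [this, ae_ne 0] with x hx hx0 hxc
    by_contra! hlt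
    have hx1 := hx hxc
    have t0 := twoPoint_nonneg hv0 (c := c) x
    have t1 := twoPoint_nonneg hv0 (c := c) (2 * c - x)
    have v0 := hv0 x
    have v1 := hv0 (2 * c - x)
    rw [ENNReal.ofReal_eq_ofReal_iff (by positivity) (by positivity), twoPoint_left hxc,
      twoPoint_right hxc, max_eq_right hlt.le, min_eq_left hlt.le] at hx1
    have h1 : v x ^ p < v (2 * c - x) ^ p := Real.rpow_lt_rpow v0 hlt hp
    have h2 : |2 * c - x| ^ (-r) < |x| ^ (-r) :=
      Real.rpow_lt_rpow_of_neg (abs_pos.2 hx0) (abs_lt_abs_reflect hc hxc) (by linarith)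
    nlinarith
  · filter_upwards [self_mem_ae_restrict measurableSet_Iio, ae_restrict_of_ae (ae_ne 0)]
      with x hx hx0
    exact ENNReal.ofReal_le_ofReal (fold_density_le hp.le hr.le hc hv0 hx hx0)

theorem rpow_mul_polarize {α c : ℝ} {u : ℝ → ℝ} {x : ℝ} (hx : x ≠ 0) :
    |x| ^ (-α) * polarize α c u x = twoPoint c (fun y => |y| ^ (-α) * u y) x := by
  rw [polarize, ← mul_assoc, ← Real.rpow_add (abs_pos.2 hx), neg_add_cancel, Real.rpow_zero,
    one_mul]

theorem measurable_polarize (α c : ℝ) {u : ℝ → ℝ} (hu : Measurable u) :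
    Measurable (polarize α c u) := by
  have h : Measurable (twoPoint c (fun y => |y| ^ (-α) * u y)) :=
    measurable_twoPoint c (by fun_prop)
  unfold polarize
  fun_prop

theorem polarize_nonneg {α c : ℝ} {u : ℝ → ℝ} (hu : ∀ x, 0 ≤ u x) (x : ℝ) :
    0 ≤ polarize α c u x := by
  refine mul_nonneg (by positivity) (twoPoint_nonneg (fun y => ?_) x)
  have := hu y; positivity

theorem polarize_le {α c M : ℝ} (hα : 0 < α) (hc : 0 < c) {u : ℝ → ℝ} (hu : ∀ x, 0 ≤ u x)
    (hM : ∀ x, u x ≤ M) (x : ℝ) : polarize α c u x ≤ M := by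
  have hM0 : 0 ≤ M := (hu 0).trans (hM 0)
  rcases eq_or_ne x 0 with rfl | hx
  · rw [polarize, abs_zero, Real.zero_rpow hα.ne', zero_mul]; exact hM0
  have hx0 := abs_pos.2 hx
  have h1 : |x| ^ α * (|x| ^ (-α) * u x) ≤ M := by
    rw [← mul_assoc, ← Real.rpow_add hx0, add_neg_cancel, Real.rpow_zero, one_mul]; exact hM x
  unfold polarize
  rcases lt_or_ge x c with h | h
  · rw [twoPoint_left h, mul_max_of_nonneg _ _ (by positivity)]
    refine max_le h1 ?_
    have h2 := abs_lt_abs_reflect hc h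
    have h3 : |x| ^ α * |2 * c - x| ^ (-α) ≤ 1 := by
      calc |x| ^ α * |2 * c - x| ^ (-α) ≤ |x| ^ α * |x| ^ (-α) := by
            gcongr ?_ * ?_
            exact Real.rpow_le_rpow_of_nonpos hx0 h2.le (by linarith)
        _ = 1 := by rw [← Real.rpow_add hx0, add_neg_cancel, Real.rpow_zero]
    rw [← mul_assoc]
    calc _ ≤ 1 * M := mul_le_mul h3 (hM _) (hu _) zero_le_one
      _ = M := one_mul M
  · rw [twoPoint, if_neg (not_lt.2 h)]
    refine le_trans ?_ h1
    gcongr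
    exact min_le_left _ _

theorem polarize_eq_zero {α c R : ℝ} (hc : 0 < c) {u : ℝ → ℝ} (hs : ∀ x, R < |x| → u x = 0)
    (x : ℝ) (hx : R + 2 * c < |x|) : polarize α c u x = 0 := by
  have h1 : u x = 0 := hs x (by linarith)
  have h2 : u (2 * c - x) = 0 := hs _ (by
    have := abs_sub_abs_le_abs_sub x (2 * c)
    rw [abs_sub_comm, abs_of_pos (by linarith : 0 < 2 * c)] at this
    linarith)
  simp [polarize, twoPoint, h1, h2]

/-- Polarization does not increase the weighted energy: by the ground state representation the
weighted energy is the unweighted one of `v = |x|^{-α} w` minus a multiple of `∫ v² |x|^{-2γ}`. -/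
theorem normSq_polarize_le {γ α c : ℝ} (h0 : 0 < γ) (h1 : γ < 1 / 2) (hα : 0 < α)
    (hα1 : α < (1 - 2 * γ) / 2) (hc : 0 < c) {w : ℝ → ℝ} {M R : ℝ} (hw : Measurable w)
    (hw0 : ∀ x, 0 ≤ w x) (hM : ∀ x, w x ≤ M) (hs : ∀ x, R < |x| → w x = 0) :
    normSq γ α (polarize α c w) ≤ normSq γ α w := by
  have hPm := measurable_polarize α c hw
  have hr : -1 < -(2 * γ + 2 * α) := by linarith
  have iw := integrable_sq_mul_rpow hw.aemeasurable
    (fun x => by rw [abs_of_nonneg (hw0 x)]; exact hM x) hs hr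
  have iP := integrable_sq_mul_rpow hPm.aemeasurable
    (fun x => by rw [abs_of_nonneg (polarize_nonneg hw0 x)]; exact polarize_le hα hc hw0 hM x)
    (polarize_eq_zero (α := α) hc hs) hr
  have gw := normSq_add_hardy h0 h1 hα.le hα1 hw.aemeasurable iw
  have gP := normSq_add_hardy h0 h1 hα.le hα1 hPm.aemeasurable iP
  set v : ℝ → ℝ := fun y => |y| ^ (-α) * w y with hv
  have hvm : Measurable v := by simp only [hv]; fun_prop
  have hv0 : ∀ x, 0 ≤ v x := fun x => by have := hw0 x; simp only [hv]; positivity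
  have eP : normSq γ 0 (fun x => |x| ^ (-α) * polarize α c w x) = normSq γ 0 (twoPoint c v) := by
    refine normSq_congr γ 0 ?_
    filter_upwards [ae_ne 0] with x hx using rpow_mul_polarize hx
  have hardy : ∫ x, w x ^ 2 * |x| ^ (-(2 * γ + 2 * α))
      ≤ ∫ x, polarize α c w x ^ 2 * |x| ^ (-(2 * γ + 2 * α)) := by
    rw [← ENNReal.ofReal_le_ofReal_iff (integral_nonneg fun x => by positivity),
      ofReal_integral_eq_lintegral_ofReal iw (ae_of_all _ fun x => by positivity),
      ofReal_integral_eq_lintegral_ofReal iP (ae_of_all _ fun x => by positivity)]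
    have hrw : ∀ f : ℝ → ℝ, ∫⁻ x, ENNReal.ofReal (f x ^ 2 * |x| ^ (-(2 * γ + 2 * α)))
        = ∫⁻ x, ENNReal.ofReal ((|x| ^ (-α) * f x) ^ (2 : ℝ) * |x| ^ (-(2 * γ))) := fun f => by
      refine lintegral_congr_ae ?_
      filter_upwards [ae_ne 0] with x hx
      have hx0 := abs_pos.2 hx
      congr 1
      have : |x| ^ (-(2 * γ + 2 * α)) = |x| ^ (-α) * |x| ^ (-α) * |x| ^ (-(2 * γ)) := by
        rw [← Real.rpow_add hx0, ← Real.rpow_add hx0]; ring_nf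
      rw [this, Real.rpow_two]; ring
    rw [hrw, hrw]
    refine (lintegral_pow_le_twoPoint (by norm_num : (0 : ℝ) ≤ 2) (by linarith : 0 ≤ 2 * γ) hc
      hvm hv0).trans (le_of_eq ?_)
    refine lintegral_congr_ae ?_
    filter_upwards [ae_ne 0] with x hx
    rw [rpow_mul_polarize hx]
  have hH := hardyConst_nonneg h0 h1 hα.le hα1
  have key : normSq γ α (polarize α c w)
      + ENNReal.ofReal (hardyConst γ α * ∫ x, polarize α c w x ^ 2 * |x| ^ (-(2 * γ + 2 * α)))
      ≤ normSq γ α w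
      + ENNReal.ofReal (hardyConst γ α * ∫ x, polarize α c w x ^ 2 * |x| ^ (-(2 * γ + 2 * α))) := by
    calc _ = normSq γ 0 (twoPoint c v) := by rw [gP, eP]
      _ ≤ normSq γ 0 v := normSq_twoPoint_le h0 c hvm.aemeasurable
      _ = _ := gw.symm
      _ ≤ _ := by gcongr
  exact (ENNReal.add_le_add_iff_right ENNReal.ofReal_ne_top).1 key

/-! ### The energy form and the weak formulation -/

/-- The bilinear form `∬ (u(x) - u(y)) (φ(x) - φ(y)) G_{γ,α}(x,y) dy dx`. -/
def energyForm (γ α : ℝ) (u φ : ℝ → ℝ) : ℝ :=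
  ∫ z : ℝ × ℝ, (u z.1 - u z.2) * (φ z.1 - φ z.2) * kernel γ α z.1 z.2

theorem MemD.aemeasurable {γ α : ℝ} {u : ℝ → ℝ} (h : MemD γ α u) : AEMeasurable u :=
  EnergyLimit.aemeasurable (memD_iff_energyLimit.1 h) fun _ hw => hw.aemeasurable

theorem normSq_lt_top_of_energyLimit {γ α : ℝ} {A : Set (ℝ → ℝ)} {u : ℝ → ℝ}
    (h : EnergyLimit γ α A u) (hA : ∀ w ∈ A, AEMeasurable w)
    (hAf : ∀ w ∈ A, normSq γ α w < ∞) : normSq γ α u < ∞ := by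
  obtain ⟨φ, h1, h2, -⟩ := h.exists_close hA one_pos
  refine lt_of_le_of_lt (normSq_le_add_sub γ α (h.aemeasurable hA) (hA _ h1)) ?_
  exact ENNReal.add_lt_top.2 ⟨ENNReal.mul_lt_top (by simp) (lt_of_le_of_lt h2 (by simp)),
    ENNReal.mul_lt_top (by simp) (hAf _ h1)⟩

theorem integrable_sq_diff {γ α : ℝ} {u : ℝ → ℝ} (hu : AEMeasurable u)
    (hf : normSq γ α u < ∞) :
    Integrable (fun z : ℝ × ℝ => (u z.1 - u z.2) ^ 2 * kernel γ α z.1 z.2) := by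
  rw [normSq_eq_lintegral_prod γ α hu] at hf
  refine ⟨(((aemeasurable_diff hu).pow_const 2).mul
    (measurable_kernel γ α).aemeasurable).aestronglyMeasurable, ?_⟩
  rw [hasFiniteIntegral_iff_ofReal (ae_of_all _ fun z =>
    mul_nonneg (sq_nonneg _) (kernel_nonneg ..))]
  exact hf

theorem integrable_energyForm {γ α : ℝ} {u φ : ℝ → ℝ} (hu : AEMeasurable u) (hφ : AEMeasurable φ)
    (huf : normSq γ α u < ∞) (hφf : normSq γ α φ < ∞) :
    Integrable (fun z : ℝ × ℝ => (u z.1 - u z.2) * (φ z.1 - φ z.2) * kernel γ α z.1 z.2) := by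
  refine ((integrable_sq_diff hu huf).add (integrable_sq_diff hφ hφf)).mono'
    (((aemeasurable_diff hu).mul (aemeasurable_diff hφ)).mul
    (measurable_kernel γ α).aemeasurable).aestronglyMeasurable (ae_of_all _ fun z => ?_)
  have hk := kernel_nonneg γ α z.1 z.2
  simp only [Pi.add_apply]
  rw [Real.norm_eq_abs, abs_mul, abs_of_nonneg hk, ← add_mul]
  refine mul_le_mul_of_nonneg_right ?_ hk
  rw [abs_le]
  constructor <;> nlinarith [sq_nonneg ((u z.1 - u z.2) + (φ z.1 - φ z.2)),
    sq_nonneg ((u z.1 - u z.2) - (φ z.1 - φ z.2))]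

theorem energyForm_self {γ α : ℝ} {u : ℝ → ℝ} (hu : AEMeasurable u) :
    energyForm γ α u u = (normSq γ α u).toReal := by
  rw [normSq_eq_lintegral_prod γ α hu, energyForm, integral_eq_lintegral_of_nonneg_ae]
  · simp_rw [sq]
  · exact ae_of_all _ fun z => mul_nonneg (mul_self_nonneg _) (kernel_nonneg ..)
  · exact (((aemeasurable_diff hu).mul (aemeasurable_diff hu)).mul
      (measurable_kernel γ α).aemeasurable).aestronglyMeasurable

theorem energyForm_add {γ α : ℝ} {u φ ψ : ℝ → ℝ} (hu : AEMeasurable u) (hφ : AEMeasurable φ)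
    (hψ : AEMeasurable ψ) (huf : normSq γ α u < ∞) (hφf : normSq γ α φ < ∞)
    (hψf : normSq γ α ψ < ∞) :
    energyForm γ α u (fun x => φ x + ψ x) = energyForm γ α u φ + energyForm γ α u ψ := by
  unfold energyForm
  rw [← integral_add (integrable_energyForm hu hφ huf hφf) (integrable_energyForm hu hψ huf hψf)]
  congr 1; ext z; ring

theorem energyForm_sub {γ α : ℝ} {u φ ψ : ℝ → ℝ} (hu : AEMeasurable u) (hφ : AEMeasurable φ)
    (hψ : AEMeasurable ψ) (huf : normSq γ α u < ∞) (hφf : normSq γ α φ < ∞)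
    (hψf : normSq γ α ψ < ∞) :
    energyForm γ α u (fun x => φ x - ψ x) = energyForm γ α u φ - energyForm γ α u ψ := by
  unfold energyForm
  rw [← integral_sub (integrable_energyForm hu hφ huf hφf) (integrable_energyForm hu hψ huf hψf)]
  congr 1; ext z; ring

/-- The Cauchy–Schwarz inequality for the energy form. -/
theorem sq_energyForm_le {γ α : ℝ} {u φ : ℝ → ℝ} (hu : AEMeasurable u) (hφ : AEMeasurable φ)
    (huf : normSq γ α u < ∞) (hφf : normSq γ α φ < ∞) :
    energyForm γ α u φ ^ 2 ≤ (normSq γ α u).toReal * (normSq γ α φ).toReal := by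
  have hq : ∀ t : ℝ, 0 ≤ (normSq γ α φ).toReal * (t * t) + (2 * energyForm γ α u φ) * t
      + (normSq γ α u).toReal := by
    intro t
    have i1 := integrable_sq_diff hu huf
    have i2 := integrable_energyForm hu hφ huf hφf
    have i3 := integrable_sq_diff hφ hφf
    have e : ∫ z : ℝ × ℝ, ((u z.1 - u z.2) + t * (φ z.1 - φ z.2)) ^ 2 * kernel γ α z.1 z.2
        = (normSq γ α φ).toReal * (t * t) + (2 * energyForm γ α u φ) * t
          + (normSq γ α u).toReal := by
      have i32 : Integrable (fun z : ℝ × ℝ => (φ z.1 - φ z.2) ^ 2 * kernel γ α z.1 z.2 * (t * t)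
          + 2 * ((u z.1 - u z.2) * (φ z.1 - φ z.2) * kernel γ α z.1 z.2) * t) :=
        (i3.mul_const (t * t)).add ((i2.const_mul 2).mul_const t)
      have hself : ∀ {w : ℝ → ℝ}, AEMeasurable w → (normSq γ α w).toReal
          = ∫ z : ℝ × ℝ, (w z.1 - w z.2) ^ 2 * kernel γ α z.1 z.2 := fun hw => by
        rw [← energyForm_self hw, energyForm]; simp_rw [sq]
      rw [hself hu, hself hφ, energyForm, ← integral_mul_const, ← integral_const_mul,
        ← integral_mul_const, ← integral_add (i3.mul_const (t * t))
          ((i2.const_mul 2).mul_const t), ← integral_add i32 i1]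
      congr 1; ext z; ring
    rw [← e]
    exact integral_nonneg fun z => mul_nonneg (sq_nonneg _) (kernel_nonneg ..)
  have := discrim_le_zero hq
  rw [discrim] at this
  nlinarith

theorem tendsto_energyForm {γ α : ℝ} {u w : ℝ → ℝ} {φ : ℕ → ℝ → ℝ} (hu : AEMeasurable u)
    (hw : AEMeasurable w) (hφ : ∀ n, AEMeasurable (φ n)) (huf : normSq γ α u < ∞)
    (hwf : normSq γ α w < ∞) (hφf : ∀ n, normSq γ α (φ n) < ∞)
    (h : Tendsto (fun n => normSq γ α (fun x => w x - φ n x)) atTop (𝓝 0)) :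
    Tendsto (fun n => energyForm γ α u (φ n)) atTop (𝓝 (energyForm γ α u w)) := by
  have hdf : ∀ n, normSq γ α (fun x => w x - φ n x) < ∞ := fun n =>
    lt_of_le_of_lt (normSq_sub_le γ α hw (hφ n)) (ENNReal.add_lt_top.2
      ⟨ENNReal.mul_lt_top (by simp) hwf, ENNReal.mul_lt_top (by simp) (hφf n)⟩)
  have h1 : Tendsto (fun n => (normSq γ α u).toReal
      * (normSq γ α (fun x => w x - φ n x)).toReal) atTop (𝓝 0) := by
    have := (ENNReal.tendsto_toReal (by simp)).comp h
    simpa using this.const_mul (normSq γ α u).toReal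
  have h2 : Tendsto (fun n => (energyForm γ α u w - energyForm γ α u (φ n)) ^ 2) atTop (𝓝 0) := by
    refine squeeze_zero (fun n => sq_nonneg _) (fun n => ?_) h1
    rw [← energyForm_sub hu hw (hφ n) huf hwf (hφf n)]
    exact sq_energyForm_le hu (hw.sub (hφ n)) huf (hdf n)
  have h3 : Tendsto (fun n => energyForm γ α u w - energyForm γ α u (φ n)) atTop (𝓝 0) := by
    rw [tendsto_zero_iff_abs_tendsto_zero]
    have := h2.sqrt
    simpa [Real.sqrt_sq_eq_abs, Function.comp_def] using this
  have := (tendsto_const_nhds (x := energyForm γ α u w)).sub h3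
  simpa using this

/-- The weak formulation extends from test functions to their bounded energy limits. -/
theorem weak_formulation_extend {γ α : ℝ} (h0 : 0 < γ) (h1 : γ < 1 / 2) (hα : 0 ≤ α)
    (hα1 : α < 1) {u F w : ℝ → ℝ} {M R : ℝ} (hu : AEMeasurable u) (huf : normSq γ α u < ∞)
    (hweak : ∀ φ, IsTestFunction φ → 1 / 2 * energyForm γ α u φ = ∫ x, F x * φ x)
    (hF : ∀ r : ℝ, IntegrableOn F (Set.Icc (-r) r))
    (hw : EnergyLimit γ α (boundedTest M R) w) :
    Integrable (fun x => F x * w x) ∧ 1 / 2 * energyForm γ α u w = ∫ x, F x * w x := by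
  have hAm : ∀ φ ∈ boundedTest M R, AEMeasurable φ := fun φ hφ => hφ.1.aemeasurable
  have hAf : ∀ φ ∈ boundedTest M R, normSq γ α φ < ∞ := fun φ hφ =>
    normSq_lt_top_of_isTestFunction h0 h1 hα hα1 hφ.1
  have hwm := hw.aemeasurable hAm
  have hwf := normSq_lt_top_of_energyLimit hw hAm hAf
  obtain ⟨φ, hφA, hφN, hφl⟩ := hw
  have hFl : LocallyIntegrable F := by
    rw [locallyIntegrable_iff]
    intro k hk
    obtain ⟨r, hr⟩ := hk.isBounded.subset_closedBall 0
    rw [Real.closedBall_eq_Icc, zero_sub, zero_add] at hr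
    exact (hF r).mono_set hr
  have hFm : AEStronglyMeasurable F := hFl.aestronglyMeasurable
  have hdom : Integrable (fun x => M * (Set.Icc (-R) R).indicator (fun x => |F x|) x) :=
    (IntegrableOn.integrable_indicator (hF R).abs measurableSet_Icc).const_mul M
  have hbound : ∀ n x, ‖F x * φ n x‖ ≤ M * (Set.Icc (-R) R).indicator (fun x => |F x|) x := by
    intro n x
    rw [Real.norm_eq_abs, abs_mul]
    rcases le_or_gt |x| R with h | h
    · rw [Set.indicator_of_mem (Set.mem_Icc.2 (abs_le.1 h)), mul_comm]
      gcongr; exact (hφA n).2.1 x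
    · rw [(hφA n).2.2 x h, Set.indicator_of_notMem
        (fun h' => absurd (abs_le.2 (Set.mem_Icc.1 h')) (not_le.2 h))]
      simp
  have hlim : ∀ᵐ x, Tendsto (fun n => F x * φ n x) atTop (𝓝 (F x * w x)) := by
    filter_upwards [hφl] with x hx using hx.const_mul _
  constructor
  · refine hdom.mono' (hFm.mul hwm.aestronglyMeasurable) ?_
    filter_upwards [hlim] with x hx
    exact le_of_tendsto hx.norm (Eventually.of_forall fun n => hbound n x)
  · have t1 := (tendsto_energyForm hu hwm (fun n => hAm _ (hφA n)) huf hwf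
      (fun n => hAf _ (hφA n)) hφN).const_mul (1 / 2)
    have t2 := tendsto_integral_of_dominated_convergence _
      (fun n => hFm.mul (hAm _ (hφA n)).aestronglyMeasurable) hdom
      (fun n => ae_of_all _ (hbound n)) hlim
    refine tendsto_nhds_unique (t1.congr fun n => ?_) t2
    exact hweak _ (hφA n).1

/-! ### Integrability of the right-hand side -/

theorem ae_const_of_normSq_eq_zero {γ α : ℝ} {u : ℝ → ℝ} (hu : AEMeasurable u)
    (h : normSq γ α u = 0) : ∃ c, ∀ᵐ x, u x = c := by
  rw [normSq_eq_lintegral_prod γ α hu,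
    lintegral_eq_zero_iff' (aemeasurable_energy_density γ α hu), Measure.volume_eq_prod] at h
  have h1 := Measure.ae_ae_of_ae_prod h
  obtain ⟨x, hx, hx0⟩ := (h1.and (ae_ne 0)).exists
  refine ⟨u x, ?_⟩
  filter_upwards [hx, ae_ne 0, ae_ne x] with y hy hy0 hyx
  have hk := kernel_pos (γ := γ) (α := α) hx0 hy0 (Ne.symm hyx)
  simp only [Pi.zero_apply, ENNReal.ofReal_eq_zero] at hy
  have : (u x - u y) ^ 2 ≤ 0 := by
    by_contra! hlt
    exact absurd hy (not_le.2 (mul_pos hlt hk))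
  have := pow_eq_zero_iff (two_ne_zero) |>.1 (le_antisymm this (sq_nonneg _))
  linarith

theorem isTestFunction_bump (r : ℝ) : ∃ θ : ℝ → ℝ, IsTestFunction θ ∧ (∀ x, 0 ≤ θ x) ∧
    (∀ x, |x| ≤ r → θ x = 1) := by
  let θ : ContDiffBump (0 : ℝ) := ⟨max r 1, max r 1 + 1, by positivity, by linarith⟩
  refine ⟨θ, ⟨θ.contDiff, θ.hasCompactSupport⟩, fun x => θ.nonneg, fun x hx => ?_⟩
  refine θ.one_of_mem_closedBall ?_
  rw [mem_closedBall_zero_iff, Real.norm_eq_abs]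
  exact hx.trans (le_max_left _ _)

/-- The right-hand side of the equation for normalized minimizers. -/
def source (γ α β : ℝ) (u : ℝ → ℝ) (x : ℝ) : ℝ :=
  1 / exponent γ α β * (1 / |x| ^ (β * exponent γ α β)) * u x ^ (exponent γ α β - 1)

theorem aemeasurable_source (γ α β : ℝ) {u : ℝ → ℝ} (hu : AEMeasurable u) :
    AEMeasurable (source γ α β u) := by
  refine AEMeasurable.mul (Measurable.aemeasurable (by fun_prop)) ?_
  exact hu.pow_const _

theorem exponent_pos {γ α β : ℝ} (h1 : γ < 1 / 2) (hαβ : α < β) : 0 < exponent γ α β :=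
  div_pos two_pos (by linarith)

theorem mul_exponent_lt_one {γ α β : ℝ} (h1 : γ < 1 / 2) (hα1 : α < (1 - 2 * γ) / 2)
    (hαβ : α < β) : β * exponent γ α β < 1 := by
  rw [exponent, ← mul_div_assoc, div_lt_one (by linarith)]
  linarith

/-- A constant `u > 0` does not solve the equation, whose right-hand side would then be positive. -/
theorem normSq_ne_zero {γ α β : ℝ} (h0 : 0 < γ) (h1 : γ < 1 / 2) (hα : 0 < α)
    (hα1 : α < (1 - 2 * γ) / 2) (hαβ : α < β) {u : ℝ → ℝ} (hpos : ∀ᵐ x, 0 < u x)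
    (hsol : IsWeakSolution γ α u (source γ α β u)) : normSq γ α u ≠ 0 := by
  intro hN
  have hum := hsol.1.aemeasurable
  obtain ⟨c, hc⟩ := ae_const_of_normSq_eq_zero hum hN
  obtain ⟨x, hx1, hx2⟩ := (hc.and hpos).exists
  have hc0 : 0 < c := by rwa [hx1] at hx2
  obtain ⟨θ, hθ, hθ0, hθ1⟩ := isTestFunction_bump 1
  obtain ⟨R, hR, hs⟩ := hθ.exists_supp
  obtain ⟨M, hM⟩ := hθ.exists_bound
  have hM0 : 0 ≤ M := (abs_nonneg _).trans (hM 0)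
  have hθf := normSq_lt_top_of_isTestFunction h0 h1 hα.le (by linarith) hθ
  have hE : energyForm γ α u θ = 0 := by
    have := sq_energyForm_le hum hθ.aemeasurable (by rw [hN]; simp) hθf
    rw [hN, ENNReal.toReal_zero, zero_mul] at this
    exact pow_eq_zero_iff two_ne_zero |>.1 (le_antisymm this (sq_nonneg _))
  have hw := hsol.2 θ hθ
  have hw' : (1 / 2) * energyForm γ α u θ = ∫ x, source γ α β u x * θ x := hw
  rw [hE, mul_zero] at hw'
  have hp := exponent_pos h1 hαβ
  have hq := mul_exponent_lt_one h1 hα1 hαβ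
  set p := exponent γ α β with hpdef
  have hcongr : ∀ᵐ x, source γ α β u x * θ x
      = 1 / p * c ^ (p - 1) * (|x| ^ (-(β * p)) * θ x) := by
    filter_upwards [hc] with x hx
    rw [source, hx, ← hpdef, one_div (|x| ^ _), ← Real.rpow_neg (abs_nonneg _)]; ring
  have hi : Integrable (fun x => |x| ^ (-(β * p)) * θ x) := by
    refine (((integrableOn_abs_rpow_Icc (r := -(β * p)) (by linarith) R).integrable_indicator
      measurableSet_Icc).const_mul M).mono' ?_ (ae_of_all _ fun x => ?_)
    · exact (Measurable.aestronglyMeasurable (by fun_prop)).mul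
        hθ.1.continuous.aestronglyMeasurable
    · rw [Real.norm_eq_abs, abs_mul, abs_of_nonneg (by positivity : 0 ≤ |x| ^ (-(β * p))), mul_comm]
      rcases le_or_gt |x| R with h | h
      · rw [Set.indicator_of_mem (Set.mem_Icc.2 (abs_le.1 h))]
        gcongr; exact hM x
      · rw [hs x h]; simp
        exact mul_nonneg hM0 (Set.indicator_nonneg (fun _ _ => by positivity) _)
  rw [integral_congr_ae hcongr, integral_const_mul] at hw'
  have hcp : 0 < 1 / p * c ^ (p - 1) := by positivity
  have hz : ∫ x, |x| ^ (-(β * p)) * θ x = 0 :=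
    (mul_eq_zero.1 hw'.symm).resolve_left hcp.ne'
  rw [integral_eq_zero_iff_of_nonneg (fun x => mul_nonneg (by positivity) (hθ0 x)) hi] at hz
  have hz2 : ∀ᵐ x ∂(volume.restrict (Set.Icc (-1 : ℝ) 1)), False := by
    filter_upwards [ae_restrict_of_ae hz, ae_restrict_of_ae (ae_ne 0),
      ae_restrict_mem measurableSet_Icc] with x hx hx0 hx1
    rw [Pi.zero_apply, hθ1 x (abs_le.2 (Set.mem_Icc.1 hx1)), mul_one] at hx
    exact absurd hx (Real.rpow_pos_of_pos (abs_pos.2 hx0) _).ne'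
  rw [ae_iff] at hz2
  norm_num at hz2

/-- The weak formulation carries no integrability of its right-hand side. If the latter failed for
one test function `φ`, the integral would take its default value `0` for `φ` and for `φ + ψ`
with any `ψ` of integrable right-hand side; hence `u` would be orthogonal to all test functions,
and thus of energy zero. -/
theorem integrable_source_mul {γ α β : ℝ} (h0 : 0 < γ) (h1 : γ < 1 / 2) (hα : 0 < α)
    (hα1 : α < (1 - 2 * γ) / 2) (hαβ : α < β) {u : ℝ → ℝ} (hpos : ∀ᵐ x, 0 < u x)
    (hsol : IsWeakSolution γ α u (source γ α β u)) {φ : ℝ → ℝ} (hφ : IsTestFunction φ) :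
    Integrable (fun x => source γ α β u x * φ x) := by
  by_contra hni
  refine normSq_ne_zero h0 h1 hα hα1 hαβ hpos hsol ?_
  have hum := hsol.1.aemeasurable
  have hα1' : α < 1 := by linarith
  have hAf : ∀ w : ℝ → ℝ, IsTestFunction w → normSq γ α w < ∞ := fun w hw =>
    normSq_lt_top_of_isTestFunction h0 h1 hα.le hα1' hw
  have huf : normSq γ α u < ∞ := normSq_lt_top_of_energyLimit (memD_iff_energyLimit.1 hsol.1)
    (fun w hw => IsTestFunction.aemeasurable hw) hAf
  have hweak : ∀ ψ, IsTestFunction ψ →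
      1 / 2 * energyForm γ α u ψ = ∫ x, source γ α β u x * ψ x := hsol.2
  have hz : ∀ ψ, IsTestFunction ψ → ¬ Integrable (fun x => source γ α β u x * ψ x) →
      energyForm γ α u ψ = 0 := fun ψ hψ hn => by
    have := hweak ψ hψ
    rw [integral_undef hn] at this
    linarith
  have hall : ∀ ψ, IsTestFunction ψ → energyForm γ α u ψ = 0 := fun ψ hψ => by
    by_cases hi : Integrable (fun x => source γ α β u x * ψ x)
    · have hsum : IsTestFunction (fun x => φ x + ψ x) := by
        have := hφ.add_smul hψ 1 1; rwa [one_smul, one_smul] at this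
      have h2 := hz _ hsum fun h => hni (by
        refine (h.sub hi).congr (ae_of_all _ fun x => ?_)
        simp only [Pi.sub_apply]; ring)
      rw [energyForm_add hum hφ.aemeasurable hψ.aemeasurable huf (hAf _ hφ) (hAf _ hψ),
        hz φ hφ hni, zero_add] at h2
      exact h2
    · exact hz ψ hψ hi
  obtain ⟨χ, hχ, hχN, -⟩ := hsol.1
  have := tendsto_energyForm hum hum (fun n => (hχ n).aemeasurable) huf huf
    (fun n => hAf _ (hχ n)) hχN
  simp_rw [hall _ (hχ _)] at this
  have h3 := tendsto_nhds_unique this tendsto_const_nhds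
  rw [energyForm_self hum] at h3
  exact ((ENNReal.toReal_eq_zero_iff _).1 h3).resolve_right huf.ne

theorem integrableOn_source {γ α β : ℝ} (h0 : 0 < γ) (h1 : γ < 1 / 2) (hα : 0 < α)
    (hα1 : α < (1 - 2 * γ) / 2) (hαβ : α < β) {u : ℝ → ℝ} (hpos : ∀ᵐ x, 0 < u x)
    (hsol : IsWeakSolution γ α u (source γ α β u)) (r : ℝ) :
    IntegrableOn (source γ α β u) (Set.Icc (-r) r) := by
  obtain ⟨θ, hθ, -, hθ1⟩ := isTestFunction_bump r
  refine (integrable_source_mul h0 h1 hα hα1 hαβ hpos hsol hθ).integrableOn.congr_fun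
    (fun x hx => ?_) measurableSet_Icc
  simp only [hθ1 x (abs_le.2 (Set.mem_Icc.1 hx)), mul_one]

theorem abs_posPart_diff_le (a b : ℝ) : |max a 0 - max b 0| ≤ |a - b| :=
  abs_max_sub_max_le_abs a b 0

/-- The approximating sequence of a member of `D_{γ,α}` may be taken within energy distance `e`. -/
theorem exists_tests_bounded {γ α : ℝ} {u : ℝ → ℝ} (h : MemD γ α u) {e : ℝ≥0∞} (he : 0 < e) :
    ∃ φ : ℕ → ℝ → ℝ, (∀ n, IsTestFunction (φ n)) ∧
      (∀ n, normSq γ α (fun x => u x - φ n x) ≤ e) ∧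
      ∀ᵐ x, Tendsto (fun n => φ n x) atTop (𝓝 (u x)) := by
  obtain ⟨φ, h1, h2, h3⟩ := h
  obtain ⟨N, hN⟩ := eventually_atTop.1 (h2.eventually_le_const he)
  refine ⟨fun n => φ (n + N), fun n => h1 _, fun n => hN _ (Nat.le_add_left _ _), ?_⟩
  filter_upwards [h3] with x hx using (tendsto_add_atTop_iff_nat N).2 hx

/-- The denominator of the quotient is finite: testing the equation with the positive parts of the
approximating test functions bounds it, by Fatou's lemma. -/
theorem lintegral_pow_ne_top {γ α β : ℝ} (h0 : 0 < γ) (h1 : γ < 1 / 2) (hα : 0 < α)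
    (hα1 : α < (1 - 2 * γ) / 2) (hαβ : α < β) {u : ℝ → ℝ} (hpos : ∀ᵐ x, 0 < u x)
    (hsol : IsWeakSolution γ α u (source γ α β u)) :
    ∫⁻ x, ENNReal.ofReal (|u x| ^ exponent γ α β / |x| ^ (β * exponent γ α β)) ≠ ∞ := by
  have hum := hsol.1.aemeasurable
  have hα1' : α < 1 := by linarith
  have hAf : ∀ w : ℝ → ℝ, IsTestFunction w → normSq γ α w < ∞ := fun w hw =>
    normSq_lt_top_of_isTestFunction h0 h1 hα.le hα1' hw
  have huf : normSq γ α u < ∞ := normSq_lt_top_of_energyLimit (memD_iff_energyLimit.1 hsol.1)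
    (fun w hw => IsTestFunction.aemeasurable hw) hAf
  have hp := exponent_pos h1 hαβ
  obtain ⟨φ, hφ, hφN, hφl⟩ := exists_tests_bounded hsol.1 (e := 1) (by simp)
  set B : ℝ≥0∞ := 2 * 1 + 2 * normSq γ α u with hB
  have hBf : B ≠ ∞ := by
    rw [hB]; exact ENNReal.add_ne_top.2 ⟨by simp, ENNReal.mul_ne_top (by simp) huf.ne⟩
  set w : ℕ → ℝ → ℝ := fun n x => max (φ n x) 0 with hw
  have hwm : ∀ n, AEMeasurable (w n) := fun n => (hφ n).aemeasurable.max aemeasurable_const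
  have hwB : ∀ n, normSq γ α (w n) ≤ B := fun n => by
    refine (normSq_le_of_abs_diff_le fun x y => abs_posPart_diff_le (φ n x) (φ n y)).trans ?_
    have := normSq_le_add_sub γ α (hφ n).aemeasurable hum
    rw [normSq_sub_comm] at this
    exact this.trans (by rw [hB]; gcongr; exact hφN n)
  have hwE : ∀ n, ∫⁻ x, ENNReal.ofReal (source γ α β u x * w n x)
      ≤ ENNReal.ofReal (((normSq γ α u).toReal * B.toReal + 1) / 2) := fun n => by
    obtain ⟨M, hM⟩ := (hφ n).exists_bound
    obtain ⟨R, -, hR⟩ := (hφ n).exists_supp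
    have hM0 : 0 ≤ M := (abs_nonneg _).trans (hM 0)
    have hwL := energyLimit_of_bounded_support h0 h1 hα.le hα1 (hwm n) hM0
      (ae_of_all _ fun x => by
        rw [abs_of_nonneg (le_max_right _ _)]
        exact max_le ((le_abs_self _).trans (hM x)) hM0)
      (ae_of_all _ fun x hx => by simp only [hw]; rw [hR x hx, max_self])
      (lt_of_le_of_lt (hwB n) (lt_top_iff_ne_top.2 hBf))
    obtain ⟨hi, he⟩ := weak_formulation_extend h0 h1 hα.le hα1' hum huf hsol.2
      (integrableOn_source h0 h1 hα hα1 hαβ hpos hsol) hwL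
    have hnn : 0 ≤ᵐ[volume] fun x => source γ α β u x * w n x := by
      filter_upwards [hpos] with x hx
      have : 0 ≤ w n x := le_max_right _ _
      unfold source
      positivity
    rw [← ofReal_integral_eq_lintegral_ofReal hi hnn, ← he]
    refine ENNReal.ofReal_le_ofReal ?_
    have hcs := sq_energyForm_le hum (hwm n) huf (lt_of_le_of_lt (hwB n) (lt_top_iff_ne_top.2 hBf))
    have h3 : (normSq γ α u).toReal * (normSq γ α (w n)).toReal
        ≤ (normSq γ α u).toReal * B.toReal := by
      gcongr
      exact hwB n
    nlinarith [sq_nonneg (energyForm γ α u (w n) - 1)]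
  have hlim : ∀ᵐ x, ENNReal.ofReal (1 / exponent γ α β * (|u x| ^ exponent γ α β
      / |x| ^ (β * exponent γ α β)))
      ≤ liminf (fun n => ENNReal.ofReal (source γ α β u x * w n x)) atTop := by
    filter_upwards [hφl, hpos] with x hx hx0
    have h1 : Tendsto (fun n => w n x) atTop (𝓝 (u x)) := by
      have := hx.max (tendsto_const_nhds (x := (0 : ℝ)))
      rwa [max_eq_left hx0.le] at this
    have h2 := ENNReal.tendsto_ofReal (h1.const_mul (source γ α β u x))
    rw [h2.liminf_eq]
    refine le_of_eq (congrArg _ ?_)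
    rw [source, abs_of_pos hx0, Real.rpow_sub_one hx0.ne']
    field_simp
  have hbd : ∫⁻ x, ENNReal.ofReal (1 / exponent γ α β * (|u x| ^ exponent γ α β
      / |x| ^ (β * exponent γ α β)))
      ≤ ENNReal.ofReal (((normSq γ α u).toReal * B.toReal + 1) / 2) := by
    refine (lintegral_mono_ae hlim).trans ((lintegral_liminf_le' fun n =>
      ((aemeasurable_source γ α β hum).mul (hwm n)).ennreal_ofReal).trans ?_)
    refine (liminf_le_liminf (Eventually.of_forall hwE)).trans ?_
    rw [liminf_const]
  simp_rw [ENNReal.ofReal_mul (by positivity : 0 ≤ 1 / exponent γ α β)] at hbd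
  rw [lintegral_const_mul' _ _ ENNReal.ofReal_ne_top] at hbd
  intro htop
  rw [htop, ENNReal.mul_top (by simpa using hp)] at hbd
  exact absurd hbd (by simp)

/-! ### Consequences of minimality -/

/-- Young's inequality for the energy of `w = u - (u - w)`. -/
theorem normSq_le_young (γ α : ℝ) {u w : ℝ → ℝ} (hu : AEMeasurable u) (hw : AEMeasurable w)
    {t : ℝ} (ht : 0 < t) :
    normSq γ α w ≤ ENNReal.ofReal (1 + t) * normSq γ α u
      + ENNReal.ofReal (1 + 1 / t) * normSq γ α (fun x => u x - w x) := by
  have hd : AEMeasurable (fun x => u x - w x) := hu.sub hw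
  rw [normSq_eq_lintegral_prod γ α hu, normSq_eq_lintegral_prod γ α hw,
    normSq_eq_lintegral_prod γ α hd, ← lintegral_const_mul' _ _ ENNReal.ofReal_ne_top,
    ← lintegral_const_mul' _ _ ENNReal.ofReal_ne_top,
    ← lintegral_add_left' ((aemeasurable_energy_density γ α hu).const_mul _)]
  refine lintegral_mono fun z => ?_
  have hk := kernel_nonneg γ α z.1 z.2
  rw [← ENNReal.ofReal_mul (by positivity), ← ENNReal.ofReal_mul (by positivity),
    ← ENNReal.ofReal_add (by positivity) (by positivity)]
  refine ENNReal.ofReal_le_ofReal ?_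
  rw [← mul_assoc, ← mul_assoc, ← add_mul]
  refine mul_le_mul_of_nonneg_right ?_ hk
  have e : (1 + t) * (u z.1 - u z.2) ^ 2
      + (1 + 1 / t) * (u z.1 - w z.1 - (u z.2 - w z.2)) ^ 2 - (w z.1 - w z.2) ^ 2
      = (t * (u z.1 - u z.2) + (u z.1 - w z.1 - (u z.2 - w z.2))) ^ 2 / t := by
    field_simp; ring
  have : 0 ≤ (t * (u z.1 - u z.2) + (u z.1 - w z.1 - (u z.2 - w z.2))) ^ 2 / t := by positivity
  linarith

/-- The energy does not jump up along a sequence converging in energy. -/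
theorem liminf_normSq_le {γ α : ℝ} {u : ℝ → ℝ} {φ : ℕ → ℝ → ℝ} (hu : AEMeasurable u)
    (hφ : ∀ n, AEMeasurable (φ n)) (huf : normSq γ α u < ∞)
    (h : Tendsto (fun n => normSq γ α (fun x => u x - φ n x)) atTop (𝓝 0)) :
    liminf (fun n => normSq γ α (φ n)) atTop ≤ normSq γ α u := by
  have h1 : ∀ t : ℝ, 0 < t →
      liminf (fun n => normSq γ α (φ n)) atTop ≤ ENNReal.ofReal (1 + t) * normSq γ α u := by
    intro t ht
    refine (liminf_le_liminf (Eventually.of_forall fun n =>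
      normSq_le_young γ α hu (hφ n) ht)).trans (le_of_eq ?_)
    have := (tendsto_const_nhds (x := ENNReal.ofReal (1 + t) * normSq γ α u)).add
      (ENNReal.Tendsto.const_mul (a := ENNReal.ofReal (1 + 1 / t)) h (by simp))
    rw [mul_zero, add_zero] at this
    exact this.liminf_eq
  have h2 : Tendsto (fun n : ℕ => ENNReal.ofReal (1 + 1 / ((n : ℝ) + 1)) * normSq γ α u) atTop
      (𝓝 (ENNReal.ofReal (1 + 0) * normSq γ α u)) :=
    ENNReal.Tendsto.mul_const (ENNReal.tendsto_ofReal
      (tendsto_const_nhds.add tendsto_one_div_add_atTop_nhds_zero_nat)) (Or.inr huf.ne)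
  rw [add_zero, ENNReal.ofReal_one, one_mul] at h2
  exact ge_of_tendsto h2 (Eventually.of_forall fun n => h1 _ (by positivity))

/-- Polarization preserves positive members of `D_{γ,α}` and does not increase their energy.
Positive parts of the approximating test functions are polarized; the results are bounded with
compact support, and closedness under bounded almost everywhere convergence gives membership. -/
theorem memD_polarize {γ α c : ℝ} (h0 : 0 < γ) (h1 : γ < 1 / 2) (hα : 0 < α)
    (hα1 : α < (1 - 2 * γ) / 2) (hc : 0 < c) {u : ℝ → ℝ} (hpos : ∀ᵐ x, 0 < u x)
    (hu : MemD γ α u) :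
    MemD γ α (polarize α c u) ∧ normSq γ α (polarize α c u) ≤ normSq γ α u := by
  have hum := hu.aemeasurable
  have hAm : ∀ w ∈ {φ : ℝ → ℝ | IsTestFunction φ}, AEMeasurable w := fun w hw =>
    IsTestFunction.aemeasurable hw
  have huf : normSq γ α u < ∞ := normSq_lt_top_of_energyLimit (memD_iff_energyLimit.1 hu) hAm
    fun w hw => normSq_lt_top_of_isTestFunction h0 h1 hα.le (by linarith) hw
  obtain ⟨φ, hφ, hφN, hφl⟩ := hu
  obtain ⟨N, hN⟩ := eventually_atTop.1 (hφN.eventually_le_const (show (0 : ℝ≥0∞) < 1 by simp))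
  set χ : ℕ → ℝ → ℝ := fun n => φ (n + N) with hχ
  have hχN : Tendsto (fun n => normSq γ α (fun x => u x - χ n x)) atTop (𝓝 0) :=
    (tendsto_add_atTop_iff_nat N).2 hφN
  have hχl : ∀ᵐ x, Tendsto (fun n => χ n x) atTop (𝓝 (u x)) := by
    filter_upwards [hφl] with x hx using (tendsto_add_atTop_iff_nat N).2 hx
  have hχm : ∀ n, AEMeasurable (χ n) := fun n => (hφ _).aemeasurable
  set w : ℕ → ℝ → ℝ := fun n x => max (χ n x) 0 with hw
  have hwm : ∀ n, Measurable (w n) := fun n =>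
    (hφ (n + N)).1.continuous.measurable.max measurable_const
  have hw0 : ∀ n x, 0 ≤ w n x := fun n x => le_max_right _ _
  have hwχ : ∀ n, normSq γ α (w n) ≤ normSq γ α (χ n) := fun n =>
    normSq_le_of_abs_diff_le fun x y => abs_posPart_diff_le (χ n x) (χ n y)
  set P : ℕ → ℝ → ℝ := fun n => polarize α c (w n) with hP
  have hPm : ∀ n, AEMeasurable (P n) := fun n => (measurable_polarize α c (hwm n)).aemeasurable
  have hPχ : ∀ n, normSq γ α (P n) ≤ normSq γ α (χ n) ∧
      EnergyLimit γ α {φ | IsTestFunction φ} (P n) := fun n => by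
    obtain ⟨M, hM⟩ := (hφ (n + N)).exists_bound
    obtain ⟨R, -, hR⟩ := (hφ (n + N)).exists_supp
    have hM0 : 0 ≤ M := (abs_nonneg _).trans (hM 0)
    have hwM : ∀ x, w n x ≤ M := fun x => max_le ((le_abs_self _).trans (hM x)) hM0
    have hwR : ∀ x, R < |x| → w n x = 0 := fun x hx => by
      simp only [hw, hχ]; rw [hR x hx, max_self]
    have hle := (normSq_polarize_le h0 h1 hα hα1 hc (hwm n) (hw0 n) hwM hwR).trans (hwχ n)
    refine ⟨hle, EnergyLimit.mono (energyLimit_of_bounded_support h0 h1 hα.le hα1 (hPm n) hM0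
      (R := R + 2 * c) (ae_of_all _ fun x => ?_) (ae_of_all _ fun x hx => ?_) ?_)
      (fun f hf => hf.1)⟩
    · simp only [hP]
      rw [abs_of_nonneg (polarize_nonneg (hw0 n) x)]
      exact polarize_le hα hc (hw0 n) hwM x
    · exact polarize_eq_zero hc hwR x hx
    · exact lt_of_le_of_lt hle
        (normSq_lt_top_of_isTestFunction h0 h1 hα.le (by linarith) (hφ _))
  have hPl : ∀ᵐ x, Tendsto (fun n => P n x) atTop (𝓝 (polarize α c u x)) := by
    filter_upwards [hχl, hpos, ae_reflect c hχl, ae_reflect c hpos] with x hx hx0 hy hy0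
    have a1 : Tendsto (fun n => w n x) atTop (𝓝 (u x)) := by
      have := hx.max (tendsto_const_nhds (x := (0 : ℝ)))
      rwa [max_eq_left hx0.le] at this
    have a2 : Tendsto (fun n => w n (2 * c - x)) atTop (𝓝 (u (2 * c - x))) := by
      have := hy.max (tendsto_const_nhds (x := (0 : ℝ)))
      rwa [max_eq_left hy0.le] at this
    simp only [hP, polarize, twoPoint]
    split_ifs
    · exact ((a1.const_mul _).max (a2.const_mul _)).const_mul _
    · exact ((a1.const_mul _).min (a2.const_mul _)).const_mul _
  constructor
  · refine memD_iff_energyLimit.2 (EnergyLimit.of_bounded (B := 2 * 1 + 2 * normSq γ α u)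
      convex_isTestFunction hAm ?_ (fun n => (hPχ n).2) (fun n => ?_) hPl)
    · exact ENNReal.add_ne_top.2 ⟨by simp, ENNReal.mul_ne_top (by simp) huf.ne⟩
    · refine (hPχ n).1.trans ?_
      have := normSq_le_add_sub γ α (hχm n) hum
      rw [normSq_sub_comm] at this
      refine this.trans ?_
      gcongr
      exact hN _ (Nat.le_add_left _ _)
  · refine (normSq_le_liminf γ α hPm hPl).trans
      ((liminf_le_liminf (Eventually.of_forall fun n => (hPχ n).1)).trans ?_)
    exact liminf_normSq_le hum hχm huf hχN

theorem lintegral_pow_eq (α β p : ℝ) {u : ℝ → ℝ} (hu : ∀ᵐ x, 0 ≤ u x) :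
    ∫⁻ x, ENNReal.ofReal (|u x| ^ p / |x| ^ (β * p))
      = ∫⁻ x, ENNReal.ofReal ((|x| ^ (-α) * u x) ^ p * |x| ^ (-((β - α) * p))) := by
  refine lintegral_congr_ae ?_
  filter_upwards [hu, ae_ne 0] with x hx hx0
  have h := abs_pos.2 hx0
  congr 1
  rw [abs_of_nonneg hx, Real.mul_rpow (by positivity) hx, ← Real.rpow_mul h.le, div_eq_mul_inv,
    ← Real.rpow_neg h.le, mul_right_comm, ← Real.rpow_add h, mul_comm]
  ring_nf

theorem polarize_congr (α c : ℝ) {u w : ℝ → ℝ} (h : u =ᵐ[volume] w) :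
    polarize α c u =ᵐ[volume] polarize α c w := by
  have : (fun y => |y| ^ (-α) * u y) =ᵐ[volume] fun y => |y| ^ (-α) * w y := by
    filter_upwards [h] with x hx
    rw [hx]
  filter_upwards [twoPoint_congr c this] with x hx
  rw [polarize, polarize, hx]

/-- For a positive minimizer `u`, the function `|x|^{-α} u` coincides with its polarizations. -/
theorem reflect_le_of_isMinimizer {γ α β c : ℝ} (h0 : 0 < γ) (h1 : γ < 1 / 2) (hα : 0 < α)
    (hα1 : α < (1 - 2 * γ) / 2) (hαβ : α < β) (hc : 0 < c) {u : ℝ → ℝ} (hpos : ∀ᵐ x, 0 < u x)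
    (hmin : IsMinimizer γ α β u) (hN : normSq γ α u ≠ 0)
    (hden : ∫⁻ x, ENNReal.ofReal (|u x| ^ exponent γ α β / |x| ^ (β * exponent γ α β)) ≠ ∞) :
    ∀ᵐ x, x < c → |2 * c - x| ^ (-α) * u (2 * c - x) ≤ |x| ^ (-α) * u x := by
  have hum := hmin.1.aemeasurable
  have hp := exponent_pos h1 hαβ
  obtain ⟨hPD, hPN⟩ := memD_polarize h0 h1 hα hα1 hc hpos hmin.1
  have huf : normSq γ α u < ∞ := normSq_lt_top_of_energyLimit (memD_iff_energyLimit.1 hmin.1)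
    (fun w hw => IsTestFunction.aemeasurable hw)
    fun w hw => normSq_lt_top_of_isTestFunction h0 h1 hα.le (by linarith) hw
  set p := exponent γ α β with hpdef
  have hPpos : ∀ᵐ x, 0 < polarize α c u x := by
    filter_upwards [hpos, ae_reflect c hpos, ae_ne 0, ae_reflect c (ae_ne 0)] with x a1 a2 a3 a4
    have b1 := abs_pos.2 a3
    have b2 := abs_pos.2 a4
    unfold polarize twoPoint
    split_ifs
    · have : 0 < max (|x| ^ (-α) * u x) (|2 * c - x| ^ (-α) * u (2 * c - x)) :=
        lt_max_of_lt_left (by positivity)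
      positivity
    · have : 0 < min (|x| ^ (-α) * u x) (|2 * c - x| ^ (-α) * u (2 * c - x)) :=
        lt_min (by positivity) (by positivity)
      positivity
  have hP0 : ¬ polarize α c u =ᵐ[volume] 0 := fun h => by
    obtain ⟨x, hx1, hx2⟩ := (h.and hPpos).exists
    exact absurd hx1 hx2.ne'
  -- Minimality and the energy inequality leave no room for a larger denominator, while
  -- polarization strictly increases the denominator unless nothing is moved.
  have hle : energy γ α β u ≤ energy γ α β (polarize α c u) := by
    rw [hmin.2.2]
    exact iInf₂_le (polarize α c u) ⟨hPD, hP0⟩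
  set Du := ∫⁻ x, ENNReal.ofReal (|u x| ^ p / |x| ^ (β * p)) with hDu
  set DP := ∫⁻ x, ENNReal.ofReal (|polarize α c u x| ^ p / |x| ^ (β * p)) with hDP
  have hle2 : normSq γ α u / Du ^ (2 / p) ≤ normSq γ α u / DP ^ (2 / p) :=
    hle.trans (ENNReal.div_le_div_right hPN _)
  have hDD : DP ≤ Du := by
    rw [div_eq_mul_inv (normSq γ α u), div_eq_mul_inv (normSq γ α u),
      ENNReal.mul_le_mul_iff_right hN huf.ne,
      ENNReal.inv_le_inv] at hle2
    exact (ENNReal.rpow_le_rpow_iff (by positivity)).1 hle2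
  set u' : ℝ → ℝ := fun x => max (hum.mk u x) 0 with hu'
  have huu' : u =ᵐ[volume] u' := by
    filter_upwards [hum.ae_eq_mk, hpos] with x hx hx0
    simp only [hu']; rw [← hx, max_eq_left hx0.le]
  have hu'm : Measurable u' := hum.measurable_mk.max measurable_const
  have hu'0 : ∀ x, 0 ≤ u' x := fun x => le_max_right _ _
  set v : ℝ → ℝ := fun x => |x| ^ (-α) * u' x with hv
  have hvm : Measurable v := by simp only [hv]; fun_prop
  have hv0 : ∀ x, 0 ≤ v x := fun x => by have := hu'0 x; simp only [hv]; positivity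
  have eu : Du = ∫⁻ x, ENNReal.ofReal (v x ^ p * |x| ^ (-((β - α) * p))) := by
    rw [hDu, lintegral_pow_eq α β p (hpos.mono fun x hx => hx.le)]
    refine lintegral_congr_ae ?_
    filter_upwards [huu'] with x hx
    rw [hx]
  have eP : DP = ∫⁻ x, ENNReal.ofReal (twoPoint c v x ^ p * |x| ^ (-((β - α) * p))) := by
    rw [hDP, lintegral_pow_eq α β p (hPpos.mono fun x hx => hx.le)]
    refine lintegral_congr_ae ?_
    filter_upwards [polarize_congr α c huu', ae_ne 0] with x hx hx0
    rw [hx, rpow_mul_polarize hx0]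
  rw [eu] at hden hDD
  rw [eP] at hDD
  have := ae_reflect_le_of_lintegral_le hp (by have := sub_pos.2 hαβ; positivity) hc hvm hv0 hden hDD
  filter_upwards [this, huu', ae_reflect c huu'] with x hx a1 a2 hxc
  rw [a1, a2]
  exact hx hxc

theorem ae_le_one_of_isNormalizedMinimizer {γ α β : ℝ} {u : ℝ → ℝ}
    (h : IsNormalizedMinimizer γ α β u) : ∀ᵐ x, |x| ≤ 1 → u x ≤ 1 := by
  have := h.max_eq_one.1
  have h2 : ∀ᵐ x ∂(volume.restrict (Set.Icc (-1 : ℝ) 1)), u x ≤ 1 := this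
  rw [ae_restrict_iff' measurableSet_Icc] at h2
  filter_upwards [h2] with x hx hx1
  exact hx (Set.mem_Icc.2 (abs_le.1 hx1))

/-- Normalized minimizers grow at most like `|x|^α` outside `[-1,1]`. -/
theorem ae_le_rpow_of_isNormalizedMinimizer {γ α β : ℝ} (h0 : 0 < γ) (h1 : γ < 1 / 2) (hα : 0 < α)
    (hα1 : α < (1 - 2 * γ) / 2) (hαβ : α < β) {u : ℝ → ℝ} (h : IsNormalizedMinimizer γ α β u) :
    ∀ᵐ x, 1 < |x| → u x ≤ |x| ^ α := by
  have hN := normSq_ne_zero h0 h1 hα hα1 hαβ h.pos h.equation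
  have hden := lintegral_pow_ne_top h0 h1 hα hα1 hαβ h.pos h.equation
  -- Countably many reflection points keep the exceptional null set independent of the point.
  have hq : ∀ᵐ x, ∀ q : ℚ, 0 < q → x < (q : ℝ) →
      |2 * (q : ℝ) - x| ^ (-α) * u (2 * q - x) ≤ |x| ^ (-α) * u x := by
    rw [ae_all_iff]
    intro q
    by_cases hq : 0 < q
    · filter_upwards [reflect_le_of_isMinimizer h0 h1 hα hα1 hαβ
        (show (0 : ℝ) < q by exact_mod_cast hq) h.pos h.minimizer hN hden] with x hx _ using hx
    · exact ae_of_all _ fun x h => absurd h hq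
  have hq2 : ∀ᵐ x, ∀ q : ℚ, 0 < q → (q : ℝ) < x → |2 * (q : ℝ) - x| ≤ 1 →
      |x| ^ (-α) * u x ≤ |2 * (q : ℝ) - x| ^ (-α) := by
    rw [ae_all_iff]
    intro q
    filter_upwards [ae_reflect (q : ℝ) hq, ae_reflect (q : ℝ)
      (ae_le_one_of_isNormalizedMinimizer h)] with x hx hx1 hq0 hqx hxa
    have a1 := hx q hq0 (by linarith)
    rw [sub_sub_cancel] at a1
    refine a1.trans ?_
    calc _ ≤ |2 * (q : ℝ) - x| ^ (-α) * 1 := by gcongr; exact hx1 hxa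
      _ = _ := mul_one _
  have hmain : ∀ᵐ x, 1 < x → u x ≤ |x| ^ α := by
    filter_upwards [hq2] with x hx hx1
    by_contra! hlt
    have hx0 : 0 < |x| := abs_pos.2 (by linarith)
    have hgt : 1 < |x| ^ (-α) * u x := by
      calc (1 : ℝ) = |x| ^ (-α) * |x| ^ α := by
            rw [← Real.rpow_add hx0, neg_add_cancel, Real.rpow_zero]
        _ < _ := by gcongr
    -- For `x > 1` the reflection point is chosen so that the mirror image lies just below `1`, where
    -- `u ≤ 1` and `|y|^{-α}` is close to `1`.
    have hcont : Tendsto (fun y : ℝ => |y| ^ (-α)) (𝓝[<] 1) (𝓝 1) := by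
      have : ContinuousAt (fun y : ℝ => |y| ^ (-α)) 1 :=
        ContinuousAt.rpow_const continuous_abs.continuousAt (Or.inl (by simp))
      have := this.tendsto
      simp only [abs_one, Real.one_rpow] at this
      exact this.mono_left nhdsWithin_le_nhds
    obtain ⟨y₀, hy₀, hy⟩ := (mem_nhdsLT_iff_exists_Ioo_subset).1 (hcont.eventually_lt_const hgt)
    rw [Set.mem_Iio] at hy₀
    obtain ⟨q, hq1, hq2⟩ := exists_rat_btwn (show (max y₀ 0 + x) / 2 < (1 + x) / 2 by
      have := max_lt hy₀ one_pos; linarith)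
    have m1 := le_max_left y₀ 0
    have m2 := le_max_right y₀ 0
    have hyq := hy (show 2 * (q : ℝ) - x ∈ Set.Ioo y₀ 1 from ⟨by linarith, by linarith⟩)
    have hq0 : (0 : ℝ) < q := by linarith
    have := hx q (by exact_mod_cast hq0) (by linarith) (abs_le.2 ⟨by linarith, by linarith⟩)
    exact absurd (lt_of_le_of_lt this hyq) (lt_irrefl _)
  have hneg : ∀ᵐ x, 1 < -x → u (-x) ≤ |-x| ^ α := by
    have := ae_reflect 0 hmain
    simpa using this
  filter_upwards [hmain, hneg, h.even] with x a1 a2 a3 hx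
  rcases lt_abs.1 hx with hx' | hx'
  · exact a1 hx'
  · rw [← a3, ← abs_neg]; exact a2 hx'

/-! ### The maximum principle -/

/-- The kernel dominates the weight `1 / (1 + |y|^{1+2γ+α})` when `x` is bounded. -/
theorem weight_le_kernel {γ α R x y : ℝ} (h0 : 0 < γ) (h1 : γ < 1 / 2) (hα : 0 ≤ α) (hα1 : α ≤ 1)
    (hR : 1 ≤ R) (hx : |x| ≤ R) (hx0 : x ≠ 0) (hy0 : y ≠ 0) (hxy : x ≠ y) :
    1 / (1 + |y| ^ (1 + 2 * γ + α)) ≤ 4 * R ^ 3 * kernel γ α x y := by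
  have px := abs_pos.2 hx0
  have py := abs_pos.2 hy0
  have pd : 0 < |x - y| := abs_pos.2 (sub_ne_zero.2 hxy)
  set m := max 1 |y| with hm
  have hm1 : 1 ≤ m := le_max_left _ _
  have hmy : |y| ≤ m := le_max_right _ _
  have a1 : |x - y| ^ (1 + 2 * γ) ≤ 4 * R ^ 2 * m ^ (1 + 2 * γ) := by
    calc |x - y| ^ (1 + 2 * γ) ≤ (2 * R * m) ^ (1 + 2 * γ) := by
          refine Real.rpow_le_rpow pd.le ((abs_sub x y).trans ?_) (by linarith)
          nlinarith
      _ = (2 * R) ^ (1 + 2 * γ) * m ^ (1 + 2 * γ) := Real.mul_rpow (by linarith) (by linarith)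
      _ ≤ (2 * R) ^ (2 : ℝ) * m ^ (1 + 2 * γ) := by
          gcongr ?_ * _
          exact Real.rpow_le_rpow_of_exponent_le (by linarith) (by linarith)
      _ = 4 * R ^ 2 * m ^ (1 + 2 * γ) := by rw [Real.rpow_two]; ring
  have a2 : |x| ^ α ≤ R := by
    calc |x| ^ α ≤ R ^ α := Real.rpow_le_rpow px.le hx hα
      _ ≤ R ^ (1 : ℝ) := Real.rpow_le_rpow_of_exponent_le hR hα1
      _ = R := Real.rpow_one R
  have a3 : |y| ^ α ≤ m ^ α := Real.rpow_le_rpow py.le hmy hα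
  have a4 : m ^ (1 + 2 * γ) * m ^ α ≤ 1 + |y| ^ (1 + 2 * γ + α) := by
    rw [← Real.rpow_add (by linarith)]
    rcases le_total 1 |y| with h | h
    · rw [hm, max_eq_right h]; linarith
    · rw [hm, max_eq_left h, Real.one_rpow]; linarith [Real.rpow_nonneg py.le (1 + 2 * γ + α)]
  have a5 : |x - y| ^ (1 + 2 * γ) * |x| ^ α * |y| ^ α
      ≤ 4 * R ^ 3 * (1 + |y| ^ (1 + 2 * γ + α)) := by
    calc _ ≤ (4 * R ^ 2 * m ^ (1 + 2 * γ)) * R * m ^ α := by gcongr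
      _ = 4 * R ^ 3 * (m ^ (1 + 2 * γ) * m ^ α) := by ring
      _ ≤ _ := by gcongr
  unfold kernel
  rw [mul_one_div, div_le_div_iff₀ (by positivity) (by positivity), one_mul]
  exact a5

theorem integrable_mul_rpow {g : ℝ → ℝ} {M R r : ℝ} (hg : AEMeasurable g)
    (hM0 : 0 ≤ M) (hM : ∀ᵐ x, |g x| ≤ M) (hsupp : ∀ᵐ x, R < |x| → g x = 0) (hr : -1 < r) :
    Integrable (fun x => g x * |x| ^ r) := by
  refine (((integrableOn_abs_rpow_Icc hr R).integrable_indicator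
    measurableSet_Icc).const_mul M).mono'
    (hg.mul (Measurable.aemeasurable (by fun_prop))).aestronglyMeasurable ?_
  filter_upwards [hM, hsupp] with x h1 h2
  rw [Real.norm_eq_abs, abs_mul, abs_of_nonneg (by positivity : 0 ≤ |x| ^ r)]
  rcases le_or_gt |x| R with h | h
  · rw [Set.indicator_of_mem (Set.mem_Icc.2 (abs_le.1 h))]
    gcongr
  · rw [h2 h, abs_zero, zero_mul]
    exact mul_nonneg hM0 (Set.indicator_nonneg (fun _ _ => by positivity) _)

/-- The sum of a multiple of `u - 1` and a barrier made of two powers. -/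
def barrierSum (p Λ σ τ : ℝ) (u : ℝ → ℝ) (x : ℝ) : ℝ :=
  p * (u x - 1) + Λ * (|x| ^ σ - |x| ^ τ)

/-- A quantitative maximum principle. If `z = p (u - 1) + Λ (|x|^σ - |x|^τ)` satisfies
`𝓛 z ≤ C` weakly, is at most `-1` outside `[-R,R]` and exceeds `-1` somewhere, then the negative part
of `z + 1` has bounded weighted integral. This is the equation evaluated at a maximum point of `z`,
in weak form: the test function is `(z + 1)⁺`, and each point where it is positive sees
the negative part of `z + 1` through the kernel. -/
theorem lintegral_negPart_le {γ α σ τ p Λ R M C : ℝ} (h0 : 0 < γ) (h1 : γ < 1 / 2) (hα : 0 ≤ α)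
    (hα1 : α < (1 - 2 * γ) / 2) (hσ : 0 < σ) (hτ : 0 < τ)
    (hσi : Integrable (fun s => (|s| ^ σ - 1) * kernel γ α 1 s))
    (hτi : Integrable (fun s => (|s| ^ τ - 1) * kernel γ α 1 s))
    (hR : 1 ≤ R) (hM0 : 0 ≤ M) (hC : 0 ≤ C)
    {u F : ℝ → ℝ} (hu : AEMeasurable u) (huf : normSq γ α u < ∞)
    (hweak : ∀ φ, IsTestFunction φ → 1 / 2 * energyForm γ α u φ = ∫ x, F x * φ x)
    (hF : ∀ r : ℝ, IntegrableOn F (Set.Icc (-r) r))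
    (hFC : ∀ᵐ x, p * F x - Λ * (powConst γ α σ * |x| ^ (σ - (2 * γ + 2 * α)))
      + Λ * (powConst γ α τ * |x| ^ (τ - (2 * γ + 2 * α))) ≤ C)
    (hzR : ∀ᵐ x, R < |x| → barrierSum p Λ σ τ u x ≤ -1)
    (hzM : ∀ᵐ x, barrierSum p Λ σ τ u x ≤ M)
    (hzpos : ¬ ∀ᵐ x, barrierSum p Λ σ τ u x ≤ -1) :
    ∫⁻ x, ENNReal.ofReal (max (-1 - barrierSum p Λ σ τ u x) 0 / (1 + |x| ^ (1 + 2 * γ + α)))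
      ≤ ENNReal.ofReal (8 * R ^ 3 * C) := by
  set z := barrierSum p Λ σ τ u with hz
  have hzm : AEMeasurable z :=
    ((hu.sub_const 1).const_mul p).add (Measurable.aemeasurable (by fun_prop))
  set φ : ℝ → ℝ := fun x => max (z x + 1) 0 with hφ
  set ψ : ℝ → ℝ := fun x => max (-1 - z x) 0 with hψ
  have hφm : AEMeasurable φ := (hzm.add_const 1).max aemeasurable_const
  have hψm : AEMeasurable ψ := (hzm.const_sub (-1)).max aemeasurable_const
  have hφ0 : ∀ x, 0 ≤ φ x := fun x => le_max_right _ _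
  have hψ0 : ∀ x, 0 ≤ ψ x := fun x => le_max_right _ _
  have hφM : ∀ᵐ x, |φ x| ≤ M + 1 := by
    filter_upwards [hzM] with x hx
    rw [abs_of_nonneg (hφ0 x)]
    exact max_le (by linarith) (by linarith)
  have hφR : ∀ᵐ x, R < |x| → φ x = 0 := by
    filter_upwards [hzR] with x hx hxR
    exact max_eq_right (by linarith [hx hxR])
  have hM1 : 0 ≤ M + 1 := by linarith
  have iσ := integrable_mul_rpow (r := σ - (2 * γ + 2 * α)) hφm hM1 hφM hφR (by linarith)
  have iτ := integrable_mul_rpow (r := τ - (2 * γ + 2 * α)) hφm hM1 hφM hφR (by linarith)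
  have iφ : Integrable φ := by
    have := integrable_mul_rpow (r := 0) hφm hM1 hφM hφR (by norm_num)
    simpa using this
  set Dσ : ℝ × ℝ → ℝ := fun q =>
    φ q.1 * ((|q.2| ^ σ - |q.1| ^ σ) * kernel γ α q.1 q.2) with hDσ
  set Dτ : ℝ × ℝ → ℝ := fun q =>
    φ q.1 * ((|q.2| ^ τ - |q.1| ^ τ) * kernel γ α q.1 q.2) with hDτ
  have iDσ : Integrable Dσ := integrable_prod_powDiff hσi hφm iσ
  have iDτ : Integrable Dτ := integrable_prod_powDiff hτi hφm iτ
  have iDσ' : Integrable (fun q : ℝ × ℝ => Dσ q.swap) := iDσ.swap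
  have iDτ' : Integrable (fun q : ℝ × ℝ => Dτ q.swap) := iDτ.swap
  have swapI : ∀ D : ℝ × ℝ → ℝ, ∫ q : ℝ × ℝ, D q.swap = ∫ q, D q := fun D => by
    rw [Measure.volume_eq_prod]; exact integral_prod_swap D
  have iσ2 : Integrable (fun q : ℝ × ℝ => Λ * (Dσ q + Dσ q.swap)) :=
    (iDσ.add iDσ').const_mul Λ
  have iτ2 : Integrable (fun q : ℝ × ℝ => Λ * (Dτ q + Dτ q.swap)) :=
    (iDτ.add iDτ').const_mul Λ
  have iρ : Integrable (fun q : ℝ × ℝ =>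
      Λ * (Dτ q + Dτ q.swap) - Λ * (Dσ q + Dσ q.swap)) := iτ2.sub iσ2
  have hρeq : ∀ q : ℝ × ℝ, Λ * (Dτ q + Dτ q.swap) - Λ * (Dσ q + Dσ q.swap)
      = Λ * (|q.1| ^ σ - |q.1| ^ τ - (|q.2| ^ σ - |q.2| ^ τ)) * (φ q.1 - φ q.2)
        * kernel γ α q.1 q.2 := fun q => by
    simp only [hDσ, hDτ, Prod.fst_swap, Prod.snd_swap]
    rw [kernel_symm γ α q.2 q.1]; ring
  -- `z + 1 = φ - ψ` with `φ ψ = 0`.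
  have hdecomp : ∀ x y, (z x - z y) * (φ x - φ y)
      = (φ x - φ y) ^ 2 + (φ x * ψ y + φ y * ψ x) := by
    have hzφψ : ∀ x, z x + 1 = φ x - ψ x ∧ φ x * ψ x = 0 := fun x => by
      simp only [hφ, hψ]
      rcases le_total (z x + 1) 0 with h | h
      · rw [max_eq_right h, max_eq_left (by linarith : (0 : ℝ) ≤ -1 - z x)]
        constructor <;> ring
      · rw [max_eq_left h, max_eq_right (by linarith : -1 - z x ≤ (0 : ℝ))]
        constructor <;> ring
    intro x y
    obtain ⟨a1, a2⟩ := hzφψ x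
    obtain ⟨b1, b2⟩ := hzφψ y
    have : z x - z y = φ x - ψ x - (φ y - ψ y) := by linarith
    rw [this]; linear_combination -a2 - b2
  have hzdiff : ∀ x y, z x - z y
      = p * (u x - u y) + Λ * (|x| ^ σ - |x| ^ τ - (|y| ^ σ - |y| ^ τ)) := fun x y => by
    simp only [hz, barrierSum]; ring
  -- The energy of `φ` is finite although that of the barrier need not be: `φ` is bounded with bounded
  -- support, and `(φ(x) - φ(y))² ≤ (z(x) - z(y)) (φ(x) - φ(y))`, where the barrier enters linearly.
  have hφf : normSq γ α φ < ∞ := by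
    rw [normSq_eq_lintegral_prod γ α hφm]
    have idom := ((integrable_sq_diff hu huf).const_mul (p ^ 2)).add (iρ.const_mul 2)
    refine lt_of_le_of_lt (lintegral_mono fun q => ENNReal.ofReal_le_ofReal ?_)
      idom.lintegral_lt_top
    have hk := kernel_nonneg γ α q.1 q.2
    simp only [Pi.add_apply]
    rw [hρeq, ← mul_assoc, ← mul_assoc, ← add_mul]
    refine mul_le_mul_of_nonneg_right ?_ hk
    have hd := hdecomp q.1 q.2
    rw [hzdiff] at hd
    have n1 := mul_nonneg (hφ0 q.1) (hψ0 q.2)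
    have n2 := mul_nonneg (hφ0 q.2) (hψ0 q.1)
    nlinarith [sq_nonneg (p * (u q.1 - u q.2) - (φ q.1 - φ q.2))]
  have hlim := energyLimit_of_bounded_support h0 h1 hα hα1 hφm hM1 hφM hφR hφf
  obtain ⟨iFφ, hwφ⟩ := weak_formulation_extend h0 h1 hα (by linarith) hu huf hweak hF hlim
  have iE := integrable_energyForm hu hφm huf hφf
  have iG : Integrable (fun q : ℝ × ℝ => (z q.1 - z q.2) * (φ q.1 - φ q.2)
      * kernel γ α q.1 q.2) := by
    refine ((iE.const_mul p).add iρ).congr (ae_of_all _ fun q => ?_)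
    simp only [Pi.add_apply]
    rw [hρeq, hzdiff]; ring
  have hG : ∫ q : ℝ × ℝ, (z q.1 - z q.2) * (φ q.1 - φ q.2) * kernel γ α q.1 q.2
      ≤ 2 * C * ∫ x, φ x := by
    have e1 : ∫ q : ℝ × ℝ, (z q.1 - z q.2) * (φ q.1 - φ q.2) * kernel γ α q.1 q.2
        = p * energyForm γ α u φ
          + ∫ q : ℝ × ℝ, (Λ * (Dτ q + Dτ q.swap) - Λ * (Dσ q + Dσ q.swap)) := by
      rw [energyForm, ← integral_const_mul, ← integral_add (iE.const_mul p) iρ]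
      congr 1; ext q
      rw [hρeq, hzdiff]; ring
    have e2 : ∫ q : ℝ × ℝ, (Λ * (Dτ q + Dτ q.swap) - Λ * (Dσ q + Dσ q.swap))
        = 2 * Λ * ((∫ x, φ x * |x| ^ (τ - (2 * γ + 2 * α))) * powConst γ α τ)
          - 2 * Λ * ((∫ x, φ x * |x| ^ (σ - (2 * γ + 2 * α))) * powConst γ α σ) := by
      rw [integral_sub iτ2 iσ2,
        integral_const_mul, integral_const_mul, integral_add iDτ iDτ', integral_add iDσ iDσ',
        swapI, swapI, integral_prod_powDiff hσi hφm iσ, integral_prod_powDiff hτi hφm iτ]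
      ring
    have e3 : p * energyForm γ α u φ = 2 * p * ∫ x, F x * φ x := by rw [← hwφ]; ring
    have jF : Integrable (fun x => 2 * p * (F x * φ x)) := iFφ.const_mul _
    have jτ : Integrable (fun x => 2 * Λ * (φ x * |x| ^ (τ - (2 * γ + 2 * α))
      * powConst γ α τ)) := (iτ.mul_const _).const_mul _
    have jσ : Integrable (fun x => 2 * Λ * (φ x * |x| ^ (σ - (2 * γ + 2 * α))
      * powConst γ α σ)) := (iσ.mul_const _).const_mul _
    have jd : Integrable (fun x => 2 * Λ * (φ x * |x| ^ (τ - (2 * γ + 2 * α)) * powConst γ α τ)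
      - 2 * Λ * (φ x * |x| ^ (σ - (2 * γ + 2 * α)) * powConst γ α σ)) := jτ.sub jσ
    rw [e1, e2, e3, ← integral_mul_const, ← integral_mul_const, ← integral_const_mul,
      ← integral_const_mul, ← integral_const_mul, ← integral_const_mul,
      ← integral_sub jτ jσ, ← integral_add jF jd]
    refine integral_mono_ae (jF.add jd) (iφ.const_mul _) ?_
    filter_upwards [hFC] with x hx
    have := mul_le_mul_of_nonneg_left hx (hφ0 x)
    linarith
  have hφI : 0 < ∫ x, φ x := by
    refine (integral_nonneg hφ0).lt_of_ne fun h => hzpos ?_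
    have := (integral_eq_zero_iff_of_nonneg hφ0 iφ).1 h.symm
    filter_upwards [this] with x hx
    have : z x + 1 ≤ φ x := le_max_left _ _
    rw [hx, Pi.zero_apply] at this
    linarith
  set W : ℝ → ℝ := fun y => ψ y / (1 + |y| ^ (1 + 2 * γ + α)) with hW
  have hWm : AEMeasurable W := hψm.div (Measurable.aemeasurable (by fun_prop))
  -- The terms `φ(x) ψ(y)` control the product of the integrals, from which that of `φ` is cancelled.
  have hprod : (∫⁻ x, ENNReal.ofReal (φ x)) * ∫⁻ y, ENNReal.ofReal (W y)
      ≤ ENNReal.ofReal (8 * R ^ 3 * C) * ∫⁻ x, ENNReal.ofReal (φ x) := by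
    rw [← lintegral_prod_mul hφm.ennreal_ofReal hWm.ennreal_ofReal, ← Measure.volume_eq_prod,
      ← ofReal_integral_eq_lintegral_ofReal iφ (ae_of_all _ hφ0),
      ← ENNReal.ofReal_mul (by positivity)]
    have iG' := iG.const_mul (4 * R ^ 3)
    have hle : 4 * R ^ 3 * ∫ q : ℝ × ℝ, (z q.1 - z q.2) * (φ q.1 - φ q.2) * kernel γ α q.1 q.2
        ≤ 8 * R ^ 3 * C * ∫ x, φ x := by
      calc _ ≤ 4 * R ^ 3 * (2 * C * ∫ x, φ x) := by gcongr
        _ = _ := by ring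
    refine le_trans ?_ (ENNReal.ofReal_le_ofReal hle)
    rw [← integral_const_mul, ofReal_integral_eq_lintegral_ofReal iG' (ae_of_all _ fun q => by
      have hk := kernel_nonneg γ α q.1 q.2
      have n1 := mul_nonneg (hφ0 q.1) (hψ0 q.2)
      have n2 := mul_nonneg (hφ0 q.2) (hψ0 q.1)
      simp only [Pi.zero_apply]
      rw [hdecomp]; positivity)]
    refine lintegral_mono_ae ?_
    have hne : ∀ᵐ q : ℝ × ℝ, q.1 ≠ q.2 := by
      rw [Measure.volume_eq_prod]
      refine (Measure.ae_prod_iff_ae_ae ?_).2 (ae_of_all _ fun x => ?_)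
      · exact (measurableSet_eq_fun measurable_fst measurable_snd).compl
      · filter_upwards [ae_ne x] with y hy using Ne.symm hy
    filter_upwards [ae_prod_fst (ae_ne 0), ae_prod_snd (ae_ne 0), hne, ae_prod_fst hφR]
      with q q1 q2 q3 q4
    rw [← ENNReal.ofReal_mul (hφ0 _)]
    refine ENNReal.ofReal_le_ofReal ?_
    have hk := kernel_nonneg γ α q.1 q.2
    have n1 := mul_nonneg (hφ0 q.1) (hψ0 q.2)
    have n2 := mul_nonneg (hφ0 q.2) (hψ0 q.1)
    rw [hdecomp]
    rcases le_or_gt |q.1| R with h | h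
    · have hw := weight_le_kernel h0 h1 hα (by linarith) hR h q1 q2 q3
      calc φ q.1 * W q.2 = φ q.1 * ψ q.2 * (1 / (1 + |q.2| ^ (1 + 2 * γ + α))) := by
            simp only [hW]; ring
        _ ≤ φ q.1 * ψ q.2 * (4 * R ^ 3 * kernel γ α q.1 q.2) := by gcongr
        _ = 4 * R ^ 3 * (φ q.1 * ψ q.2 * kernel γ α q.1 q.2) := by ring
        _ ≤ _ := by
            gcongr
            nlinarith [sq_nonneg (φ q.1 - φ q.2)]
    · rw [q4 h]
      have : 0 ≤ φ q.2 * ψ q.1 := n2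
      simp only [zero_mul]
      positivity
  rw [← ofReal_integral_eq_lintegral_ofReal iφ (ae_of_all _ hφ0), mul_comm] at hprod
  exact (ENNReal.mul_le_mul_iff_left (ENNReal.ofReal_pos.2 hφI).ne' ENNReal.ofReal_ne_top).1 hprod

/-! ### The uniform bound -/

/-- An integrable majorant of `(1 + |x|^κ) / (1 + |x|^θ)` when `κ - θ ≤ r < -1`. -/
def weightMajorant (r x : ℝ) : ℝ :=
  2 * (Set.Icc (-1 : ℝ) 1).indicator (fun _ => (1 : ℝ)) x
    + 2 * {x : ℝ | 1 ≤ |x|}.indicator (fun x => |x| ^ r) x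

theorem integrable_weightMajorant {r : ℝ} (hr : r < -1) : Integrable (weightMajorant r) := by
  have i1 : Integrable ((Set.Icc (-1 : ℝ) 1).indicator (fun _ => (1 : ℝ))) :=
    (integrableOn_const (by simp)).integrable_indicator measurableSet_Icc
  have i2 := (integrableOn_abs_rpow_compl (r := r) (R := 1) hr one_pos).integrable_indicator
    (measurableSet_le_abs 1)
  exact (i1.const_mul 2).add (i2.const_mul 2)

theorem div_le_weightMajorant {κ θ r : ℝ} (hκ : 0 ≤ κ) (hr : κ - θ ≤ r) (x : ℝ) :
    (1 + |x| ^ κ) / (1 + |x| ^ θ) ≤ weightMajorant r x := by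
  have hx := abs_nonneg x
  have n1 := Real.rpow_nonneg hx κ
  have n2 := Real.rpow_nonneg hx θ
  unfold weightMajorant
  rcases le_or_gt |x| 1 with h | h
  · rw [Set.indicator_of_mem (Set.mem_Icc.2 (abs_le.1 h))]
    have h2 : 0 ≤ {x : ℝ | 1 ≤ |x|}.indicator (fun x => |x| ^ r) x :=
      Set.indicator_nonneg (fun _ _ => by positivity) _
    have : |x| ^ κ ≤ 1 := Real.rpow_le_one hx h hκ
    have : (1 + |x| ^ κ) / (1 + |x| ^ θ) ≤ 2 := by
      rw [div_le_iff₀ (by positivity)]; linarith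
    linarith
  · have h0 : 0 < |x| := by linarith
    rw [Set.indicator_of_mem (show x ∈ {x : ℝ | 1 ≤ |x|} from h.le)]
    have h2 : 0 ≤ (Set.Icc (-1 : ℝ) 1).indicator (fun _ => (1 : ℝ)) x :=
      Set.indicator_nonneg (fun _ _ => zero_le_one) _
    have h3 : (1 + |x| ^ κ) / (1 + |x| ^ θ) ≤ 2 * |x| ^ (κ - θ) := by
      have p2 := Real.rpow_pos_of_pos h0 θ
      have : 1 ≤ |x| ^ κ := Real.one_le_rpow h.le hκ
      rw [Real.rpow_sub h0, div_le_iff₀ (by positivity)]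
      have e : 2 * (|x| ^ κ / |x| ^ θ) * (1 + |x| ^ θ)
          = 2 * (|x| ^ κ / |x| ^ θ) + 2 * |x| ^ κ := by field_simp
      rw [e]
      have : 0 ≤ |x| ^ κ / |x| ^ θ := by positivity
      linarith
    have h4 : |x| ^ (κ - θ) ≤ |x| ^ r := Real.rpow_le_rpow_of_exponent_le h.le hr
    linarith

theorem two_lt_exponent {γ α β : ℝ} (h1 : γ < 1 / 2) (hαβ : α < β) (hβ : β < α + γ) :
    2 < exponent γ α β := by
  rw [exponent, lt_div_iff₀ (by linarith)]
  linarith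

/-- Integrability for fixed parameters: `|η|` grows at most like `|x|^α`. -/
theorem integrable_eta {γ α β : ℝ} (h0 : 0 < γ) (h1 : γ < 1 / 2) (hα : 0 < α)
    (hα1 : α < (1 - 2 * γ) / 2) (hαβ : α < β) {u : ℝ → ℝ} (h : IsNormalizedMinimizer γ α β u) :
    Integrable (fun x => |eta γ α β u x| / (1 + |x| ^ (1 + 2 * γ + α))) := by
  have hp := exponent_pos h1 hαβ
  have hum := h.minimizer.1.aemeasurable
  refine ((integrable_weightMajorant (r := -(1 + 2 * γ)) (by linarith)).const_mul
    (exponent γ α β)).mono' ?_ ?_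
  · refine AEMeasurable.aestronglyMeasurable (AEMeasurable.div ?_
      (Measurable.aemeasurable (by fun_prop)))
    have : AEMeasurable (eta γ α β u) := (hum.sub_const 1).const_mul _
    exact this.abs
  filter_upwards [h.pos, ae_le_one_of_isNormalizedMinimizer h,
    ae_le_rpow_of_isNormalizedMinimizer h0 h1 hα hα1 hαβ h] with x hx hx1 hx2
  have n1 := Real.rpow_nonneg (abs_nonneg x) α
  have n2 := Real.rpow_nonneg (abs_nonneg x) (1 + 2 * γ + α)
  have hle : |u x - 1| ≤ 1 + |x| ^ α := by
    rw [abs_le]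
    constructor
    · linarith
    · rcases le_or_gt |x| 1 with hc | hc
      · linarith [hx1 hc]
      · linarith [hx2 hc]
  rw [Real.norm_eq_abs, abs_of_nonneg (by positivity), eta, abs_mul, abs_of_pos hp, mul_div_assoc]
  refine mul_le_mul_of_nonneg_left (le_trans ?_
    (div_le_weightMajorant hα.le (by linarith : α - (1 + 2 * γ + α) ≤ -(1 + 2 * γ)) x)) hp.le
  gcongr

/-- The equation gives a bound for `p 𝓛 u` plus the operator applied to the barrier: near the
origin the term `|x|^{σ-s}`, `s = 2γ + 2α`, absorbs the right-hand side, whose singularity is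
weaker because `q ≤ s - σ`. -/
theorem source_add_barrier_le {γ α β σ Λ cσ cτ K x v : ℝ} (hγ : 3 / 8 ≤ γ) (h1 : γ < 1 / 2)
    (hα : 0 < α) (hα1 : α < (1 - 2 * γ) / 2) (hαβ : α < β) (hβ : β < α + γ)
    (hσ : 0 < σ) (hσ4 : σ ≤ 1 / 4) (hq : β * exponent γ α β ≤ 2 * γ - σ)
    (hΛ : 0 < Λ) (hcσ : 2 ≤ Λ * cσ) (hK : 0 ≤ K) (hcτ : cτ ≤ K)
    (hx : x ≠ 0) (hv : 0 < v) (hv1 : |x| ≤ 1 → v ≤ 1) (hv2 : 1 < |x| → v ≤ |x| ^ α) :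
    1 / |x| ^ (β * exponent γ α β) * v ^ (exponent γ α β - 1)
      - Λ * (cσ * |x| ^ (σ - (2 * γ + 2 * α))) + Λ * (cτ * |x| ^ (2 * σ - (2 * γ + 2 * α)))
      ≤ (Λ * K + 1) ^ (1 / σ) * (Λ * K + 1) + 1 + (Λ * K + 1) := by
  set p := exponent γ α β with hp
  set A := Λ * K + 1 with hA
  have hp2 : 2 < p := two_lt_exponent h1 hαβ hβ
  have ht : 0 < |x| := abs_pos.2 hx
  set t := |x| with ht'
  have hA1 : 1 ≤ A := by
    have := mul_nonneg hΛ.le hK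
    linarith
  have hApos : 0 ≤ A ^ (1 / σ) := Real.rpow_nonneg (by linarith) _
  have e1 : 1 / t ^ (β * p) = t ^ (-(β * p)) := by rw [Real.rpow_neg ht.le, one_div]
  have e2 : t ^ (2 * σ - (2 * γ + 2 * α)) = t ^ (σ - (2 * γ + 2 * α)) * t ^ σ := by
    rw [← Real.rpow_add ht]; congr 1; ring
  have nσ := Real.rpow_nonneg ht.le σ
  have nS := Real.rpow_nonneg ht.le (σ - (2 * γ + 2 * α))
  rw [e1]
  rcases le_or_gt t 1 with h | h
  · have b1 : v ^ (p - 1) ≤ 1 := Real.rpow_le_one hv.le (hv1 h) (by linarith)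
    have b2 : t ^ (-(β * p)) ≤ t ^ (σ - (2 * γ + 2 * α)) :=
      Real.rpow_le_rpow_of_exponent_ge ht h (by linarith)
    have b3 : t ^ (-(β * p)) * v ^ (p - 1) ≤ t ^ (σ - (2 * γ + 2 * α)) := by
      calc _ ≤ t ^ (-(β * p)) * 1 := by gcongr
        _ ≤ _ := by rw [mul_one]; exact b2
    have b4 : 2 * t ^ (σ - (2 * γ + 2 * α)) ≤ Λ * cσ * t ^ (σ - (2 * γ + 2 * α)) := by gcongr
    have b5 : Λ * (cτ * (t ^ (σ - (2 * γ + 2 * α)) * t ^ σ))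
        ≤ A * (t ^ (σ - (2 * γ + 2 * α)) * t ^ σ) := by
      rw [← mul_assoc]
      refine mul_le_mul_of_nonneg_right ?_ (by positivity)
      have := mul_le_mul_of_nonneg_left hcτ hΛ.le
      linarith
    have b6 : t ^ (σ - (2 * γ + 2 * α)) * (A * t ^ σ - 1) ≤ A ^ (1 / σ) * A := by
      rcases le_or_gt (A * t ^ σ) 1 with hc | hc
      · refine le_trans (mul_nonpos_of_nonneg_of_nonpos nS (by linarith)) (by positivity)
      · have c1 : 1 ≤ A ^ (1 / σ) * t := by
          have := Real.one_le_rpow hc.le (by positivity : 0 ≤ 1 / σ)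
          rwa [Real.mul_rpow (by linarith) nσ, ← Real.rpow_mul ht.le, mul_one_div_cancel hσ.ne',
            Real.rpow_one] at this
        have c2 : t ^ (σ - (2 * γ + 2 * α)) ≤ A ^ (1 / σ) := by
          calc t ^ (σ - (2 * γ + 2 * α)) ≤ t ^ (-1 : ℝ) :=
                Real.rpow_le_rpow_of_exponent_ge ht h (by linarith)
            _ = 1 / t := by rw [Real.rpow_neg_one, one_div]
            _ ≤ A ^ (1 / σ) := by rw [div_le_iff₀ ht]; exact c1
        have c3 : A * t ^ σ - 1 ≤ A := by
          have := Real.rpow_le_one ht.le h hσ.le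
          nlinarith
        exact mul_le_mul c2 c3 (by linarith) hApos
    rw [e2]
    nlinarith
  · have b1 : t ^ (-(β * p)) * v ^ (p - 1) ≤ 1 := by
      calc t ^ (-(β * p)) * v ^ (p - 1) ≤ t ^ (-(β * p)) * (t ^ α) ^ (p - 1) := by
            gcongr
            · linarith
            · exact hv2 h
        _ = t ^ (-(β * p) + α * (p - 1)) := by rw [← Real.rpow_mul ht.le, ← Real.rpow_add ht]
        _ ≤ 1 := Real.rpow_le_one_of_one_le_of_nonpos h.le (by nlinarith)
    have b2 : t ^ (2 * σ - (2 * γ + 2 * α)) ≤ 1 :=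
      Real.rpow_le_one_of_one_le_of_nonpos h.le (by linarith)
    have n3 := Real.rpow_nonneg ht.le (2 * σ - (2 * γ + 2 * α))
    have b3 : Λ * (cτ * t ^ (2 * σ - (2 * γ + 2 * α))) ≤ Λ * (K * 1) := by gcongr
    have b4 : 0 ≤ Λ * cσ * t ^ (σ - (2 * γ + 2 * α)) := mul_nonneg (by linarith) nS
    have b5 : 0 ≤ A ^ (1 / σ) * A := by positivity
    nlinarith

/-- `p (|x|^α - 1)` is controlled by `|x|^σ / σ`, since `α p < 1`. -/
theorem mul_rpow_sub_one_le {p α σ t : ℝ} (hp : 0 ≤ p) (hα : 0 < α) (hασ : α ≤ σ) (hpα : α * p ≤ 1)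
    (ht : 1 ≤ t) : p * (t ^ α - 1) ≤ 1 / σ * t ^ σ := by
  have hσ : 0 < σ := hα.trans_le hασ
  have h1 : 1 ≤ t ^ σ := Real.one_le_rpow ht hσ.le
  have h2 : t ^ α ≤ 1 + α / σ * (t ^ σ - 1) := by
    have := rpow_one_add_le_one_add_mul_self (s := t ^ σ - 1) (by linarith)
      (p := α / σ) (by positivity) ((div_le_one hσ).2 hασ)
    rwa [add_sub_cancel, ← Real.rpow_mul (by linarith), mul_div_cancel₀ _ hσ.ne'] at this
  calc p * (t ^ α - 1) ≤ p * (α / σ * (t ^ σ - 1)) := by gcongr; linarith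
    _ = (α * p) * (1 / σ * (t ^ σ - 1)) := by ring
    _ ≤ 1 * (1 / σ * (t ^ σ - 1)) := by gcongr
    _ ≤ 1 / σ * t ^ σ := by
      rw [one_mul]
      gcongr
      linarith

theorem mul_exponent_le_one {γ α β : ℝ} (h1 : γ < 1 / 2)
    (hα1 : α < (1 - 2 * γ) / 2) (hαβ : α < β) : α * exponent γ α β ≤ 1 := by
  have := mul_exponent_lt_one h1 hα1 hαβ
  have := exponent_pos h1 hαβ
  nlinarith

/-- A one-sided bound for `η` with parameters that stay away from the limit. -/
theorem eta_le {γ α β σ : ℝ} {u : ℝ → ℝ} (h0 : 0 < γ) (h1 : γ < 1 / 2) (hα : 0 < α)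
    (hα1 : α < (1 - 2 * γ) / 2) (hαβ : α < β) (hασ : α ≤ σ) (h : IsNormalizedMinimizer γ α β u) :
    ∀ᵐ x, eta γ α β u x ≤ 1 / σ * |x| ^ σ := by
  have hσ : 0 < σ := hα.trans_le hασ
  have hp := exponent_pos h1 hαβ
  have hαp := mul_exponent_le_one h1 hα1 hαβ
  filter_upwards [ae_le_one_of_isNormalizedMinimizer h,
    ae_le_rpow_of_isNormalizedMinimizer h0 h1 hα hα1 hαβ h] with x hx1 hx2
  have n := Real.rpow_nonneg (abs_nonneg x) σ
  rcases le_or_gt |x| 1 with hc | hc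
  · have hneg : eta γ α β u x ≤ 0 :=
      mul_nonpos_of_nonneg_of_nonpos hp.le (by linarith [hx1 hc])
    exact hneg.trans (by positivity)
  · refine le_trans ?_ (mul_rpow_sub_one_le hp.le hα hασ hαp hc.le)
    unfold eta
    gcongr
    exact hx2 hc

theorem barrierSum_eq (γ α β Λ σ : ℝ) (u : ℝ → ℝ) (x : ℝ) :
    barrierSum (exponent γ α β) Λ σ (2 * σ) u x
      = eta γ α β u x + Λ * (|x| ^ σ - |x| ^ σ * |x| ^ σ) := by
  rw [barrierSum, eta, mul_comm 2 σ, Real.rpow_mul (abs_nonneg x), Real.rpow_two, sq]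

/-- The maximum principle applied to `η + Λ (|x|^σ - |x|^{2σ})`, with constants that depend on
`σ`, `Λ` and the bound `K` of the power constant only. -/
theorem lintegral_negPart_barrierSum_le {γ α β σ Λ K T : ℝ} {u : ℝ → ℝ} (hγ : 3 / 8 ≤ γ)
    (h1 : γ < 1 / 2) (hα : 0 < α) (hα1 : α < (1 - 2 * γ) / 2) (hαβ : α < β) (hβ : β < α + γ)
    (hσ4 : σ ≤ 1 / 4) (hασ : α ≤ σ)
    (hq : β * exponent γ α β ≤ 2 * γ - σ) (h : IsNormalizedMinimizer γ α β u)
    (hΛ0 : 0 < Λ) (hcσ : 2 ≤ Λ * powConst γ α σ) (hK : 0 ≤ K) (hcτ : powConst γ α (2 * σ) ≤ K)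
    (hT1 : 1 ≤ T) (hΛT : Λ * T = 1 / σ + Λ + 1) :
    ∫⁻ x, ENNReal.ofReal (max (-1 - barrierSum (exponent γ α β) Λ σ (2 * σ) u x) 0
        / (1 + |x| ^ (1 + 2 * γ + α)))
      ≤ ENNReal.ofReal (8 * (T ^ (1 / σ)) ^ 3
        * ((Λ * K + 1) ^ (1 / σ) * (Λ * K + 1) + 1 + (Λ * K + 1))) := by
  have hσ : 0 < σ := hα.trans_le hασ
  have hσi : 0 < 1 / σ := by positivity
  set R := T ^ (1 / σ) with hR
  have hR1 : 1 ≤ R := Real.one_le_rpow hT1 hσi.le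
  set B := (Λ * K + 1) ^ (1 / σ) * (Λ * K + 1) + 1 + (Λ * K + 1) with hB
  have hB0 : 0 ≤ B := by positivity
  have h0 : 0 < γ := by linarith
  have hp := exponent_pos h1 hαβ
  have hum := h.minimizer.1.aemeasurable
  have huf : normSq γ α u < ∞ :=
    normSq_lt_top_of_energyLimit (memD_iff_energyLimit.1 h.minimizer.1)
      (fun _ hw => IsTestFunction.aemeasurable hw)
      (fun _ hw => normSq_lt_top_of_isTestFunction h0 h1 hα.le (by linarith) hw)
  have hle1 := ae_le_one_of_isNormalizedMinimizer h
  have hle2 := ae_le_rpow_of_isNormalizedMinimizer h0 h1 hα hα1 hαβ h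
  have iσ : Integrable (fun s => (|s| ^ σ - 1) * kernel γ α 1 s) :=
    integrable_powConst h0 h1 hα.le (by linarith) (by rw [abs_of_pos hσ]; linarith)
      (by linarith) (by linarith)
  have iτ : Integrable (fun s => (|s| ^ (2 * σ) - 1) * kernel γ α 1 s) :=
    integrable_powConst h0 h1 hα.le (by linarith) (by rw [abs_of_pos (by linarith)]; linarith)
      (by linarith) (by linarith)
  have heta := eta_le h0 h1 hα hα1 hαβ hασ h
  have hzT : ∀ᵐ x, T ≤ |x| ^ σ → barrierSum (exponent γ α β) Λ σ (2 * σ) u x ≤ -1 := by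
    filter_upwards [heta] with x hx hTx
    rw [barrierSum_eq]
    have : Λ * T * |x| ^ σ ≤ Λ * |x| ^ σ * |x| ^ σ := by
      have := Real.rpow_nonneg (abs_nonneg x) σ
      gcongr
    rw [hΛT] at this
    nlinarith [hx]
  have hzR : ∀ᵐ x, R < |x| → barrierSum (exponent γ α β) Λ σ (2 * σ) u x ≤ -1 := by
    filter_upwards [hzT] with x hx hRx
    refine hx ?_
    calc T = R ^ σ := by
          rw [hR, ← Real.rpow_mul (by linarith), one_div_mul_cancel hσ.ne', Real.rpow_one]
      _ ≤ |x| ^ σ := Real.rpow_le_rpow (by linarith) hRx.le hσ.le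
  have hzM : ∀ᵐ x, barrierSum (exponent γ α β) Λ σ (2 * σ) u x ≤ (1 / σ + Λ) * T := by
    filter_upwards [heta, hzT] with x hx hxT
    have n := Real.rpow_nonneg (abs_nonneg x) σ
    rcases le_or_gt T (|x| ^ σ) with hc | hc
    · have : 0 ≤ (1 / σ + Λ) * T := by positivity
      linarith [hxT hc]
    · rw [barrierSum_eq]
      calc eta γ α β u x + Λ * (|x| ^ σ - |x| ^ σ * |x| ^ σ)
          ≤ 1 / σ * |x| ^ σ + Λ * (|x| ^ σ) := by
            gcongr
            nlinarith
        _ = (1 / σ + Λ) * |x| ^ σ := by ring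
        _ ≤ (1 / σ + Λ) * T := by gcongr
  -- Otherwise `u ≤ 1 - 1/p` on `[-1,1]`, where the barrier is nonnegative.
  have hzpos : ¬ ∀ᵐ x, barrierSum (exponent γ α β) Λ σ (2 * σ) u x ≤ -1 := by
    intro hall
    have hmem : 1 - 1 / exponent γ α β ∈
        {m : ℝ | ∀ᵐ x ∂(volume.restrict (Set.Icc (-1 : ℝ) 1)), u x ≤ m} := by
      change ∀ᵐ x ∂(volume.restrict (Set.Icc (-1 : ℝ) 1)), u x ≤ 1 - 1 / exponent γ α β
      rw [ae_restrict_iff' measurableSet_Icc]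
      filter_upwards [hall] with x hx hx1
      rw [barrierSum_eq, eta] at hx
      have n := Real.rpow_nonneg (abs_nonneg x) σ
      have n1 : |x| ^ σ ≤ 1 := Real.rpow_le_one (abs_nonneg x) (abs_le.2 (Set.mem_Icc.1 hx1)) hσ.le
      have n2 : 0 ≤ Λ * (|x| ^ σ - |x| ^ σ * |x| ^ σ) := mul_nonneg hΛ0.le (by nlinarith)
      have : u x - 1 ≤ -1 / exponent γ α β := by
        rw [le_div_iff₀ hp]; linarith
      rw [neg_div] at this
      linarith
    have := h.max_eq_one.2 hmem
    have : 0 < 1 / exponent γ α β := by positivity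
    linarith
  have hFC : ∀ᵐ x, exponent γ α β * source γ α β u x
      - Λ * (powConst γ α σ * |x| ^ (σ - (2 * γ + 2 * α)))
      + Λ * (powConst γ α (2 * σ) * |x| ^ (2 * σ - (2 * γ + 2 * α))) ≤ B := by
    filter_upwards [ae_ne 0, h.pos, hle1, hle2] with x hx0 hx hx1 hx2
    have e : exponent γ α β * source γ α β u x
        = 1 / |x| ^ (β * exponent γ α β) * u x ^ (exponent γ α β - 1) := by
      rw [source]; field_simp
    rw [e]
    exact source_add_barrier_le hγ h1 hα hα1 hαβ hβ hσ hσ4 hq hΛ0 hcσ hK hcτ hx0 hx hx1 hx2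
  exact lintegral_negPart_le (p := exponent γ α β) h0 h1 hα.le hα1 hσ
    (by linarith : 0 < 2 * σ) iσ iτ hR1
    (by positivity : 0 ≤ (1 / σ + Λ) * T) hB0 hum huf h.equation.2
    (integrableOn_source h0 h1 hα hα1 hαβ h.pos h.equation) hFC hzR hzM hzpos

/-- The positive part of `η` and the barrier are bounded by powers, so that a bound for the negative
part of `η + Λ (|x|^σ - |x|^{2σ}) + 1` suffices. -/
theorem integral_eta_le {γ α β σ Λ Q : ℝ} {u : ℝ → ℝ} (hγ : 3 / 8 ≤ γ)
    (h1 : γ < 1 / 2) (hα : 0 < α) (hα1 : α < (1 - 2 * γ) / 2) (hαβ : α < β)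
    (hσ4 : σ ≤ 1 / 4) (hασ : α ≤ σ) (hΛ0 : 0 < Λ) (hQ : 0 ≤ Q)
    (h : IsNormalizedMinimizer γ α β u)
    (hmain : ∫⁻ x, ENNReal.ofReal (max (-1 - barrierSum (exponent γ α β) Λ σ (2 * σ) u x) 0
      / (1 + |x| ^ (1 + 2 * γ + α))) ≤ ENNReal.ofReal Q) :
    ∫ x, |eta γ α β u x| / (1 + |x| ^ (1 + 2 * γ + α))
      ≤ Q + (1 + 2 * Λ + 1 / σ) * ∫ x, weightMajorant (-(5 / 4)) x := by
  have hσ : 0 < σ := hα.trans_le hασ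
  have h0 : 0 < γ := by linarith
  have hum := h.minimizer.1.aemeasurable
  have heta := eta_le h0 h1 hα hα1 hαβ hασ h
  set L := 1 + 2 * Λ + 1 / σ with hL
  have hL0 : 0 ≤ L := by positivity
  have hsq : ∀ x : ℝ, |x| ^ (2 * σ) = |x| ^ σ * |x| ^ σ := fun x => by
    rw [mul_comm, Real.rpow_mul (abs_nonneg x), Real.rpow_two, sq]
  set Ψ : ℝ → ℝ := fun x => max (-1 - barrierSum (exponent γ α β) Λ σ (2 * σ) u x) 0
    / (1 + |x| ^ (1 + 2 * γ + α)) with hΨ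
  have hΨ0 : ∀ x, 0 ≤ Ψ x := fun x => by
    have := Real.rpow_nonneg (abs_nonneg x) (1 + 2 * γ + α)
    have := le_max_right (-1 - barrierSum (exponent γ α β) Λ σ (2 * σ) u x) 0
    positivity
  have hΨm : AEMeasurable Ψ := by
    have hzm : AEMeasurable (barrierSum (exponent γ α β) Λ σ (2 * σ) u) :=
      ((hum.sub_const 1).const_mul _).add (Measurable.aemeasurable (by fun_prop))
    exact ((hzm.const_sub (-1)).max aemeasurable_const).div
      (Measurable.aemeasurable (by fun_prop))
  have iΨ : Integrable Ψ :=
    (lintegral_ofReal_ne_top_iff_integrable hΨm.aestronglyMeasurable (ae_of_all _ hΨ0)).1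
      (hmain.trans_lt ENNReal.ofReal_lt_top).ne
  have hΨle : ∫ x, Ψ x ≤ Q := by
    rw [integral_eq_lintegral_of_nonneg_ae (ae_of_all _ hΨ0) hΨm.aestronglyMeasurable]
    exact ENNReal.toReal_le_of_le_ofReal hQ hmain
  have iG : Integrable (fun x => L * weightMajorant (-(5 / 4)) x) :=
    (integrable_weightMajorant (by norm_num)).const_mul L
  calc ∫ x, |eta γ α β u x| / (1 + |x| ^ (1 + 2 * γ + α))
      ≤ ∫ x, (Ψ x + L * weightMajorant (-(5 / 4)) x) := by
        refine integral_mono_ae (integrable_eta h0 h1 hα hα1 hαβ h) (iΨ.add iG) ?_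
        filter_upwards [heta] with x hx
        have n := Real.rpow_nonneg (abs_nonneg x) σ
        have n2 := Real.rpow_nonneg (abs_nonneg x) (1 + 2 * γ + α)
        have hb : |eta γ α β u x| ≤ max (-1 - barrierSum (exponent γ α β) Λ σ (2 * σ) u x) 0
            + L * (1 + |x| ^ (2 * σ)) := by
          rw [hsq]
          have m1 := le_max_left (-1 - barrierSum (exponent γ α β) Λ σ (2 * σ) u x) 0
          have m2 := le_max_right (-1 - barrierSum (exponent γ α β) Λ σ (2 * σ) u x) 0
          have y1 : |x| ^ σ ≤ 1 + |x| ^ σ * |x| ^ σ := by nlinarith [sq_nonneg (|x| ^ σ - 1)]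
          have y2 : 1 / σ * |x| ^ σ ≤ 1 / σ * (1 + |x| ^ σ * |x| ^ σ) := by gcongr
          have y3 : Λ * |x| ^ σ ≤ Λ * (1 + |x| ^ σ * |x| ^ σ) := by gcongr
          have y4 : 0 ≤ Λ * (1 + |x| ^ σ * |x| ^ σ) := by positivity
          have y5 : 0 ≤ 1 / σ * (1 + |x| ^ σ * |x| ^ σ) := by positivity
          have y6 : 0 ≤ Λ * (|x| ^ σ * |x| ^ σ) := by positivity
          have y7 : 0 ≤ |x| ^ σ * |x| ^ σ := by positivity
          have eL : L * (1 + |x| ^ σ * |x| ^ σ) = 1 + |x| ^ σ * |x| ^ σ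
              + 2 * (Λ * (1 + |x| ^ σ * |x| ^ σ)) + 1 / σ * (1 + |x| ^ σ * |x| ^ σ) := by
            rw [hL]; ring
          rw [eL, abs_le]
          rw [barrierSum_eq, mul_sub] at m1
          rw [barrierSum_eq, mul_sub] at m2 ⊢
          constructor
          · linarith
          · linarith [hx]
        calc |eta γ α β u x| / (1 + |x| ^ (1 + 2 * γ + α))
            ≤ (max (-1 - barrierSum (exponent γ α β) Λ σ (2 * σ) u x) 0
              + L * (1 + |x| ^ (2 * σ))) / (1 + |x| ^ (1 + 2 * γ + α)) := by gcongr
          _ = Ψ x + L * ((1 + |x| ^ (2 * σ)) / (1 + |x| ^ (1 + 2 * γ + α))) := by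
            rw [hΨ]; ring
          _ ≤ Ψ x + L * weightMajorant (-(5 / 4)) x := by
            gcongr
            exact div_le_weightMajorant (by linarith) (by linarith) x
    _ = (∫ x, Ψ x) + L * ∫ x, weightMajorant (-(5 / 4)) x := by
        rw [integral_add iΨ iG, integral_const_mul]
    _ ≤ _ := by gcongr

/-- The bound, uniform over all parameters for which the barrier with exponents `σ` and `2σ` works. -/
theorem exists_integral_eta_le {σ : ℝ} (hσ : 0 < σ) (hσ4 : σ ≤ 1 / 4) : ∃ C : ℝ, ∀ γ α β u,
    3 / 8 ≤ γ → γ < 1 / 2 → 0 < α → α < (1 - 2 * γ) / 2 → α < β → β < α + γ → α ≤ 1 / 8 → α ≤ σ →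
    β * exponent γ α β ≤ 2 * γ - σ → IsNormalizedMinimizer γ α β u →
    ∫ x, |eta γ α β u x| / (1 + |x| ^ (1 + 2 * γ + α)) ≤ C := by
  obtain ⟨K, hK, hpow⟩ := exists_powConst_le
  set c := ((2 : ℝ) ^ σ - 1) * (1 - 2 ^ (-σ)) / 24 with hc
  have hc0 : 0 < c := by
    have h1 : (1 : ℝ) < 2 ^ σ := Real.one_lt_rpow (by norm_num) hσ
    have h2 : (2 : ℝ) ^ (-σ) < 1 := Real.rpow_lt_one_of_one_lt_of_neg (by norm_num) (by linarith)
    have := mul_pos (sub_pos.2 h1) (sub_pos.2 h2)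
    positivity
  -- With this factor the barrier beats the right-hand side near the origin.
  set Λ := 2 / c with hΛ
  have hΛ0 : 0 < Λ := by positivity
  -- For `|x|^σ ≥ T` the term `-Λ |x|^{2σ}` outweighs the others.
  set T := (1 / σ + Λ + 1) / Λ with hT
  have hσi : 0 < 1 / σ := by positivity
  have hΛT : Λ * T = 1 / σ + Λ + 1 := by rw [hT]; field_simp
  have hT1 : 1 ≤ T := by rw [hT, le_div_iff₀ hΛ0]; linarith
  refine ⟨8 * (T ^ (1 / σ)) ^ 3 * ((Λ * K + 1) ^ (1 / σ) * (Λ * K + 1) + 1 + (Λ * K + 1))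
    + (1 + 2 * Λ + 1 / σ) * ∫ x, weightMajorant (-(5 / 4)) x, ?_⟩
  intro γ α β u hγ h1 hα hα1 hαβ hβ hα8 hασ hq h
  have h0 : 0 < γ := by linarith
  have iσ : Integrable (fun s => (|s| ^ σ - 1) * kernel γ α 1 s) :=
    integrable_powConst h0 h1 hα.le (by linarith) (by rw [abs_of_pos hσ]; linarith)
      (by linarith) (by linarith)
  have iτ : Integrable (fun s => (|s| ^ (2 * σ) - 1) * kernel γ α 1 s) :=
    integrable_powConst h0 h1 hα.le (by linarith) (by rw [abs_of_pos (by linarith)]; linarith)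
      (by linarith) (by linarith)
  have hcσ : 2 ≤ Λ * powConst γ α σ := by
    have := le_powConst h0 h1 (by linarith) hσ (by linarith) iσ
    calc (2 : ℝ) = Λ * c := by rw [hΛ]; field_simp
      _ ≤ _ := by gcongr
  have hcτ : powConst γ α (2 * σ) ≤ K :=
    hpow γ α (2 * σ) hγ h1 hα.le hα8 (by linarith) (by linarith) (by linarith) iτ
  exact integral_eta_le hγ h1 hα hα1 hαβ hσ4 hασ hΛ0 (by positivity) h
    (lintegral_negPart_barrierSum_le hγ h1 hα hα1 hαβ hβ hσ4 hασ hq h hΛ0 hcσ hK hcτ hT1 hΛT)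

end CKN

end

theorem lemma4p6
    (ε γ α β : ℕ → ℝ) (u : ℕ → ℝ → ℝ) (a b : ℝ)
    (hε_pos : ∀ k, 0 < ε k) (hε : Tendsto ε atTop (𝓝 0))
    (hγ_mem : ∀ k, 0 < γ k ∧ γ k < 1 / 2) (hγ : Tendsto γ atTop (𝓝 (1 / 2)))
    (hα : ∀ k, 0 < α k ∧ α k < min (β k) ((1 - 2 * γ k) / 2))
    (hβ_lt : ∀ k, β k < α k + γ k) (hβ : Tendsto β atTop (𝓝 0))
    (ha : 0 < a)
    (hεp : Tendsto (fun k => ε k * CKN.exponent (γ k) (α k) (β k)) atTop (𝓝 a))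
    (hb : 0 ≤ b ∧ b < 1)
    (hβp : Tendsto (fun k => β k * CKN.exponent (γ k) (α k) (β k)) atTop (𝓝 b))
    (hu : ∀ k, CKN.IsNormalizedMinimizer (γ k) (α k) (β k) (u k)) :
    ∃ C : ℝ, ∀ k,
      Integrable (fun x : ℝ =>
        |CKN.eta (γ k) (α k) (β k) (u k) x| / (1 + |x| ^ (1 + 2 * γ k + α k))) ∧
      ∫ x : ℝ, |CKN.eta (γ k) (α k) (β k) (u k) x| / (1 + |x| ^ (1 + 2 * γ k + α k)) ≤ C := by
  have hαβ : ∀ k, α k < β k := fun k => (hα k).2.trans_le (min_le_left _ _)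
  have hα1 : ∀ k, α k < (1 - 2 * γ k) / 2 := fun k => (hα k).2.trans_le (min_le_right _ _)
  have hσ : 0 < (1 - b) / 4 := by linarith [hb.2]
  have hσ4 : (1 - b) / 4 ≤ 1 / 4 := by linarith [hb.1]
  -- In the limit `β p → b` and `2γ → 1`, so `β p ≤ 2γ - σ` eventually holds for `σ = (1 - b) / 4`.
  obtain ⟨C, hC⟩ := CKN.exists_integral_eta_le hσ hσ4
  have hγ' : ∀ᶠ k in atTop, max (3 / 8) (1 / 2 - (1 - b) / 8) < γ k :=
    hγ.eventually_const_lt (max_lt (by norm_num) (by linarith))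
  have hβ' : ∀ᶠ k in atTop, β k < min (1 / 8) ((1 - b) / 4) :=
    hβ.eventually_lt_const (lt_min (by norm_num) hσ)
  have hβp' : ∀ᶠ k in atTop, β k * CKN.exponent (γ k) (α k) (β k) < b + (1 - b) / 4 :=
    hβp.eventually_lt_const (by linarith)
  obtain ⟨N, hN⟩ := eventually_atTop.1 (hγ'.and (hβ'.and hβp'))
  set I : ℕ → ℝ := fun k =>
    ∫ x : ℝ, |CKN.eta (γ k) (α k) (β k) (u k) x| / (1 + |x| ^ (1 + 2 * γ k + α k)) with hI
  refine ⟨max C (∑ k ∈ Finset.range N, |I k|), fun k => ⟨CKN.integrable_eta (hγ_mem k).1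
    (hγ_mem k).2 (hα k).1 (hα1 k) (hαβ k) (hu k), ?_⟩⟩
  rcases lt_or_ge k N with hk | hk
  · refine le_max_of_le_right (le_trans (le_abs_self (I k)) ?_)
    exact Finset.single_le_sum (f := fun k => |I k|) (fun _ _ => abs_nonneg _)
      (Finset.mem_range.2 hk)
  · obtain ⟨k1, k2, k3⟩ := hN k hk
    obtain ⟨k1, k4⟩ := max_lt_iff.1 k1
    obtain ⟨k2, k5⟩ := lt_min_iff.1 k2
    refine le_max_of_le_left (hC _ _ _ _ k1.le (hγ_mem k).2 (hα k).1 (hα1 k) (hαβ k) (hβ_lt k)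
      ?_ ?_ ?_ (hu k))
    · linarith [hαβ k]
    · linarith [hαβ k]
    · linarith
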